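/- **Model.** Types $x$ lie in $X=[\underline x,\bar x]$ with $0\le\underline x<\bar x<\infty$, and the principal has funds $\tau>0$. The cost functions $c_A,c_P:[0,1]\to\mathbb R$ are strictly increasing and strictly convex, differentiable on $[0,1]$ and thrice differentiable on $(0,1]$, with $c_A(0)=c_P(0)=c_A'(0)=c_P'(0)=0$. Assume $\tau\ge c_A'(1)>c_P(1)$; that for all $e\in(0,1]$, $c_A''(e)>0$ and $$\frac{\underline x+\tau}{c_P'(1)}+e>e(1-e)\frac{c_A'''(e)}{c_A''(e)}+1-e;$$ and that $e\mapsto e\,c_A'(e)$ is strictly convex on $[0,1]$. Write $u_A(e)=e\,c_A'(e)-c_A(e)$. **Mechanisms.** A tax mechanism $m=(e_A,e_P,r_A,r_P,r_\emptyset)$ consists of real functions on $X$; it is feasible if $e_A(y),e_P(y)\in[0,1]$ and $r_A(y),r_P(y),r_\emptyset(y)\in[0,y+\tau]$ for all $y$. Put $R_{NA}(x)=e_P(x)r_P(x)+(1-e_P(x))r_\emptyset(x)$, the evidence rent $V_m(x)=e_A(x)(r_A(x)-R_{NA}(x))-c_A(e_A(x))$, the agent's utility $U_m(x)=R_{NA}(x)+V_m(x)$,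 the loss function $$\lambda_m(x)=\inf_{y\in[\underline x,x]}\; e_P(y)x+(1-e_P(y))(y-r_\emptyset(y)),$$ and the profit $\Pi_m(x)=x-R_{NA}(x)-V_m(x)-c_A(e_A(x))-(1-e_A(x))c_P(e_P(x))$. A feasible $m$ is incentive compatible if for every $x\in X$, $e_A(x)$ maximizes $e\,(r_A(x)-R_{NA}(x))-c_A(e)$ over $e\in[0,1]$ and $U_m(x)\ge x-\lambda_m(x)$. From now on, mechanisms are feasible and incentive compatible. Two mechanisms are identified if they differ only in $r_P$ at types with $e_P=0$ and in $r_\emptyset$ at types with $e_P=1$ (refunds that are never paid). A mechanism $m$ is tight if every mechanism $m'$ with $\Pi_m\le\Pi_{m'}$ and $\lambda_m\le\lambda_{m'}$ pointwise on $X$ has $\Pi_m=\Pi_{m'}$ and $\lambda_m=\lambda_{m'}$. It has random audits if $e_P(x)\in(0,1)$ for some $x\in X$. The efficient agent effort $e_A^{\mathrm{eff}}(x)$ is the unique minimizer over $e\in[0,1]$ of $c_A(e)+(1-e)c_P(e_P(x))$. **Theorem 1.** Let $m$ be a tight mechanism with random audits. Then $V_m(x)=u_A(e_A(x))$ for all $x\in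 X$, and there are five consecutive intervals $SL,L,M,H,SH$ (SuperLow, Low, Middle, High, SuperHigh; consecutive means $\sup SL=\inf L$, $\sup L=\inf M$, $\sup M=\inf H$, $\sup H=\inf SH$), each with non-empty interior, that partition $\{x\in X: e_P(x)\in(0,1)\}$ and such that: 1. The principal's effort $e_P$ is $1$ on $[\underline x,\inf SL)$; decreasing on $X$, strictly so on $SL\cup L\cup M\cup H$; $0$ on $[\sup SH,\bar x]$; and continuous on $X$ except possibly at $\inf SL$, where it is right-continuous. 2. The agent's effort $e_A$ is constant on $[\underline x,\inf SL)$; strictly decreasing on each of $SL,M,SH$ and strictly increasing on each of $L,H$; $0$ on $[\sup SH,\bar x]$; strictly below $e_A^{\mathrm{eff}}$ on $[\underline x,\inf M)$, equal to $e_A^{\mathrm{eff}}$ on $M$, strictly above $e_A^{\mathrm{eff}}$ on $(\sup M,\sup SH)$ and equal to $e_A^{\mathrm{eff}}$ on $[\sup SH,\bar x]$; and continuous on $X$ except possibly at $\inf SL$, where it is right-continuous. 3. For some mechanism identified with $m$: $r_\emptyset$ is increasing, and $r_\emptyset(y)>0$ iff $y>\inf SH$; $r_P$ is increasing, $r_P(y)>0$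 iff $y>\inf M$, and $r_P(y)=y+\tau$ iff $y\ge\sup M$. 4. The utility $U_m$ is v-shaped: decreasing on $[\underline x,\sup SL]$, constant on $[\underline x,\inf SL]\setminus SL$ (that is, on $[\underline x,\inf SL)$, and also up to and including $\inf SL$ unless $\inf SL\in SL$), strictly decreasing on $SL$, and strictly increasing on $[\sup SL,\bar x]$. Moreover $\inf_X U_m>0$. 5. $U_m(y)>y-\lambda_m(y)$ for $y\in[\underline x,\sup SL)$, and $U_m(y)=y-\lambda_m(y)$ for $y\in[\sup SL,\bar x]$. 6. The profit $\Pi_m$ is increasing on $X$. (Increasing and decreasing are meant weakly unless qualified by "strictly".) -/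

import Mathlib

open Set

noncomputable section

/-- The derivative of a function of an effort level, taken relative to the effort domain `[0, 1]`
(so it is one-sided at the end points). -/
def effortDeriv (c : ℝ → ℝ) : ℝ → ℝ := derivWithin c (Icc 0 1)

/-- Effort cost functions on `[0, 1]`: strictly increasing and strictly convex, with
`c 0 = c' 0 = 0`, differentiable on `[0, 1]` and three times differentiable at positive efforts
(so that costs such as `e ^ 1.01` are included). -/
structure IsEffortCost (c : ℝ → ℝ) : Prop where
  strictMonoOn : StrictMonoOn c (Icc 0 1)
  strictConvexOn : StrictConvexOn ℝ (Icc 0 1) c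
  differentiableOn : DifferentiableOn ℝ c (Icc 0 1)
  differentiableOn_deriv : DifferentiableOn ℝ (effortDeriv c) (Ioc 0 1)
  differentiableOn_deriv_deriv : DifferentiableOn ℝ (effortDeriv (effortDeriv c)) (Ioc 0 1)
  map_zero : c 0 = 0
  deriv_zero : effortDeriv c 0 = 0

/-- The primitives of the model: the type space `[xlo, xhi]`, the principal's funds `τ`, and the
cost functions of the agent and of the principal for acquiring evidence. -/
structure AuditEnv where
  xlo : ℝ
  xhi : ℝ
  τ : ℝ
  cA : ℝ → ℝ
  cP : ℝ → ℝ

/-- The type space. -/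
def AuditEnv.types (E : AuditEnv) : Set ℝ := Icc E.xlo E.xhi

/-- The rent from agent effort, `u_A(e) = e c_A'(e) - c_A(e)`. -/
def AuditEnv.uA (E : AuditEnv) (e : ℝ) : ℝ := e * effortDeriv E.cA e - E.cA e

/-- The standing assumptions on the primitives. -/
structure AuditEnv.Admissible (E : AuditEnv) : Prop where
  xlo_nonneg : 0 ≤ E.xlo
  xlo_lt_xhi : E.xlo < E.xhi
  τ_pos : 0 < E.τ
  cost_A : IsEffortCost E.cA
  cost_P : IsEffortCost E.cP
  /-- `τ ≥ c_A'(1) > c_P(1)`. -/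
  funds : effortDeriv E.cA 1 ≤ E.τ
  audit_cost : E.cP 1 < effortDeriv E.cA 1
  /-- `c_A''` does not vanish at positive efforts, so the ratio `c_A''' / c_A''` is defined. -/
  curvature_pos : ∀ e ∈ Ioc (0 : ℝ) 1, 0 < effortDeriv (effortDeriv E.cA) e
  regularity : ∀ e ∈ Ioc (0 : ℝ) 1,
    e * (1 - e) * (effortDeriv (effortDeriv (effortDeriv E.cA)) e
        / effortDeriv (effortDeriv E.cA) e) + (1 - e)
      < (E.xlo + E.τ) / effortDeriv E.cP 1 + e
  rent_regularity : StrictConvexOn ℝ (Icc 0 1) (fun e => e * effortDeriv E.cA e)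

/-- A tax mechanism: recommended agent effort, principal effort (audit probability), and the
refunds after evidence by the agent, after evidence by the principal, and after no evidence.
Only the values on the type space matter. -/
structure TaxMechanism where
  eA : ℝ → ℝ
  eP : ℝ → ℝ
  rA : ℝ → ℝ
  rP : ℝ → ℝ
  rN : ℝ → ℝ

namespace TaxMechanism

variable (E : AuditEnv) (m : TaxMechanism)

/-- Efforts are probabilities and refunds are between `0` and the advance payment plus the
principal's funds. -/
def Feasible : Prop :=
  ∀ y ∈ E.types, m.eA y ∈ Icc (0 : ℝ) 1 ∧ m.eP y ∈ Icc (0 : ℝ) 1 ∧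
    m.rA y ∈ Icc 0 (y + E.τ) ∧ m.rP y ∈ Icc 0 (y + E.τ) ∧ m.rN y ∈ Icc 0 (y + E.τ)

/-- Expected refund of a truthful type if the agent provides no evidence. -/
def RNA (x : ℝ) : ℝ := m.eP x * m.rP x + (1 - m.eP x) * m.rN x

/-- Extra refund of a truthful type from acquiring evidence with the recommended effort, net of
the effort cost. -/
def evidenceRent (x : ℝ) : ℝ := m.eA x * (m.rA x - m.RNA x) - E.cA (m.eA x)

/-- Interim utility of type `x` from advancing the full surplus and obeying. -/
def utility (x : ℝ) : ℝ := m.RNA x + m.evidenceRent E x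

/-- Loss of type `x` from advancing `y` and not providing evidence, when the principal seizes
everything after acquiring evidence. -/
def deviationLoss (x y : ℝ) : ℝ := m.eP y * x + (1 - m.eP y) * (y - m.rN y)

/-- The loss function `λ_m`. -/
def loss (x : ℝ) : ℝ := sInf (m.deviationLoss x '' Icc E.xlo x)

/-- The recommended effort is a best response of the truthful agent. -/
def Obedient : Prop :=
  ∀ x ∈ E.types, ∀ e ∈ Icc (0 : ℝ) 1,
    e * (m.rA x - m.RNA x) - E.cA e ≤ m.eA x * (m.rA x - m.RNA x) - E.cA (m.eA x)

/-- Feasible incentive compatible mechanisms. -/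
structure IsMechanism : Prop where
  feasible : m.Feasible E
  obedient : m.Obedient E
  truthful : ∀ x ∈ E.types, x - m.loss E x ≤ m.utility E x

/-- The principal's expected profit from type `x`. -/
def profit (x : ℝ) : ℝ :=
  x - m.RNA x - m.evidenceRent E x - E.cA (m.eA x) - (1 - m.eA x) * E.cP (m.eP x)

/-- `m'.TighterThan E m`: both the profit and the loss function of `m'` are pointwise above those
of `m`. -/
def TighterThan (m' m : TaxMechanism) : Prop :=
  ∀ x ∈ E.types, m.profit E x ≤ m'.profit E x ∧ m.loss E x ≤ m'.loss E x

/-- A mechanism is tight if every mechanism that is tighter has the same profit and the same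
loss function. -/
def Tight : Prop :=
  m.IsMechanism E ∧ ∀ m' : TaxMechanism, m'.IsMechanism E → TighterThan E m' m →
    ∀ x ∈ E.types, m.profit E x = m'.profit E x ∧ m.loss E x = m'.loss E x

/-- The audit probability is interior for at least one type. -/
def RandomAudits : Prop := ∃ x ∈ E.types, m.eP x ∈ Ioo (0 : ℝ) 1

/-- Two mechanisms are identified if they differ only in refunds that are never paid because the
principal's effort is `0` (for `rP`) or `1` (for `rN`). -/
def Identified (m m' : TaxMechanism) : Prop :=
  ∀ x ∈ E.types, m'.eA x = m.eA x ∧ m'.eP x = m.eP x ∧ m'.rA x = m.rA x ∧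
    (m.eP x ≠ 0 → m'.rP x = m.rP x) ∧ (m.eP x ≠ 1 → m'.rN x = m.rN x)

/-- `e` is the efficient agent effort at type `x`: the unique minimizer over `[0, 1]` of the
agent's effort cost plus the principal's expected effort cost. -/
def IsEfficientEffort (x e : ℝ) : Prop :=
  e ∈ Icc (0 : ℝ) 1 ∧ ∀ e' ∈ Icc (0 : ℝ) 1, e' ≠ e →
    E.cA e + (1 - e) * E.cP (m.eP x) < E.cA e' + (1 - e') * E.cP (m.eP x)

end TaxMechanism

end

/-! Fix the loss function λ of a tight mechanism. Incentive compatibility then separates across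
types: the contract of y must leave the agent at least y - λ(y), and its deviation line, affine in
the deviating type w ≥ y, must lie above λ. Contracts chosen type by type under these conditions
form a mechanism whose loss function is at least λ. Tightness therefore says that each contract
maximizes profit given λ (`Tight.profit_le`) and that λ cannot be raised without a loss of profit
(`Tight.eq_of_forall_exists`). It follows that λ is nondecreasing, 1-Lipschitz and, as an infimum of
lines, concave.

With the smallest possible refunds only the efforts e and p remain (`Tight.reducedSolution`). They
minimize max(y - λ(y), u_A(e)) + c_A(e) + (1 - e) c_P(p) under two constraints. The line through (y,
y) with slope p must lie above λ, that is, p ≥ P(y) with P = `minSlope`. And, because refunds after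
evidence are capped, the rent constraint Φ(p) ≤ λ(y) + u_A(e) must hold, where Φ = `supportValue`
gives the value at -τ of the supporting line of λ with slope p.

The gap g(y) = y - λ(y) is convex and vanishes up to a last fixed point y₀ of λ, below which p = 1.
Above y₀ and while the rent constraint does not distort efforts, p = P(y), and the kink of the
objective yields three regimes: the effort that minimizes rent plus costs (SuperLow), the effort
with u_A(e) = g(y) (Low), and the efficient effort (Middle). They come in this order since g
increases while the relevant rents fall with P (`exists_thresholds`).

Once the efficient effort violates the rent constraint, the constraint binds (`supportValue_eq`). In
High, p = P(y) and u_A(e) = g(y) - P(y)(y + τ) increases. In SuperHigh, p > P(y) and the two efforts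
are traded off along Φ. The resulting one-sided first-order conditions involve `auditGain`, which
the regularity assumption makes decreasing in e; hence a higher p comes with a higher e
(`eA_lt_of_eP_lt`), and the binding constraint then forces both to fall in y. The same comparison
puts High before SuperHigh (`exists_last_eP_eq`). Where λ has reached its maximum, both efforts are
zero. -/

noncomputable section

/-! ### Derivatives of strictly convex functions on the effort interval -/

section StrictConvex

variable {f : ℝ → ℝ}

theorem StrictConvexOn.tangent_lt_of_ne (hf : StrictConvexOn ℝ (Icc 0 1) f)
    (hd : DifferentiableOn ℝ f (Icc 0 1)) {x y : ℝ} (hx : x ∈ Icc (0 : ℝ) 1)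
    (hy : y ∈ Icc (0 : ℝ) 1) (hxy : x ≠ y) : f y + effortDeriv f y * (x - y) < f x := by
  rcases lt_or_gt_of_ne hxy with h | h
  · have := hf.slope_lt_derivWithin hx hy h (hd y hy)
    rw [slope_def_field, div_lt_iff₀ (by linarith)] at this
    unfold effortDeriv
    linarith
  · have := hf.derivWithin_lt_slope hy hx h (hd y hy)
    rw [slope_def_field, lt_div_iff₀ (by linarith)] at this
    unfold effortDeriv
    linarith

theorem StrictConvexOn.effortDeriv_strictMonoOn (hf : StrictConvexOn ℝ (Icc 0 1) f)
    (hd : DifferentiableOn ℝ f (Icc 0 1)) : StrictMonoOn (effortDeriv f) (Icc 0 1) :=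
  hf.strictMonoOn_derivWithin hd

theorem StrictConvexOn.sub_mul_strictAntiOn (hf : StrictConvexOn ℝ (Icc 0 1) f)
    (hd : DifferentiableOn ℝ f (Icc 0 1)) {e s : ℝ} (he : e ∈ Icc (0 : ℝ) 1)
    (hs : effortDeriv f e = s) : StrictAntiOn (fun x => f x - s * x) (Icc 0 e) := by
  intro x hx y hy hxy
  have hx' : x ∈ Icc (0 : ℝ) 1 := ⟨hx.1, hx.2.trans he.2⟩
  have hy' : y ∈ Icc (0 : ℝ) 1 := ⟨hy.1, hy.2.trans he.2⟩
  have h1 := hf.tangent_lt_of_ne hd hx' hy' hxy.ne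
  have h2 : effortDeriv f y ≤ s := hs ▸ (hf.effortDeriv_strictMonoOn hd).monotoneOn hy' he hy.2
  show f y - s * y < f x - s * x
  nlinarith

theorem StrictConvexOn.sub_mul_strictMonoOn (hf : StrictConvexOn ℝ (Icc 0 1) f)
    (hd : DifferentiableOn ℝ f (Icc 0 1)) {e s : ℝ} (he : e ∈ Icc (0 : ℝ) 1)
    (hs : effortDeriv f e = s) : StrictMonoOn (fun x => f x - s * x) (Icc e 1) := by
  intro x hx y hy hxy
  have hx' : x ∈ Icc (0 : ℝ) 1 := ⟨he.1.trans hx.1, hx.2⟩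
  have hy' : y ∈ Icc (0 : ℝ) 1 := ⟨he.1.trans hy.1, hy.2⟩
  have h1 := hf.tangent_lt_of_ne hd hy' hx' hxy.ne'
  have h2 : s ≤ effortDeriv f x := hs ▸ (hf.effortDeriv_strictMonoOn hd).monotoneOn he hx' hx.1
  show f x - s * x < f y - s * y
  nlinarith

/-- Darboux's theorem; no continuity of the derivative is needed. -/
theorem StrictConvexOn.exists_effortDeriv_eq (hd : DifferentiableOn ℝ f (Icc 0 1)) {s : ℝ}
    (h0 : effortDeriv f 0 ≤ s) (h1 : s ≤ effortDeriv f 1) :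
    ∃ e ∈ Icc (0 : ℝ) 1, effortDeriv f e = s := by
  obtain ⟨e, he, h⟩ := exists_hasDerivWithinAt_eq_of_ge_of_le (f := f) (f' := effortDeriv f)
    (zero_le_one) (fun x hx => (hd x hx).hasDerivWithinAt) h0 h1
  exact ⟨e, he, h⟩

end StrictConvex

/-- An injective strictly monotone reparametrisation detects continuity. -/
theorem StrictMonoOn.continuousWithinAt_of_comp {f e : ℝ → ℝ} {s : Set ℝ} {y₀ : ℝ}
    (hf : StrictMonoOn f (Icc 0 1)) (he : ∀ y ∈ s, e y ∈ Icc (0 : ℝ) 1) (hy₀ : y₀ ∈ s)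
    (hc : ContinuousWithinAt (fun y => f (e y)) s y₀) : ContinuousWithinAt e s y₀ := by
  have h0 := he y₀ hy₀
  refine tendsto_order.2 ⟨fun a ha => ?_, fun a ha => ?_⟩
  · by_cases ha0 : a < 0
    · filter_upwards [self_mem_nhdsWithin] with y hy
      exact ha0.trans_le (he y hy).1
    · have haI : a ∈ Icc (0 : ℝ) 1 := ⟨not_lt.1 ha0, ha.le.trans h0.2⟩
      filter_upwards [self_mem_nhdsWithin, (tendsto_order.1 hc).1 _ (hf haI h0 ha)] with y hy h
      exact (hf.lt_iff_lt haI (he y hy)).1 h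
  · by_cases ha1 : 1 < a
    · filter_upwards [self_mem_nhdsWithin] with y hy
      exact (he y hy).2.trans_lt ha1
    · have haI : a ∈ Icc (0 : ℝ) 1 := ⟨h0.1.trans ha.le, not_lt.1 ha1⟩
      filter_upwards [self_mem_nhdsWithin, (tendsto_order.1 hc).2 _ (hf h0 haI ha)] with y hy h
      exact (hf.lt_iff_lt (he y hy) haI).1 h

theorem zero_mem_effort : (0 : ℝ) ∈ Icc (0 : ℝ) 1 := ⟨le_rfl, zero_le_one⟩

theorem one_mem_effort : (1 : ℝ) ∈ Icc (0 : ℝ) 1 := ⟨zero_le_one, le_rfl⟩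

/-! ### Cost functions and marginal costs -/

namespace IsEffortCost

variable {c : ℝ → ℝ} {e : ℝ}

theorem nonneg (hc : IsEffortCost c) (he : e ∈ Icc (0 : ℝ) 1) : 0 ≤ c e := by
  have := hc.strictMonoOn.monotoneOn zero_mem_effort he he.1
  rwa [hc.map_zero] at this

theorem pos (hc : IsEffortCost c) (he : e ∈ Icc (0 : ℝ) 1) (h : 0 < e) : 0 < c e := by
  have := hc.strictMonoOn zero_mem_effort he h
  rwa [hc.map_zero] at this

theorem deriv_strictMonoOn (hc : IsEffortCost c) : StrictMonoOn (effortDeriv c) (Icc 0 1) :=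
  hc.strictConvexOn.effortDeriv_strictMonoOn hc.differentiableOn

theorem deriv_pos (hc : IsEffortCost c) (he : e ∈ Icc (0 : ℝ) 1) (h : 0 < e) :
    0 < effortDeriv c e := by
  have := hc.deriv_strictMonoOn zero_mem_effort he h
  rwa [hc.deriv_zero] at this

theorem deriv_nonneg (hc : IsEffortCost c) (he : e ∈ Icc (0 : ℝ) 1) :
    0 ≤ effortDeriv c e := by
  have := hc.deriv_strictMonoOn.monotoneOn zero_mem_effort he he.1
  rwa [hc.deriv_zero] at this

theorem deriv_le_one (hc : IsEffortCost c) (he : e ∈ Icc (0 : ℝ) 1) :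
    effortDeriv c e ≤ effortDeriv c 1 :=
  hc.deriv_strictMonoOn.monotoneOn he one_mem_effort he.2

theorem hasDerivWithinAt (hc : IsEffortCost c) (he : e ∈ Icc (0 : ℝ) 1) :
    HasDerivWithinAt c (effortDeriv c e) (Icc 0 1) e :=
  (hc.differentiableOn e he).hasDerivWithinAt

theorem hasDerivAt (hc : IsEffortCost c) (he : e ∈ Ioo (0 : ℝ) 1) :
    HasDerivAt c (effortDeriv c e) e :=
  (hc.hasDerivWithinAt ⟨he.1.le, he.2.le⟩).hasDerivAt (Icc_mem_nhds he.1 he.2)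

end IsEffortCost

theorem hasDerivWithinAt_effortDeriv {f : ℝ → ℝ} {e : ℝ} (hf : DifferentiableOn ℝ f (Ioc 0 1))
    (he : e ∈ Ioc (0 : ℝ) 1) : HasDerivWithinAt f (effortDeriv f e) (Icc 0 1) e := by
  refine DifferentiableWithinAt.hasDerivWithinAt ((hf e he).mono_of_mem_nhdsWithin ?_)
  have : Ioc (0 : ℝ) 1 = Icc 0 1 ∩ Ioi 0 := by
    ext x; simp only [mem_Ioc, mem_inter_iff, mem_Icc, mem_Ioi]
    constructor
    · rintro ⟨h, h'⟩; exact ⟨⟨h.le, h'⟩, h⟩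
    · rintro ⟨⟨_, h'⟩, h⟩; exact ⟨h, h'⟩
  rw [this]
  exact inter_mem_nhdsWithin _ (Ioi_mem_nhds he.1)

namespace IsEffortCost

variable {c : ℝ → ℝ} {e : ℝ}

theorem hasDerivWithinAt_deriv (hc : IsEffortCost c) (he : e ∈ Ioc (0 : ℝ) 1) :
    HasDerivWithinAt (effortDeriv c) (effortDeriv (effortDeriv c) e) (Icc 0 1) e :=
  hasDerivWithinAt_effortDeriv hc.differentiableOn_deriv he

theorem hasDerivAt_deriv (hc : IsEffortCost c) (he : e ∈ Ioo (0 : ℝ) 1) :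
    HasDerivAt (effortDeriv c) (effortDeriv (effortDeriv c) e) e :=
  (hc.hasDerivWithinAt_deriv ⟨he.1, he.2.le⟩).hasDerivAt (Icc_mem_nhds he.1 he.2)

theorem hasDerivAt_deriv_deriv (hc : IsEffortCost c) (he : e ∈ Ioo (0 : ℝ) 1) :
    HasDerivAt (effortDeriv (effortDeriv c)) (effortDeriv (effortDeriv (effortDeriv c)) e) e :=
  (hasDerivWithinAt_effortDeriv hc.differentiableOn_deriv_deriv ⟨he.1, he.2.le⟩).hasDerivAt
    (Icc_mem_nhds he.1 he.2)

/-- Only 0 needs an argument, since `c'` need not be differentiable there: Darboux supplies an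
effort with small marginal cost, and monotonicity carries the bound to all smaller efforts. -/
theorem continuousOn_deriv (hc : IsEffortCost c) : ContinuousOn (effortDeriv c) (Icc 0 1) := by
  intro e he
  rcases he.1.eq_or_lt with rfl | h
  · refine tendsto_order.2 ⟨fun a ha => ?_, fun a ha => ?_⟩
    · filter_upwards [self_mem_nhdsWithin] with x hx
      exact ha.trans_le (by rw [hc.deriv_zero]; exact hc.deriv_nonneg hx)
    · rw [hc.deriv_zero] at ha
      obtain ⟨x, hx, hxa⟩ := StrictConvexOn.exists_effortDeriv_eq hc.differentiableOn
        (s := min (a / 2) (effortDeriv c 1))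
        (by rw [hc.deriv_zero]; exact le_min (by linarith) (hc.deriv_nonneg one_mem_effort))
        (min_le_right _ _)
      have hx0 : 0 < x := by
        rcases hx.1.eq_or_lt with rfl | h
        · rw [hc.deriv_zero] at hxa
          have := hc.deriv_pos one_mem_effort one_pos
          have : 0 < min (a / 2) (effortDeriv c 1) := lt_min (by linarith) this
          linarith
        · exact h
      filter_upwards [inter_mem_nhdsWithin (Icc (0 : ℝ) 1) (Iio_mem_nhds hx0)] with y hy
      have h1 := hc.deriv_strictMonoOn hy.1 hx hy.2
      have h2 := min_le_left (a / 2) (effortDeriv c 1)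
      linarith
  · exact (hc.hasDerivWithinAt_deriv ⟨h, he.2⟩).continuousWithinAt

end IsEffortCost

/-! ### Agent rents, and the two efforts with prescribed marginal cost or marginal reward -/

namespace AuditEnv

variable {E : AuditEnv} {e s : ℝ}

theorem Admissible.xlo_mem (hE : E.Admissible) : E.xlo ∈ E.types := ⟨le_rfl, hE.xlo_lt_xhi.le⟩

theorem Admissible.xhi_mem (hE : E.Admissible) : E.xhi ∈ E.types := ⟨hE.xlo_lt_xhi.le, le_rfl⟩

theorem Admissible.uA_zero (hE : E.Admissible) : E.uA 0 = 0 := by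
  simp [uA, hE.cost_A.map_zero]

theorem Admissible.uA_strictMonoOn (hE : E.Admissible) : StrictMonoOn E.uA (Icc 0 1) := by
  intro x hx y hy hxy
  have h1 := hE.cost_A.strictConvexOn.tangent_lt_of_ne hE.cost_A.differentiableOn hx hy hxy.ne
  have h2 := hE.cost_A.deriv_strictMonoOn hx hy hxy
  unfold uA
  nlinarith [hx.1]

theorem Admissible.uA_nonneg (hE : E.Admissible) (he : e ∈ Icc (0 : ℝ) 1) : 0 ≤ E.uA e := by
  have := hE.uA_strictMonoOn.monotoneOn zero_mem_effort he he.1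
  rwa [hE.uA_zero] at this

theorem Admissible.uA_pos (hE : E.Admissible) (he : e ∈ Icc (0 : ℝ) 1) (h : 0 < e) :
    0 < E.uA e := by
  have := hE.uA_strictMonoOn zero_mem_effort he h
  rwa [hE.uA_zero] at this

theorem Admissible.uA_continuousOn (hE : E.Admissible) : ContinuousOn E.uA (Icc 0 1) :=
  (continuousOn_id.mul hE.cost_A.continuousOn_deriv).sub hE.cost_A.differentiableOn.continuousOn

theorem Admissible.uA_hasDerivAt (hE : E.Admissible) (he : e ∈ Ioo (0 : ℝ) 1) :
    HasDerivAt E.uA (e * effortDeriv (effortDeriv E.cA) e) e := by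
  have h : HasDerivAt E.uA _ e :=
    ((hasDerivAt_id e).mul (hE.cost_A.hasDerivAt_deriv he)).sub (hE.cost_A.hasDerivAt he)
  exact h.congr_deriv (by simp)

/-- The expected reward `e c_A'(e)` that implements the agent effort `e`. -/
def reward (E : AuditEnv) (e : ℝ) : ℝ := e * effortDeriv E.cA e

theorem reward_eq (E : AuditEnv) (e : ℝ) : E.reward e = E.uA e + E.cA e := by
  unfold reward uA; ring

theorem Admissible.reward_strictConvexOn (hE : E.Admissible) :
    StrictConvexOn ℝ (Icc 0 1) E.reward := hE.rent_regularity

theorem Admissible.reward_hasDerivWithinAt (hE : E.Admissible) (he : e ∈ Ioc (0 : ℝ) 1) :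
    HasDerivWithinAt E.reward (effortDeriv E.cA e + e * effortDeriv (effortDeriv E.cA) e)
      (Icc 0 1) e := by
  have h : HasDerivWithinAt E.reward _ (Icc 0 1) e :=
    (hasDerivWithinAt_id e (Icc (0 : ℝ) 1)).mul (hE.cost_A.hasDerivWithinAt_deriv he)
  exact h.congr_deriv (by simp)

/-- The product rule is not available at 0, where `c_A''` may not exist. The slope of the reward
from 0 to x is `c_A'(x)`, which tends to 0. -/
theorem Admissible.reward_hasDerivWithinAt_zero (hE : E.Admissible) :
    HasDerivWithinAt E.reward 0 (Icc 0 1) 0 := by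
  rw [hasDerivWithinAt_iff_tendsto_slope]
  have h := hE.cost_A.continuousOn_deriv 0 zero_mem_effort
  unfold ContinuousWithinAt at h
  rw [hE.cost_A.deriv_zero] at h
  refine (h.mono_left (nhdsWithin_mono _ sdiff_subset)).congr' ?_
  filter_upwards [self_mem_nhdsWithin] with x hx
  have : x ≠ 0 := hx.2
  simp [slope_def_field, reward]
  field_simp

theorem effortDeriv_eq {f : ℝ → ℝ} {d : ℝ} (he : e ∈ Icc (0 : ℝ) 1)
    (h : HasDerivWithinAt f d (Icc 0 1) e) : effortDeriv f e = d :=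
  h.derivWithin (uniqueDiffOn_Icc zero_lt_one e he)

theorem Admissible.reward_differentiableOn (hE : E.Admissible) :
    DifferentiableOn ℝ E.reward (Icc 0 1) := by
  intro e he
  rcases he.1.eq_or_lt with rfl | h
  · exact hE.reward_hasDerivWithinAt_zero.differentiableWithinAt
  · exact (hE.reward_hasDerivWithinAt ⟨h, he.2⟩).differentiableWithinAt

theorem Admissible.reward_deriv_zero (hE : E.Admissible) : effortDeriv E.reward 0 = 0 :=
  effortDeriv_eq zero_mem_effort hE.reward_hasDerivWithinAt_zero

/-- The difference is the marginal rent `e c_A''(e)`. It separates the effort that minimizes rent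
plus cost from the efficient one. -/
theorem Admissible.lt_reward_deriv (hE : E.Admissible) (he : e ∈ Ioc (0 : ℝ) 1) :
    effortDeriv E.cA e < effortDeriv E.reward e := by
  rw [effortDeriv_eq ⟨he.1.le, he.2⟩ (hE.reward_hasDerivWithinAt he)]
  have := mul_pos he.1 (hE.curvature_pos e he)
  linarith

/-- The agent effort with marginal cost `s`. -/
def effEffort (E : AuditEnv) (s : ℝ) : ℝ := Function.invFunOn (effortDeriv E.cA) (Icc 0 1) s

/-- The agent effort with marginal reward `s`. -/
def lowEffort (E : AuditEnv) (s : ℝ) : ℝ := Function.invFunOn (effortDeriv E.reward) (Icc 0 1) s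

section

variable (hE : E.Admissible) (hs : s ∈ Icc 0 (E.cP 1))
include hE hs

theorem Admissible.exists_eff : ∃ e ∈ Icc (0 : ℝ) 1, effortDeriv E.cA e = s :=
  StrictConvexOn.exists_effortDeriv_eq hE.cost_A.differentiableOn
    (by rw [hE.cost_A.deriv_zero]; exact hs.1) (hs.2.trans hE.audit_cost.le)

theorem Admissible.effEffort_mem : E.effEffort s ∈ Icc (0 : ℝ) 1 :=
  Function.invFunOn_mem (hE.exists_eff hs)

theorem Admissible.deriv_effEffort : effortDeriv E.cA (E.effEffort s) = s :=
  Function.invFunOn_eq (hE.exists_eff hs)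

theorem Admissible.exists_low : ∃ e ∈ Icc (0 : ℝ) 1, effortDeriv E.reward e = s :=
  StrictConvexOn.exists_effortDeriv_eq hE.reward_differentiableOn
    (by rw [hE.reward_deriv_zero]; exact hs.1)
    ((hs.2.trans hE.audit_cost.le).trans (hE.lt_reward_deriv ⟨one_pos, le_rfl⟩).le)

theorem Admissible.lowEffort_mem : E.lowEffort s ∈ Icc (0 : ℝ) 1 :=
  Function.invFunOn_mem (hE.exists_low hs)

theorem Admissible.deriv_lowEffort : effortDeriv E.reward (E.lowEffort s) = s :=
  Function.invFunOn_eq (hE.exists_low hs)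

theorem Admissible.effEffort_lt_one : E.effEffort s < 1 := by
  refine lt_of_le_of_ne (hE.effEffort_mem hs).2 fun h => ?_
  have := hE.deriv_effEffort hs
  rw [h] at this
  linarith [hE.audit_cost, hs.2]

theorem Admissible.lowEffort_pos (h : 0 < s) : 0 < E.lowEffort s := by
  refine lt_of_le_of_ne (hE.lowEffort_mem hs).1 fun h' => ?_
  have := hE.deriv_lowEffort hs
  rw [← h', hE.reward_deriv_zero] at this
  linarith

theorem Admissible.lowEffort_lt_effEffort (h : 0 < s) : E.lowEffort s < E.effEffort s := by
  have h1 := hE.lt_reward_deriv ⟨hE.lowEffort_pos hs h, (hE.lowEffort_mem hs).2⟩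
  rw [hE.deriv_lowEffort hs, ← hE.deriv_effEffort hs] at h1
  rw [hE.deriv_effEffort hs] at h1
  conv_rhs at h1 => rw [← hE.deriv_effEffort hs]
  exact (hE.cost_A.deriv_strictMonoOn.lt_iff_lt (hE.lowEffort_mem hs) (hE.effEffort_mem hs)).1 h1

end

theorem Admissible.cP_one_nonneg (hE : E.Admissible) : 0 ≤ E.cP 1 :=
  hE.cost_P.nonneg one_mem_effort

theorem Admissible.effEffort_zero (hE : E.Admissible) : E.effEffort 0 = 0 := by
  have hs : (0 : ℝ) ∈ Icc 0 (E.cP 1) := ⟨le_rfl, hE.cP_one_nonneg⟩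
  refine hE.cost_A.deriv_strictMonoOn.injOn (hE.effEffort_mem hs) zero_mem_effort ?_
  rw [hE.deriv_effEffort hs, hE.cost_A.deriv_zero]

theorem Admissible.lowEffort_zero (hE : E.Admissible) : E.lowEffort 0 = 0 := by
  have hs : (0 : ℝ) ∈ Icc 0 (E.cP 1) := ⟨le_rfl, hE.cP_one_nonneg⟩
  refine (hE.reward_strictConvexOn.effortDeriv_strictMonoOn hE.reward_differentiableOn).injOn
    (hE.lowEffort_mem hs) zero_mem_effort ?_
  rw [hE.deriv_lowEffort hs, hE.reward_deriv_zero]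

theorem Admissible.effEffort_strictMonoOn (hE : E.Admissible) :
    StrictMonoOn E.effEffort (Icc 0 (E.cP 1)) := by
  intro s hs t ht hst
  refine (hE.cost_A.deriv_strictMonoOn.lt_iff_lt (hE.effEffort_mem hs) (hE.effEffort_mem ht)).1 ?_
  rwa [hE.deriv_effEffort hs, hE.deriv_effEffort ht]

theorem Admissible.lowEffort_strictMonoOn (hE : E.Admissible) :
    StrictMonoOn E.lowEffort (Icc 0 (E.cP 1)) := by
  intro s hs t ht hst
  refine ((hE.reward_strictConvexOn.effortDeriv_strictMonoOn
    hE.reward_differentiableOn).lt_iff_lt (hE.lowEffort_mem hs) (hE.lowEffort_mem ht)).1 ?_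
  rwa [hE.deriv_lowEffort hs, hE.deriv_lowEffort ht]

theorem Admissible.effEffort_continuousOn (hE : E.Admissible) :
    ContinuousOn E.effEffort (Icc 0 (E.cP 1)) := fun _ hs =>
  hE.cost_A.deriv_strictMonoOn.continuousWithinAt_of_comp (fun _ ht => hE.effEffort_mem ht) hs
    (continuousWithinAt_id.congr (fun _ ht => hE.deriv_effEffort ht) (hE.deriv_effEffort hs))

theorem Admissible.lowEffort_continuousOn (hE : E.Admissible) :
    ContinuousOn E.lowEffort (Icc 0 (E.cP 1)) := fun _ hs =>
  (hE.reward_strictConvexOn.effortDeriv_strictMonoOn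
    hE.reward_differentiableOn).continuousWithinAt_of_comp (fun _ ht => hE.lowEffort_mem ht) hs
    (continuousWithinAt_id.congr (fun _ ht => hE.deriv_lowEffort ht) (hE.deriv_lowEffort hs))

theorem Admissible.cP_mem (hE : E.Admissible) {p : ℝ} (hp : p ∈ Icc (0 : ℝ) 1) :
    E.cP p ∈ Icc 0 (E.cP 1) :=
  ⟨hE.cost_P.nonneg hp, hE.cost_P.strictMonoOn.monotoneOn hp one_mem_effort hp.2⟩

/-- The marginal net benefit, at agent effort `e` and principal effort `p`, of trading agent effort
for principal effort at the rate `κ`. -/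
def auditGain (E : AuditEnv) (κ e p : ℝ) : ℝ :=
  (1 - e) * (e * effortDeriv (effortDeriv E.cA) e) * effortDeriv E.cP p -
    κ * (effortDeriv E.cA e - E.cP p)

theorem Admissible.auditGain_hasDerivAt (hE : E.Admissible) (κ p : ℝ) (he : e ∈ Ioo (0 : ℝ) 1) :
    HasDerivAt (fun x => E.auditGain κ x p)
      (((1 - 2 * e) * effortDeriv (effortDeriv E.cA) e +
        e * (1 - e) * effortDeriv (effortDeriv (effortDeriv E.cA)) e) * effortDeriv E.cP p -
        κ * effortDeriv (effortDeriv E.cA) e) e := by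
  have h1 : HasDerivAt (fun x => E.auditGain κ x p) _ e :=
    ((((hasDerivAt_const e (1 : ℝ)).sub (hasDerivAt_id e)).mul
    ((hasDerivAt_id e).mul (hE.cost_A.hasDerivAt_deriv_deriv he))).mul_const
    (effortDeriv E.cP p)).sub (((hE.cost_A.hasDerivAt_deriv he).sub_const (E.cP p)).const_mul κ)
  exact h1.congr_deriv (by simp only [Pi.mul_apply, Pi.sub_apply, id]; ring)

/-- This is the purpose of the regularity assumption. Divided by `c_A''(e)`, the derivative in `e`
is X `c_P'(p)` - κ with X = 1 - 2e + e(1 - e) `c_A'''(e)` / `c_A''(e)`, and regularity says X < (xlo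
+ τ) / `c_P'(1)`. -/
theorem Admissible.auditGain_strictAntiOn (hE : E.Admissible) {κ p : ℝ} (hκ : E.xlo + E.τ ≤ κ)
    (hp : p ∈ Icc (0 : ℝ) 1) : StrictAntiOn (fun x => E.auditGain κ x p) (Ioo 0 1) := by
  refine strictAntiOn_of_deriv_neg (convex_Ioo 0 1)
    (fun e he => (hE.auditGain_hasDerivAt κ p he).continuousAt.continuousWithinAt) fun e he => ?_
  rw [interior_Ioo] at he
  rw [(hE.auditGain_hasDerivAt κ p he).deriv]
  have hA := hE.curvature_pos e ⟨he.1, he.2.le⟩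
  have hreg := hE.regularity e ⟨he.1, he.2.le⟩
  have hP1 := hE.cost_P.deriv_pos one_mem_effort one_pos
  have hq := hE.cost_P.deriv_le_one hp
  have hq0 := hE.cost_P.deriv_nonneg hp
  set A := effortDeriv (effortDeriv E.cA) e
  set A' := effortDeriv (effortDeriv (effortDeriv E.cA)) e
  set q := effortDeriv E.cP p
  set q1 := effortDeriv E.cP 1
  have hκ0 : 0 < κ := by linarith [hE.xlo_nonneg, hE.τ_pos]
  set X := (1 - 2 * e) + e * (1 - e) * (A' / A) with hX
  have hXlt : X < (E.xlo + E.τ) / q1 := by rw [hX]; linarith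
  have hXA : (1 - 2 * e) * A + e * (1 - e) * A' = X * A := by rw [hX]; field_simp
  rw [hXA]
  have hXq : X * q < κ := by
    rcases le_or_gt X 0 with h | h
    · nlinarith
    · rw [lt_div_iff₀ hP1] at hXlt
      nlinarith
  nlinarith

theorem Admissible.auditGain_lt_of_lt (hE : E.Admissible) {κ p p' : ℝ} (hκ : 0 < κ)
    (he : e ∈ Icc (0 : ℝ) 1)
    (hp : p ∈ Icc (0 : ℝ) 1) (hp' : p' ∈ Icc (0 : ℝ) 1) (h : p < p') :
    E.auditGain κ e p < E.auditGain κ e p' := by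
  have h1 := hE.cost_P.strictMonoOn hp hp' h
  have h2 := hE.cost_P.deriv_strictMonoOn hp hp' h
  have h3 : 0 ≤ (1 - e) * (e * effortDeriv (effortDeriv E.cA) e) := by
    rcases he.1.eq_or_lt with rfl | h0
    · simp
    · exact mul_nonneg (by linarith [he.2]) (mul_nonneg h0.le (hE.curvature_pos e ⟨h0, he.2⟩).le)
  unfold auditGain
  nlinarith

end AuditEnv

/-! ### Type-by-type improvements of a tight mechanism -/

namespace TaxMechanism

variable {E : AuditEnv} {m n : TaxMechanism} {x y : ℝ}

/-- Type `y` can be offered what `n` offers it when the loss function has to be at least `μ`. -/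
structure ValidAt (E : AuditEnv) (μ : ℝ → ℝ) (n : TaxMechanism) (y : ℝ) : Prop where
  feasible : n.eA y ∈ Icc (0 : ℝ) 1 ∧ n.eP y ∈ Icc (0 : ℝ) 1 ∧
    n.rA y ∈ Icc 0 (y + E.τ) ∧ n.rP y ∈ Icc 0 (y + E.τ) ∧ n.rN y ∈ Icc 0 (y + E.τ)
  obedient : ∀ e ∈ Icc (0 : ℝ) 1, e * (n.rA y - n.RNA y) - E.cA e ≤
    n.eA y * (n.rA y - n.RNA y) - E.cA (n.eA y)
  le_deviationLoss : ∀ w ∈ Icc y E.xhi, μ w ≤ n.deviationLoss w y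
  truthful : y - μ y ≤ n.utility E y

theorem loss_le (hE : E.Admissible) (hm : m.Feasible E) (hx : x ∈ E.types)
    (hy : y ∈ Icc E.xlo x) : m.loss E x ≤ m.deviationLoss x y := by
  -- A crude lower bound for all deviation lines, so that the infimum is not a default value.
  refine csInf_le ⟨-E.τ, ?_⟩ ⟨y, hy, rfl⟩
  rintro _ ⟨z, hz, rfl⟩
  obtain ⟨-, hp, -, -, hN⟩ := hm z ⟨hz.1, hz.2.trans hx.2⟩
  have h0 := hE.xlo_nonneg
  have hτ := hE.τ_pos
  unfold deviationLoss
  nlinarith [mul_nonneg hp.1 (by linarith [hx.1] : 0 ≤ x),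
    mul_nonneg (sub_nonneg.2 hp.2) (sub_nonneg.2 hN.2), mul_nonneg hp.1 hτ.le]

theorem le_loss {μ : ℝ} (hx : x ∈ E.types) (h : ∀ y ∈ Icc E.xlo x, μ ≤ m.deviationLoss x y) :
    μ ≤ m.loss E x := by
  refine le_csInf ⟨_, E.xlo, ⟨le_rfl, hx.1⟩, rfl⟩ ?_
  rintro _ ⟨y, hy, rfl⟩
  exact h y hy

theorem IsMechanism.validAt (hE : E.Admissible) (hm : m.IsMechanism E) (hy : y ∈ E.types) :
    ValidAt E (m.loss E) m y where
  feasible := hm.feasible y hy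
  obedient := hm.obedient y hy
  le_deviationLoss := fun _ hw =>
    loss_le hE hm.feasible ⟨hy.1.trans hw.1, hw.2⟩ ⟨hy.1, hw.1⟩
  truthful := hm.truthful y hy

/-- The loss function and the profit of a tight mechanism cannot be improved type by type. -/
theorem Tight.eq_of_forall_exists (hm : m.Tight E) {μ : ℝ → ℝ}
    (hμ : ∀ y ∈ E.types, m.loss E y ≤ μ y)
    (h : ∀ y ∈ E.types, ∃ n, ValidAt E μ n y ∧ m.profit E y ≤ n.profit E y) :
    ∀ y ∈ E.types, m.loss E y = μ y := by
  have h' : ∀ y, ∃ n, y ∈ E.types → ValidAt E μ n y ∧ m.profit E y ≤ n.profit E y := by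
    intro y
    by_cases hy : y ∈ E.types
    · obtain ⟨n, hn⟩ := h y hy
      exact ⟨n, fun _ => hn⟩
    · exact ⟨m, fun hy' => absurd hy' hy⟩
  choose n hn using h'
  -- The contracts are glued. Their lines lie above `μ`, so the new loss function does too, and
  -- truthfulness against `μ` suffices.
  let m' : TaxMechanism := ⟨fun y => (n y).eA y, fun y => (n y).eP y, fun y => (n y).rA y,
    fun y => (n y).rP y, fun y => (n y).rN y⟩
  have hloss : ∀ x ∈ E.types, μ x ≤ m'.loss E x := fun x hx =>
    le_loss hx fun y hy => (hn y ⟨hy.1, hy.2.trans hx.2⟩).1.le_deviationLoss x ⟨hy.2, hx.2⟩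
  have hm' : m'.IsMechanism E :=
    { feasible := fun y hy => (hn y hy).1.feasible
      obedient := fun y hy => (hn y hy).1.obedient
      truthful := fun y hy => by
        have h1 := (hn y hy).1.truthful
        have h2 := hloss y hy
        have h3 : m'.utility E y = (n y).utility E y := rfl
        linarith }
  intro y hy
  have h1 := (hm.2 m' hm' (fun y hy => ⟨(hn y hy).2, (hμ y hy).trans (hloss y hy)⟩) y hy).2
  exact le_antisymm (hμ y hy) (h1 ▸ hloss y hy)

/-- Change the contract of one type only: all lines still lie above the loss function, so a higher
profit at that type would give a strictly better mechanism. -/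
theorem Tight.profit_le (hE : E.Admissible) (hm : m.Tight E) (hy : y ∈ E.types)
    (hn : ValidAt E (m.loss E) n y) : n.profit E y ≤ m.profit E y := by
  by_contra! hlt
  classical
  let N : ℝ → TaxMechanism := fun z => if z = y then n else m
  let m' : TaxMechanism := ⟨fun z => (N z).eA z, fun z => (N z).eP z, fun z => (N z).rA z,
    fun z => (N z).rP z, fun z => (N z).rN z⟩
  have hN : ∀ z ∈ E.types, ValidAt E (m.loss E) (N z) z ∧ m.profit E z ≤ (N z).profit E z := by
    intro z hz
    by_cases h : z = y
    · subst h
      simp only [N, if_true]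
      exact ⟨hn, hlt.le⟩
    · simp only [N, if_neg h]
      exact ⟨hm.1.validAt hE hz, le_rfl⟩
  have hloss : ∀ x ∈ E.types, m.loss E x ≤ m'.loss E x := fun x hx =>
    le_loss hx fun z hz => (hN z ⟨hz.1, hz.2.trans hx.2⟩).1.le_deviationLoss x ⟨hz.2, hx.2⟩
  have hm' : m'.IsMechanism E :=
    { feasible := fun z hz => (hN z hz).1.feasible
      obedient := fun z hz => (hN z hz).1.obedient
      truthful := fun z hz => by
        have h1 := (hN z hz).1.truthful
        have h2 := hloss z hz
        have h3 : m'.utility E z = (N z).utility E z := rfl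
        linarith }
  have h1 := (hm.2 m' hm' (fun z hz => ⟨(hN z hz).2, hloss z hz⟩) y hy).1
  have h2 : m'.profit E y = n.profit E y := by
    change (N y).profit E y = n.profit E y
    simp [N]
  linarith

theorem deviationLoss_self (n : TaxMechanism) (y : ℝ) :
    n.deviationLoss y y = y - (1 - n.eP y) * n.rN y := by
  unfold deviationLoss; ring

theorem deviationLoss_eq (n : TaxMechanism) (w y : ℝ) :
    n.deviationLoss w y = y - (1 - n.eP y) * n.rN y + n.eP y * (w - y) := by
  unfold deviationLoss; ring

theorem deviationLoss_mono (n : TaxMechanism) (y : ℝ) (hp : 0 ≤ n.eP y) :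
    Monotone fun w => n.deviationLoss w y := by
  intro w w' hw
  simp only [deviationLoss_eq]
  nlinarith

/-- All refunds can be lowered by the same amount. -/
theorem exists_lower_refunds (hE : E.Admissible) {δ : ℝ}
    (hf : n.eA y ∈ Icc (0 : ℝ) 1 ∧ n.eP y ∈ Icc (0 : ℝ) 1 ∧
      n.rA y ∈ Icc 0 (y + E.τ) ∧ n.rP y ∈ Icc 0 (y + E.τ) ∧ n.rN y ∈ Icc 0 (y + E.τ))
    (ho : ∀ e ∈ Icc (0 : ℝ) 1, e * (n.rA y - n.RNA y) - E.cA e ≤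
      n.eA y * (n.rA y - n.RNA y) - E.cA (n.eA y))
    (hδ : 0 ≤ δ) (hδ' : δ ≤ (1 - n.eP y) * n.rN y) :
    ∃ n' : TaxMechanism, (n'.eA y ∈ Icc (0 : ℝ) 1 ∧ n'.eP y ∈ Icc (0 : ℝ) 1 ∧
      n'.rA y ∈ Icc 0 (y + E.τ) ∧ n'.rP y ∈ Icc 0 (y + E.τ) ∧ n'.rN y ∈ Icc 0 (y + E.τ)) ∧
      (∀ e ∈ Icc (0 : ℝ) 1, e * (n'.rA y - n'.RNA y) - E.cA e ≤
        n'.eA y * (n'.rA y - n'.RNA y) - E.cA (n'.eA y)) ∧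
      (∀ w, n'.deviationLoss w y = n.deviationLoss w y + δ) ∧
      n'.utility E y = n.utility E y - δ ∧ n'.profit E y = n.profit E y + δ := by
  obtain ⟨he, hp, hA, hP, hN⟩ := hf
  set e := n.eA y with he_def
  set p := n.eP y with hp_def
  set w := n.rA y - n.RNA y with hw
  have hR : n.RNA y = p * n.rP y + (1 - p) * n.rN y := rfl
  have hRδ : δ ≤ n.RNA y := by
    rw [hR]; nlinarith [mul_nonneg hp.1 hP.1]
  have hew : 0 ≤ e * w - E.cA e := by
    have := ho 0 zero_mem_effort
    simpa [hE.cost_A.map_zero] using this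
  -- A negative reward makes zero effort the only best response.
  have hcase : 0 ≤ w ∨ e = 0 := by
    by_contra! h
    have he0 : 0 < e := lt_of_le_of_ne he.1 (Ne.symm h.2)
    nlinarith [hE.cost_A.nonneg he, mul_pos he0 (neg_pos.2 h.1)]
  -- The refund without evidence falls by `δ / (1 - p)`; if `p = 1`, then `δ = 0` and nothing is
  -- changed.
  obtain ⟨d, hd, hd1⟩ : ∃ d, (1 - p) * d = δ ∧ 0 ≤ d ∧ d ≤ n.rN y := by
    rcases hp.2.eq_or_lt with h | h
    · refine ⟨0, ?_, le_rfl, hN.1⟩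
      rw [h] at hδ' ⊢
      linarith
    · have h1 : 0 < 1 - p := by linarith
      refine ⟨δ / (1 - p), by field_simp, by positivity, ?_⟩
      rw [div_le_iff₀ h1]; linarith
  -- Truncating the reward at zero affects neither the chosen effort nor the rent, and keeps the
  -- refund after the agent's evidence nonnegative.
  let n' : TaxMechanism := ⟨fun _ => e, fun _ => p, fun _ => n.RNA y - δ + max w 0,
    fun _ => n.rP y, fun _ => n.rN y - d⟩
  have hR' : n'.RNA y = n.RNA y - δ := by
    change p * n.rP y + (1 - p) * (n.rN y - d) = _
    rw [hR]; linear_combination -hd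
  have hw' : n'.rA y - n'.RNA y = max w 0 := by
    rw [hR']; change n.RNA y - δ + max w 0 - _ = _; ring
  have hmax : e * max w 0 = e * w := by
    rcases hcase with h | h
    · rw [max_eq_left h]
    · rw [h]; ring
  have hRle : n.RNA y ≤ y + E.τ := by
    rw [hR]; nlinarith [mul_le_mul_of_nonneg_left hP.2 hp.1,
      mul_le_mul_of_nonneg_left hN.2 (sub_nonneg.2 hp.2)]
  have hV : n'.evidenceRent E y = n.evidenceRent E y := by
    change e * (n'.rA y - n'.RNA y) - E.cA e = e * w - E.cA e
    rw [hw', hmax]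
  refine ⟨n', ⟨he, hp, ⟨?_, ?_⟩, hP, ⟨?_, ?_⟩⟩, ?_, ?_, ?_, ?_⟩
  · change 0 ≤ n.RNA y - δ + max w 0
    have := le_max_right w 0
    linarith
  · change n.RNA y - δ + max w 0 ≤ _
    have hA2 := hA.2
    rcases max_choice w 0 with h | h <;> rw [h] <;> linarith
  · change 0 ≤ n.rN y - d
    linarith
  · change n.rN y - d ≤ _
    linarith [hN.2]
  · intro x hx
    rw [hw']
    change x * max w 0 - E.cA x ≤ e * max w 0 - E.cA e
    rw [hmax]
    rcases le_total 0 w with h | h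
    · rw [max_eq_left h]; exact ho x hx
    · rw [max_eq_right h]
      linarith [hE.cost_A.nonneg hx]
  · intro z
    change p * z + (1 - p) * (y - (n.rN y - d)) = p * z + (1 - p) * (y - n.rN y) + δ
    linear_combination hd
  · unfold utility
    rw [hR', hV]; ring
  · unfold profit
    rw [hR', hV]
    change y - (n.RNA y - δ) - n.evidenceRent E y - E.cA e - (1 - e) * E.cP p = _
    ring

theorem IsMechanism.loss_le_self (hE : E.Admissible) (hm : m.IsMechanism E) (hy : y ∈ E.types) :
    m.loss E y ≤ y := by
  have h1 := loss_le hE hm.feasible hy ⟨hy.1, le_rfl⟩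
  obtain ⟨-, hp, -, -, hN⟩ := hm.feasible y hy
  rw [deviationLoss_self] at h1
  nlinarith [mul_nonneg (sub_nonneg.2 hp.2) hN.1]

/-- A lower bound on the loss of type `z` against the lines of lower types persists above `z`. -/
theorem Tight.le_loss_of_forall_lt (hE : E.Admissible) (hm : m.Tight E) {z c : ℝ} (hcz : c ≤ z)
    (hc : ∀ y ∈ E.types, y < z → c ≤ m.deviationLoss z y) :
    ∀ w ∈ E.types, z ≤ w → c ≤ m.loss E w := by
  classical
  -- The loss function is raised to at least `c` from `z` on. Only types above `z` whose own line
  -- starts below `c` need a new contract.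
  set μ : ℝ → ℝ := fun w => if z ≤ w then max (m.loss E w) c else m.loss E w with hμ
  have hle : ∀ y, m.loss E y ≤ μ y := by
    intro y
    simp only [hμ]
    split_ifs
    · exact le_max_left _ _
    · exact le_rfl
  have hμle : ∀ w {d : ℝ}, m.loss E w ≤ d → (z ≤ w → c ≤ d) → μ w ≤ d := by
    intro w d h1 h2
    simp only [hμ]
    split_ifs with h
    · exact max_le h1 (h2 h)
    · exact h1
  have key := hm.eq_of_forall_exists (μ := μ) (fun y _ => hle y) ?_
  · intro w hw hzw
    rw [key w hw]
    simp only [hμ, if_pos hzw]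
    exact le_max_right _ _
  intro y hy
  have hv := hm.1.validAt hE hy
  have hp := hv.feasible.2.1
  have hline : ∀ w ∈ Icc y E.xhi, m.loss E w ≤ m.deviationLoss w y := hv.le_deviationLoss
  by_cases hcy : z ≤ y → c ≤ m.deviationLoss y y
  · refine ⟨m, ⟨hv.feasible, hv.obedient, fun w hw => ?_, ?_⟩, le_rfl⟩
    · refine hμle w (hline w hw) fun hzw => ?_
      rcases le_or_gt z y with h | h
      · exact (hcy h).trans (m.deviationLoss_mono y hp.1 hw.1)
      · exact (hc y hy h).trans (m.deviationLoss_mono y hp.1 hzw)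
    · linarith [hle y, hv.truthful]
  · push Not at hcy
    obtain ⟨hzy, hlt⟩ := hcy
    have hself := m.deviationLoss_self y
    -- This `δ` lifts the line of `y` to height `c` at `y`. Enough refund is available for it,
    -- because `c ≤ z ≤ y`.
    obtain ⟨n, hf, ho, hd, hu, hpr⟩ := exists_lower_refunds hE (δ := c - m.deviationLoss y y)
      hv.feasible hv.obedient (by linarith) (by linarith)
    refine ⟨n, ⟨hf, ho, fun w hw => ?_, ?_⟩, by linarith⟩
    · rw [hd]
      have h1 := m.deviationLoss_mono y hp.1 hw.1
      simp only at h1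
      exact hμle w (by linarith [hline w hw]) fun _ => by linarith
    · have h1 : μ y = max (m.loss E y) c := by simp only [hμ, if_pos hzy]
      have h2 := le_max_right (m.loss E y) c
      have h3 := hline y ⟨le_rfl, hy.2⟩
      have h4 := hv.truthful
      rw [hu]
      linarith

theorem Tight.xlo_le_loss (hE : E.Admissible) (hm : m.Tight E) (hy : y ∈ E.types) :
    E.xlo ≤ m.loss E y :=
  hm.le_loss_of_forall_lt hE le_rfl (fun _ hz h => absurd hz.1 (not_le.2 h)) y hy hy.1

theorem Tight.loss_monotoneOn (hE : E.Admissible) (hm : m.Tight E) :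
    MonotoneOn (m.loss E) E.types := fun _ hz w hw hzw =>
  hm.le_loss_of_forall_lt hE (hm.1.loss_le_self hE hz)
    (fun _ hy hyz => loss_le hE hm.1.feasible hz ⟨hy.1, hyz.le⟩) w hw hzw

/-- The scheme with agent effort `e`, principal effort `p`, expected refund `R` without evidence by
the agent, and the smallest possible refund without any evidence. -/
theorem exists_scheme (hE : E.Admissible) (hy : y ∈ E.types) {e p R : ℝ}
    (he : e ∈ Icc (0 : ℝ) 1) (hp : p ∈ Icc (0 : ℝ) 1) (hR : 0 ≤ R) (hRy : R ≤ y) :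
    ∃ n : TaxMechanism, (n.eA y ∈ Icc (0 : ℝ) 1 ∧ n.eP y ∈ Icc (0 : ℝ) 1 ∧
      n.rA y ∈ Icc 0 (y + E.τ) ∧ n.rP y ∈ Icc 0 (y + E.τ) ∧ n.rN y ∈ Icc 0 (y + E.τ)) ∧
      (∀ x ∈ Icc (0 : ℝ) 1, x * (n.rA y - n.RNA y) - E.cA x ≤
        n.eA y * (n.rA y - n.RNA y) - E.cA (n.eA y)) ∧
      (∀ w, n.deviationLoss w y = y + p * (w - y) - max (R - p * (y + E.τ)) 0) ∧
      n.utility E y = R + E.uA e ∧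
      n.profit E y = y - (R + E.uA e + E.cA e + (1 - e) * E.cP p) := by
  have hτ := hE.τ_pos
  have hy0 : 0 ≤ y := hE.xlo_nonneg.trans hy.1
  -- The refund after the principal's evidence is used up to its cap `y + τ` before any refund
  -- without evidence is paid.
  obtain ⟨rP, rN, hrP, hrN, hsum, hmax⟩ : ∃ rP rN, rP ∈ Icc 0 (y + E.τ) ∧ rN ∈ Icc 0 (y + E.τ) ∧
      p * rP + (1 - p) * rN = R ∧ (1 - p) * rN = max (R - p * (y + E.τ)) 0 := by
    rcases le_or_gt R (p * (y + E.τ)) with h | h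
    · rw [max_eq_right (by linarith)]
      rcases hp.1.eq_or_lt with h0 | h0
      · rw [← h0] at h ⊢
        exact ⟨0, 0, ⟨le_rfl, by linarith⟩, ⟨le_rfl, by linarith⟩, by linarith, by ring⟩
      · refine ⟨R / p, 0, ⟨by positivity, ?_⟩, ⟨le_rfl, by linarith⟩, by field_simp; ring, by ring⟩
        rw [div_le_iff₀ h0]; linarith
    · rw [max_eq_left (by linarith)]
      have hp1 : 0 < 1 - p := by
        by_contra! h1
        have : p = 1 := le_antisymm hp.2 (by linarith)
        rw [this] at h; linarith
      refine ⟨y + E.τ, (R - p * (y + E.τ)) / (1 - p), ⟨by linarith, le_rfl⟩,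
        ⟨div_nonneg (by linarith) hp1.le, ?_⟩, by field_simp; ring, by field_simp⟩
      rw [div_le_iff₀ hp1]; nlinarith
  have hd0 := hE.cost_A.deriv_nonneg he
  have hd1 := hE.cost_A.deriv_le_one he
  -- The reward `c_A'(e)` implements `e`; it is affordable because `R ≤ y` and `c_A'(1) ≤ τ`.
  let n : TaxMechanism := ⟨fun _ => e, fun _ => p, fun _ => R + effortDeriv E.cA e,
    fun _ => rP, fun _ => rN⟩
  have hRNA : n.RNA y = R := hsum
  have hw : n.rA y - n.RNA y = effortDeriv E.cA e := by
    rw [hRNA]; change R + _ - R = _; ring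
  have hV : n.evidenceRent E y = E.uA e := by
    change e * (n.rA y - n.RNA y) - E.cA e = _
    rw [hw]; rfl
  refine ⟨n, ⟨he, hp, ⟨?_, ?_⟩, hrP, hrN⟩, ?_, ?_, ?_, ?_⟩
  · change 0 ≤ R + effortDeriv E.cA e
    linarith
  · change R + effortDeriv E.cA e ≤ _
    linarith [hE.funds]
  · intro x hx
    rw [hw]
    change x * _ - E.cA x ≤ e * _ - E.cA e
    rcases eq_or_ne x e with rfl | hne
    · exact le_rfl
    · have := hE.cost_A.strictConvexOn.tangent_lt_of_ne hE.cost_A.differentiableOn hx he hne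
      linarith
  · intro w
    change p * w + (1 - p) * (y - rN) = _
    rw [← hmax]; ring
  · unfold utility
    rw [hRNA, hV]
  · unfold profit
    rw [hRNA, hV]
    change y - R - E.uA e - E.cA e - (1 - e) * E.cP p = _
    ring

end TaxMechanism

/-! ### The reduced problem of a single type -/

namespace AuditEnv

/-- The efforts `e`, `p` are feasible for type `y` when the loss function is `lam` and refunds are
as small as possible: the line through `(y, y)` with slope `p` and the line that leaves the agent
the required utility both lie above `lam`. -/
structure ReducedFeasible (E : AuditEnv) (lam : ℝ → ℝ) (y e p : ℝ) : Prop where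
  eA_mem : e ∈ Icc (0 : ℝ) 1
  eP_mem : p ∈ Icc (0 : ℝ) 1
  le_line : ∀ w ∈ E.types, lam w ≤ y + p * (w - y)
  le_rent : ∀ w ∈ E.types, lam w - p * (w + E.τ) ≤ lam y + E.uA e

/-- The surplus the principal does not obtain from type `y` when efforts are `e`, `p` and the loss
function is `lam`. -/
def reducedCost (E : AuditEnv) (lam : ℝ → ℝ) (y e p : ℝ) : ℝ :=
  max (y - lam y) (E.uA e) + E.cA e + (1 - e) * E.cP p

/-- The efforts `e`, `p` solve the reduced problems given a concave loss function `lam`. -/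
structure ReducedSolution (E : AuditEnv) (lam e p : ℝ → ℝ) : Prop where
  mono : MonotoneOn lam E.types
  concave : ConcaveOn ℝ E.types lam
  le_self : ∀ y ∈ E.types, lam y ≤ y
  xlo_le : ∀ y ∈ E.types, E.xlo ≤ lam y
  sub_le : ∀ y ∈ E.types, ∀ y' ∈ E.types, y ≤ y' → lam y' - lam y ≤ y' - y
  feasible : ∀ y ∈ E.types, E.ReducedFeasible lam y (e y) (p y)
  eA_lt_one : ∀ y ∈ E.types, e y < 1
  optimal : ∀ y ∈ E.types, ∀ e' p', E.ReducedFeasible lam y e' p' →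
    E.reducedCost lam y (e y) (p y) ≤ E.reducedCost lam y e' p'

theorem max_gap_add (g u : ℝ) : max (g - u) 0 + u = max g u := by
  rcases le_total u g with h | h
  · rw [max_eq_left (by linarith), max_eq_left h]; ring
  · rw [max_eq_right (by linarith), max_eq_right h]; ring

end AuditEnv

/-! ### Tight mechanisms solve the reduced problems -/

namespace TaxMechanism

open AuditEnv

variable {E : AuditEnv} {m : TaxMechanism} {y : ℝ}

/-- A negative reward yields zero effort, a reward up to `c_A'(1)` yields the effort with this
marginal cost, and only a larger reward yields full effort with a rent above `u_A(1)`. -/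
theorem evidenceRent_of_obedient (hE : E.Admissible) (he : m.eA y ∈ Icc (0 : ℝ) 1)
    (ho : ∀ e ∈ Icc (0 : ℝ) 1, e * (m.rA y - m.RNA y) - E.cA e ≤
      m.eA y * (m.rA y - m.RNA y) - E.cA (m.eA y)) :
    m.evidenceRent E y = E.uA (m.eA y) ∨ (m.eA y = 1 ∧ E.uA 1 ≤ m.evidenceRent E y) := by
  unfold evidenceRent
  set w := m.rA y - m.RNA y
  set e := m.eA y
  have hc := hE.cost_A
  rcases lt_or_ge w 0 with hw | hw
  · have h0 := ho 0 zero_mem_effort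
    rw [hc.map_zero] at h0
    have : e = 0 := by
      by_contra hne
      have he0 : 0 < e := lt_of_le_of_ne he.1 (Ne.symm hne)
      nlinarith [hc.nonneg he, mul_pos he0 (neg_pos.2 hw)]
    left
    rw [this, hE.uA_zero, hc.map_zero]; ring
  rcases le_or_gt w (effortDeriv E.cA 1) with hw1 | hw1
  · obtain ⟨x, hx, hxw⟩ := StrictConvexOn.exists_effortDeriv_eq hc.differentiableOn
      (by rw [hc.deriv_zero]; exact hw) hw1
    have : e = x := by
      by_contra hne
      have h1 := hc.strictConvexOn.tangent_lt_of_ne hc.differentiableOn he hx hne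
      have h2 := ho x hx
      rw [hxw] at h1
      nlinarith
    left
    rw [this, uA, hxw]
  · have : e = 1 := by
      by_contra hne
      have h1 := hc.strictConvexOn.tangent_lt_of_ne hc.differentiableOn he one_mem_effort hne
      have h2 := ho 1 one_mem_effort
      have h3 : e < 1 := lt_of_le_of_ne he.2 hne
      nlinarith
    right
    refine ⟨this, ?_⟩
    rw [this, uA]; linarith

/-- The competing scheme pays the expected refund (y - λ(y) - u_A(e))⁺, the least one that makes
advancing the full surplus optimal. -/
theorem Tight.sub_profit_le (hE : E.Admissible) (hm : m.Tight E) (hy : y ∈ E.types) {e p : ℝ}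
    (he : e ∈ Icc (0 : ℝ) 1) (hp : p ∈ Icc (0 : ℝ) 1)
    (hline : ∀ w ∈ Icc y E.xhi, m.loss E w ≤
      y + p * (w - y) - max (max (y - m.loss E y - E.uA e) 0 - p * (y + E.τ)) 0) :
    y - m.profit E y ≤ E.reducedCost (m.loss E) y e p := by
  have hu := hE.uA_nonneg he
  have hlo := hm.xlo_le_loss hE hy
  have h0 := hE.xlo_nonneg
  have hR : max (y - m.loss E y - E.uA e) 0 ≤ y := max_le (by linarith) (h0.trans hy.1)
  obtain ⟨n, hf, ho, hd, hun, hpr⟩ := exists_scheme hE hy he hp (le_max_right _ _) hR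
  have h1 := hm.profit_le hE hy ⟨hf, ho, fun w hw => by rw [hd]; exact hline w hw, by
    rw [hun, max_gap_add]; exact le_max_left _ _⟩
  rw [hpr, max_gap_add] at h1
  unfold reducedCost
  linarith

theorem Tight.sub_profit_le_of_reducedFeasible (hE : E.Admissible) (hm : m.Tight E)
    (hy : y ∈ E.types) {e p : ℝ} (h : E.ReducedFeasible (m.loss E) y e p) :
    y - m.profit E y ≤ E.reducedCost (m.loss E) y e p := by
  refine hm.sub_profit_le hE hy h.eA_mem h.eP_mem fun w hw => ?_
  have hw' : w ∈ E.types := ⟨hy.1.trans hw.1, hw.2⟩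
  have h1 := h.le_line w hw'
  have h2 := h.le_rent w hw'
  have h3 : 0 ≤ p * (y + E.τ) :=
    mul_nonneg h.eP_mem.1 (by linarith [hE.xlo_nonneg, hE.τ_pos, hy.1])
  rcases max_cases (max (y - m.loss E y - E.uA e) 0 - p * (y + E.τ)) 0 with ⟨h4, h5⟩ | ⟨h4, h5⟩ <;>
    rw [h4]
  · rcases max_cases (y - m.loss E y - E.uA e) 0 with ⟨h6, h7⟩ | ⟨h6, h7⟩ <;> rw [h6]
    · nlinarith
    · linarith
  · linarith

theorem reducedFeasible_one (hE : E.Admissible) {lam : ℝ → ℝ} {e : ℝ}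
    (hself : ∀ w ∈ E.types, lam w ≤ w) (hlo : E.xlo ≤ lam y) (he : e ∈ Icc (0 : ℝ) 1) :
    E.ReducedFeasible lam y e 1 := by
  refine ⟨he, one_mem_effort, fun w hw => by linarith [hself w hw], fun w hw => ?_⟩
  linarith [hself w hw, hE.uA_nonneg he, hE.xlo_nonneg, hE.τ_pos]

theorem Tight.RNA_nonneg (hm : m.Tight E) (hy : y ∈ E.types) : 0 ≤ m.RNA y := by
  obtain ⟨-, hp, -, hP, hN⟩ := hm.1.feasible y hy
  exact add_nonneg (mul_nonneg hp.1 hP.1) (mul_nonneg (sub_nonneg.2 hp.2) hN.1)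

/-- Full audits are always feasible in the reduced problem. Combined with the agent effort that is
efficient against them, which is below one since `c_P(1) < c_A'(1)`, they cost less than full agent
effort and leave no more utility to the agent. -/
theorem Tight.eA_lt_one (hE : E.Admissible) (hm : m.Tight E) (hy : y ∈ E.types) :
    m.eA y < 1 := by
  have hv := hm.1.validAt hE hy
  refine lt_of_le_of_ne hv.feasible.1.2 fun h1 => ?_
  have hs := hE.cP_mem one_mem_effort
  have hV : E.uA 1 ≤ m.evidenceRent E y := by
    rcases evidenceRent_of_obedient hE hv.feasible.1 hv.obedient with h | h
    · rw [h, h1]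
    · exact h.2
  have h2 := hm.sub_profit_le_of_reducedFeasible hE hy (reducedFeasible_one hE
    (fun w hw => hm.1.loss_le_self hE hw) (hm.xlo_le_loss hE hy) (hE.effEffort_mem hs))
  have h3 := hE.cost_A.strictConvexOn.sub_mul_strictMonoOn hE.cost_A.differentiableOn
    (hE.effEffort_mem hs) (hE.deriv_effEffort hs) ⟨le_rfl, (hE.effEffort_mem hs).2⟩
    ⟨(hE.effEffort_mem hs).2, le_rfl⟩ (hE.effEffort_lt_one hs)
  simp only at h3
  have h4 := hv.truthful
  have h5 := hm.RNA_nonneg hy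
  have h6 := hE.uA_strictMonoOn (hE.effEffort_mem hs) one_mem_effort (hE.effEffort_lt_one hs)
  have h7 : max (y - m.loss E y) (E.uA (E.effEffort (E.cP 1))) ≤ m.utility E y :=
    max_le h4 (by unfold utility; linarith)
  unfold reducedCost at h2
  have h8 : m.profit E y = y - m.utility E y - E.cA 1 := by
    unfold profit utility; rw [h1]; ring
  linarith

theorem Tight.evidenceRent_eq (hE : E.Admissible) (hm : m.Tight E) (hy : y ∈ E.types) :
    m.evidenceRent E y = E.uA (m.eA y) := by
  have hv := hm.1.validAt hE hy
  rcases evidenceRent_of_obedient hE hv.feasible.1 hv.obedient with h | h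
  · exact h
  · exact absurd h.1 (hm.eA_lt_one hE hy).ne

theorem Tight.le_line (hE : E.Admissible) (hm : m.Tight E) (hy : y ∈ E.types) {R w : ℝ}
    (hR : R ≤ m.RNA y) (hw : w ∈ Icc y E.xhi) :
    m.loss E w ≤ y + m.eP y * (w - y) - max (R - m.eP y * (y + E.τ)) 0 := by
  have hv := hm.1.validAt hE hy
  obtain ⟨-, hp, -, hP, hN⟩ := hv.feasible
  have h1 := hv.le_deviationLoss w hw
  rw [deviationLoss_eq] at h1
  have h2 : max (R - m.eP y * (y + E.τ)) 0 ≤ (1 - m.eP y) * m.rN y := by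
    refine max_le ?_ (mul_nonneg (sub_nonneg.2 hp.2) hN.1)
    have h3 : m.RNA y = m.eP y * m.rP y + (1 - m.eP y) * m.rN y := rfl
    nlinarith [mul_le_mul_of_nonneg_left hP.2 hp.1]
  linarith

/-- With the same efforts, paying only the required refund keeps the line above the loss function,
so anything more would forgo profit. -/
theorem Tight.RNA_eq (hE : E.Admissible) (hm : m.Tight E) (hy : y ∈ E.types) :
    m.RNA y = max (y - m.loss E y - E.uA (m.eA y)) 0 := by
  have hv := hm.1.validAt hE hy
  have hV := hm.evidenceRent_eq hE hy
  have h1 : max (y - m.loss E y - E.uA (m.eA y)) 0 ≤ m.RNA y := by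
    refine max_le ?_ (hm.RNA_nonneg hy)
    have := hv.truthful
    unfold utility at this
    linarith
  refine le_antisymm ?_ h1
  have h2 := hm.sub_profit_le hE hy hv.feasible.1 hv.feasible.2.1
    (fun w hw => hm.le_line hE hy h1 hw)
  unfold reducedCost at h2
  rw [← max_gap_add] at h2
  unfold profit at h2
  linarith

theorem Tight.utility_eq (hE : E.Admissible) (hm : m.Tight E) (hy : y ∈ E.types) :
    m.utility E y = max (y - m.loss E y) (E.uA (m.eA y)) := by
  unfold utility
  rw [hm.RNA_eq hE hy, hm.evidenceRent_eq hE hy, max_gap_add]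

theorem Tight.profit_eq (hE : E.Admissible) (hm : m.Tight E) (hy : y ∈ E.types) :
    m.profit E y = y - E.reducedCost (m.loss E) y (m.eA y) (m.eP y) := by
  have h := hm.utility_eq hE hy
  unfold utility at h
  unfold profit reducedCost
  rw [← h]; ring

/-- Types below `y` cannot imitate `y`, but the inequality is automatic there: from λ(w) ≤ w if no
refund without evidence is needed, and otherwise because the line stays above λ(y) ≥ λ(w). With
lines on the whole type space, λ becomes an infimum of affine functions. -/
theorem Tight.le_line_types (hE : E.Admissible) (hm : m.Tight E) (hy : y ∈ E.types) {w : ℝ}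
    (hw : w ∈ E.types) :
    m.loss E w ≤ y + m.eP y * (w - y) - max (m.RNA y - m.eP y * (y + E.τ)) 0 := by
  rcases le_total y w with h | h
  · exact hm.le_line hE hy le_rfl ⟨h, hw.2⟩
  obtain ⟨he, hp, -, -, -⟩ := hm.1.feasible y hy
  have hself := hm.1.loss_le_self hE hw
  have hτ : 0 ≤ w + E.τ := by linarith [hE.xlo_nonneg, hE.τ_pos, hw.1]
  rcases max_cases (m.RNA y - m.eP y * (y + E.τ)) 0 with ⟨h4, h5⟩ | ⟨h4, h5⟩ <;> rw [h4]
  · have h3 : 0 ≤ m.eP y * (y + E.τ) := mul_nonneg hp.1 (by linarith)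
    have h6 := hm.RNA_eq hE hy
    have h7 := hE.uA_nonneg he
    have h8 := hm.loss_monotoneOn hE hw hy h
    have h9 := mul_nonneg hp.1 hτ
    rcases max_cases (y - m.loss E y - E.uA (m.eA y)) 0 with ⟨h10, h11⟩ | ⟨h10, h11⟩ <;>
      rw [h10] at h6
    · nlinarith
    · have : m.eP y * (y + E.τ) = 0 := by linarith
      have h13 := mul_nonneg hp.1 (sub_nonneg.2 h)
      nlinarith [hp.2]
  · nlinarith [hp.2]

/-- Give each type its own efforts with the smallest refunds. Profits do not fall and the lines rise
to those in the infimum, so tightness forces equality. -/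
theorem Tight.loss_eq_sInf (hE : E.Admissible) (hm : m.Tight E) : ∀ w ∈ E.types, m.loss E w =
    sInf ((fun y => y + m.eP y * (w - y) - max (m.RNA y - m.eP y * (y + E.τ)) 0) '' E.types) := by
  refine hm.eq_of_forall_exists (fun w hw => ?_) fun y hy => ?_
  · refine le_csInf ⟨_, w, hw, rfl⟩ ?_
    rintro _ ⟨y, hy, rfl⟩
    exact hm.le_line_types hE hy hw
  · have hv := hm.1.validAt hE hy
    have hu := hE.uA_nonneg hv.feasible.1
    have hlo := hm.xlo_le_loss hE hy
    have h0 := hE.xlo_nonneg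
    have hR : m.RNA y ≤ y := by
      rw [hm.RNA_eq hE hy]
      exact max_le (by linarith) (h0.trans hy.1)
    obtain ⟨n, hf, ho, hd, hun, hpr⟩ := exists_scheme hE hy hv.feasible.1 hv.feasible.2.1
      (hm.RNA_nonneg hy) hR
    refine ⟨n, ⟨hf, ho, fun w hw => ?_, ?_⟩, ?_⟩
    · rw [hd]
      have hw' : w ∈ E.types := ⟨hy.1.trans hw.1, hw.2⟩
      refine csInf_le ⟨m.loss E w, ?_⟩ ⟨y, hy, rfl⟩
      rintro _ ⟨z, hz, rfl⟩
      exact hm.le_line_types hE hz hw'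
    · have h1 : m.loss E y ≤ sInf ((fun z => z + m.eP z * (y - z) -
          max (m.RNA z - m.eP z * (z + E.τ)) 0) '' E.types) := by
        refine le_csInf ⟨_, y, hy, rfl⟩ ?_
        rintro _ ⟨z, hz, rfl⟩
        exact hm.le_line_types hE hz hy
      rw [hun, ← hm.evidenceRent_eq hE hy]
      have := hv.truthful
      unfold utility at this
      linarith
    · rw [hpr, ← hm.evidenceRent_eq hE hy]
      unfold profit
      linarith

theorem Tight.loss_concaveOn (hE : E.Admissible) (hm : m.Tight E) :
    ConcaveOn ℝ E.types (m.loss E) := by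
  refine ⟨convex_Icc _ _, fun x hx z hz a b ha hb hab => ?_⟩
  have hw := convex_Icc E.xlo E.xhi hx hz ha hb hab
  rw [hm.loss_eq_sInf hE _ hw]
  refine le_csInf ⟨_, x, hx, rfl⟩ ?_
  rintro _ ⟨y, hy, rfl⟩
  have h1 := mul_le_mul_of_nonneg_left (hm.le_line_types hE hy hx) ha
  have h2 := mul_le_mul_of_nonneg_left (hm.le_line_types hE hy hz) hb
  simp only [smul_eq_mul]
  have hb' : b = 1 - a := by linarith
  subst hb'
  nlinarith

theorem Tight.loss_sub_le (hE : E.Admissible) (hm : m.Tight E) {y' : ℝ} (hy : y ∈ E.types)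
    (hy' : y' ∈ E.types) (hle : y ≤ y') : m.loss E y' - m.loss E y ≤ y' - y := by
  suffices m.loss E y' - (y' - y) ≤ m.loss E y by linarith
  rw [hm.loss_eq_sInf hE y hy]
  refine le_csInf ⟨_, y, hy, rfl⟩ ?_
  rintro _ ⟨z, hz, rfl⟩
  have h1 := hm.le_line_types hE hz hy'
  have h2 := (hm.1.feasible z hz).2.1.2
  simp only
  nlinarith

theorem Tight.reducedSolution (hE : E.Admissible) (hm : m.Tight E) :
    E.ReducedSolution (m.loss E) m.eA m.eP where
  mono := hm.loss_monotoneOn hE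
  concave := hm.loss_concaveOn hE
  le_self := fun _ hy => hm.1.loss_le_self hE hy
  xlo_le := fun _ hy => hm.xlo_le_loss hE hy
  sub_le := fun _ hy _ hy' h => hm.loss_sub_le hE hy hy' h
  feasible := fun y hy => by
    obtain ⟨he, hp, -, -, -⟩ := hm.1.feasible y hy
    refine ⟨he, hp, fun w hw => ?_, fun w hw => ?_⟩
    · have h1 := hm.le_line_types hE hy hw
      have h2 := le_max_right (m.RNA y - m.eP y * (y + E.τ)) 0
      linarith
    · have h1 := hm.le_line_types hE hy hw
      have h2 := le_max_left (m.RNA y - m.eP y * (y + E.τ)) 0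
      have h3 := hm.RNA_eq hE hy
      have h4 := le_max_left (y - m.loss E y - E.uA (m.eA y)) 0
      nlinarith
  eA_lt_one := fun _ hy => hm.eA_lt_one hE hy
  optimal := fun y hy e' p' h => by
    have h1 := hm.sub_profit_le_of_reducedFeasible hE hy h
    rw [hm.profit_eq hE hy] at h1
    linarith

/-- A higher type can copy the efforts of a lower one: both constraints relax, and the required
utility grows by no more than the surplus because λ is nondecreasing. -/
theorem Tight.profit_monotoneOn (hE : E.Admissible) (hm : m.Tight E) :
    MonotoneOn (m.profit E) E.types := by
  intro y hy y' hy' hle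
  have hS := hm.reducedSolution hE
  have hf := hS.feasible y hy
  have hmono := hS.mono hy hy' hle
  have h1 := hm.sub_profit_le_of_reducedFeasible hE hy' (e := m.eA y) (p := m.eP y)
    ⟨hf.eA_mem, hf.eP_mem, fun w hw => by nlinarith [hf.le_line w hw, hf.eP_mem.2],
      fun w hw => by linarith [hf.le_rent w hw]⟩
  rw [hm.profit_eq hE hy]
  unfold reducedCost at h1 ⊢
  have h2 : max (y' - m.loss E y') (E.uA (m.eA y)) ≤
      y' - y + max (y - m.loss E y) (E.uA (m.eA y)) :=
    max_le (by linarith [le_max_left (y - m.loss E y) (E.uA (m.eA y))])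
      (by linarith [le_max_right (y - m.loss E y) (E.uA (m.eA y))])
  linarith

/-- With random audits no refund without evidence is larger than necessary. -/
theorem Tight.rN_eq (hE : E.Admissible) (hm : m.Tight E) (hy : y ∈ E.types)
    (hp : m.eP y ∈ Ioo (0 : ℝ) 1) :
    (1 - m.eP y) * m.rN y = max (m.RNA y - m.eP y * (y + E.τ)) 0 := by
  have hv := hm.1.validAt hE hy
  obtain ⟨he, -, -, hP, hN⟩ := hv.feasible
  have hR : m.RNA y = m.eP y * m.rP y + (1 - m.eP y) * m.rN y := rfl
  set p := m.eP y with hpdef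
  refine le_antisymm ?_ (max_le ?_ (mul_nonneg (sub_nonneg.2 hp.2.le) hN.1))
  swap
  · nlinarith [mul_le_mul_of_nonneg_left hP.2 hp.1.le]
  by_contra! hlt
  set η := (1 - p) * m.rN y - max (m.RNA y - p * (y + E.τ)) 0 with hη
  have hη0 : 0 < η := by linarith
  have hbτ : 0 < E.xhi + E.τ := by linarith [hE.xlo_nonneg, hE.τ_pos, hE.xlo_lt_xhi]
  -- For types above `y` both lines clear λ by `η`, hence still lie above it when the slope falls by
  -- this `ε`. A cheaper audit would thus be feasible.
  set ε := min p (η / (E.xhi + E.τ)) with hε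
  have hε0 : 0 < ε := lt_min hp.1 (by positivity)
  have hεη : ε * (E.xhi + E.τ) ≤ η := by
    have := min_le_right p (η / (E.xhi + E.τ))
    rwa [← hε, le_div_iff₀ hbτ] at this
  have hεp : ε ≤ p := min_le_left _ _
  have hp' : p - ε ∈ Icc (0 : ℝ) 1 := ⟨by linarith, by linarith [hp.2]⟩
  have hy0 : 0 ≤ y + E.τ := by linarith [hE.xlo_nonneg, hE.τ_pos, hy.1]
  have hS := hm.reducedSolution hE
  have h1 := hS.optimal y hy (m.eA y) (p - ε) ⟨he, hp', fun w hw => ?_, fun w hw => ?_⟩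
  · have h2 := hE.cost_P.strictMonoOn hp' ⟨hp.1.le, hp.2.le⟩ (by linarith : p - ε < p)
    have h3 := hm.eA_lt_one hE hy
    unfold reducedCost at h1
    rw [← hpdef] at h1
    nlinarith
  · rcases le_total y w with h | h
    · have h2 := hv.le_deviationLoss w ⟨h, hw.2⟩
      rw [deviationLoss_eq, ← hpdef] at h2
      have h3 := le_max_right (m.RNA y - p * (y + E.τ)) 0
      have h4 : ε * (w - y) ≤ ε * (E.xhi + E.τ) :=
        mul_le_mul_of_nonneg_left (by linarith [hw.2, hE.τ_pos]) hε0.le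
      nlinarith
    · nlinarith [hS.le_self w hw, hp'.2]
  · rcases le_total y w with h | h
    · have h2 := hv.le_deviationLoss w ⟨h, hw.2⟩
      rw [deviationLoss_eq, ← hpdef] at h2
      have h3 := le_max_left (m.RNA y - p * (y + E.τ)) 0
      have h4 : ε * (w + E.τ) ≤ ε * (E.xhi + E.τ) :=
        mul_le_mul_of_nonneg_left (by linarith [hw.2]) hε0.le
      have h5 := hm.RNA_eq hE hy
      have h6 := le_max_left (y - m.loss E y - E.uA (m.eA y)) 0
      nlinarith
    · have h2 := hS.mono hw hy h
      have h3 := hE.uA_nonneg he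
      have h4 : 0 ≤ (p - ε) * (w + E.τ) :=
        mul_nonneg hp'.1 (by linarith [hE.xlo_nonneg, hE.τ_pos, hw.1])
      linarith

end TaxMechanism

/-! ### The smallest slope and the conjugate of the loss function -/

namespace AuditEnv

/-- The smallest slope of a line through `(y, y)` that lies above `lam`. -/
def minSlope (E : AuditEnv) (lam : ℝ → ℝ) (y : ℝ) : ℝ :=
  sInf {q | q ∈ Icc (0 : ℝ) 1 ∧ ∀ w ∈ E.types, lam w ≤ y + q * (w - y)}

/-- The value at `-τ` of the supporting line of `lam` with slope `q`. -/
def supportValue (E : AuditEnv) (lam : ℝ → ℝ) (q : ℝ) : ℝ :=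
  sSup ((fun w => lam w - q * (w + E.τ)) '' E.types)

variable {E : AuditEnv} {lam e p : ℝ → ℝ} {y y' q q' : ℝ}

theorem Admissible.add_τ_pos (hE : E.Admissible) (hy : y ∈ E.types) : 0 < y + E.τ := by
  linarith [hE.xlo_nonneg, hE.τ_pos, hy.1]

namespace ReducedSolution

theorem minSlope_le (hq : q ∈ Icc (0 : ℝ) 1) (h : ∀ w ∈ E.types, lam w ≤ y + q * (w - y)) :
    E.minSlope lam y ≤ q :=
  csInf_le ⟨0, fun _ hr => hr.1.1⟩ ⟨hq, h⟩

section

variable (hS : E.ReducedSolution lam e p)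
include hS

theorem one_mem_slopes :
    (1 : ℝ) ∈ {q | q ∈ Icc (0 : ℝ) 1 ∧ ∀ w ∈ E.types, lam w ≤ y + q * (w - y)} :=
  ⟨one_mem_effort, fun w hw => by linarith [hS.le_self w hw]⟩

theorem minSlope_mem : E.minSlope lam y ∈ Icc (0 : ℝ) 1 :=
  ⟨le_csInf ⟨1, hS.one_mem_slopes⟩ fun _ hr => hr.1.1,
    minSlope_le one_mem_effort (hS.one_mem_slopes (y := y)).2⟩

theorem le_line_minSlope {w : ℝ} (hw : w ∈ E.types) :
    lam w ≤ y + E.minSlope lam y * (w - y) := by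
  rcases le_or_gt w y with h | h
  · nlinarith [hS.le_self w hw, (hS.minSlope_mem (y := y)).2]
  · have : (lam w - y) / (w - y) ≤ E.minSlope lam y := by
      refine le_csInf ⟨1, hS.one_mem_slopes⟩ fun r hr => ?_
      rw [div_le_iff₀ (by linarith)]
      linarith [hr.2 w hw]
    rw [div_le_iff₀ (by linarith)] at this
    linarith

theorem le_line_of_minSlope_le (hq : E.minSlope lam y ≤ q) (hq1 : q ≤ 1) {w : ℝ}
    (hw : w ∈ E.types) : lam w ≤ y + q * (w - y) := by
  rcases le_or_gt w y with h | h
  · nlinarith [hS.le_self w hw]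
  · nlinarith [hS.le_line_minSlope (y := y) hw]

theorem minSlope_antitone : Antitone (E.minSlope lam) := fun y y' h =>
  minSlope_le hS.minSlope_mem fun w hw => by
    nlinarith [hS.le_line_minSlope (y := y) hw, (hS.minSlope_mem (y := y)).2]

theorem exists_lt_of_lt_minSlope (hq0 : 0 ≤ q) (hq : q < E.minSlope lam y) :
    ∃ w ∈ E.types, y + q * (w - y) < lam w := by
  by_contra! h
  exact absurd (minSlope_le ⟨hq0, hq.le.trans hS.minSlope_mem.2⟩ h) (not_le.2 hq)

theorem continuousOn : ContinuousOn lam E.types := by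
  have : LipschitzOnWith 1 lam E.types := by
    refine LipschitzOnWith.of_dist_le_mul fun x hx z hz => ?_
    rw [Real.dist_eq, Real.dist_eq, NNReal.coe_one, one_mul]
    rcases le_total x z with h | h
    · have h1 := hS.mono hx hz h
      have h2 := hS.sub_le x hx z hz h
      rw [abs_of_nonpos (by linarith), abs_of_nonpos (by linarith)]
      linarith
    · have h1 := hS.mono hz hx h
      have h2 := hS.sub_le z hz x hx h
      rw [abs_of_nonneg (by linarith), abs_of_nonneg (by linarith)]
      linarith
  exact this.continuousOn

theorem exists_gap (hE : E.Admissible) (h : ∀ w ∈ E.types, lam w < y + q * (w - y)) :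
    ∃ η > 0, ∀ w ∈ E.types, lam w + η ≤ y + q * (w - y) := by
  have hc : ContinuousOn (fun w => y + q * (w - y) - lam w) E.types :=
    (by fun_prop : Continuous fun w => y + q * (w - y)).continuousOn.sub hS.continuousOn
  obtain ⟨w₀, hw₀, hmin⟩ := isCompact_Icc.exists_isMinOn ⟨E.xlo, hE.xlo_mem⟩ hc
  refine ⟨y + q * (w₀ - y) - lam w₀, by linarith [h w₀ hw₀], fun w hw => ?_⟩
  have := hmin hw
  simp only [mem_ofPred_eq] at this
  linarith

theorem lt_line (hy : y ∈ E.types) (hlt : lam y < y) (hq : E.minSlope lam y < q) (hq1 : q < 1)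
    {w : ℝ} (hw : w ∈ E.types) : lam w < y + q * (w - y) := by
  rcases lt_trichotomy w y with h | rfl | h
  · nlinarith [hS.le_self w hw]
  · linarith
  · nlinarith [hS.le_line_minSlope (y := y) hw]

theorem minSlope_lt_one (hy : y ∈ E.types) (hyx : y < E.xhi) (hlt : lam y < y) :
    E.minSlope lam y < 1 := by
  -- As `lam` is 1-Lipschitz, the line of slope one clears it by `y - lam y` above `y`; this slack
  -- is spread over the distance to `xhi`.
  set q := max 0 (1 - (y - lam y) / (E.xhi - y)) with hq
  have hpos : 0 < (y - lam y) / (E.xhi - y) := div_pos (by linarith) (by linarith)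
  have hq1 : q < 1 := max_lt one_pos (by linarith)
  refine lt_of_le_of_lt (minSlope_le ⟨le_max_left _ _, hq1.le⟩ fun w hw => ?_) hq1
  rcases le_total w y with h | h
  · nlinarith [hS.le_self w hw]
  · have h1 := hS.sub_le y hy w hw h
    have h2 : 1 - (y - lam y) / (E.xhi - y) ≤ q := le_max_right _ _
    have h3 : (y - lam y) / (E.xhi - y) * (w - y) ≤ y - lam y := by
      rw [div_mul_eq_mul_div, div_le_iff₀ (by linarith)]
      nlinarith [hw.2]
    nlinarith

theorem minSlope_eq_zero (hy : lam E.xhi ≤ y) (hE : E.Admissible) : E.minSlope lam y = 0 :=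
  le_antisymm (minSlope_le zero_mem_effort fun w hw => by
    linarith [hS.mono hw hE.xhi_mem hw.2]) hS.minSlope_mem.1

theorem minSlope_pos (hE : E.Admissible) (hy : y < lam E.xhi) : 0 < E.minSlope lam y := by
  refine lt_of_le_of_ne hS.minSlope_mem.1 fun h => ?_
  have := hS.le_line_minSlope (y := y) hE.xhi_mem
  rw [← h] at this
  linarith

theorem minSlope_eq_one {z : ℝ} (hz : z ∈ E.types) (hlz : lam z = z) (hyz : y < z) :
    E.minSlope lam y = 1 := by
  refine le_antisymm hS.minSlope_mem.2 ?_
  have := hS.le_line_minSlope (y := y) hz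
  rw [hlz] at this
  nlinarith

/-- The line of slope r through (y', y') lies (1 - r)(y' - y) above the parallel line through (y,
y), which leaves room for a smaller slope. -/
theorem minSlope_lt_of_lt (hE : E.Admissible) (h0 : 0 < E.minSlope lam y)
    (h1 : E.minSlope lam y < 1) (hlt : y < y') (hy' : y' ∈ E.types) :
    E.minSlope lam y' < E.minSlope lam y := by
  set r := E.minSlope lam y with hr
  have hL : 0 < E.xhi - E.xlo := by linarith [hE.xlo_lt_xhi]
  have hd : 0 < (1 - r) * (y' - y) := mul_pos (by linarith) (by linarith)
  set ε := min r ((1 - r) * (y' - y) / (E.xhi - E.xlo)) with hε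
  have hε0 : 0 < ε := lt_min h0 (by positivity)
  have hε1 : ε * (E.xhi - E.xlo) ≤ (1 - r) * (y' - y) := by
    have := min_le_right r ((1 - r) * (y' - y) / (E.xhi - E.xlo))
    rwa [← hε, le_div_iff₀ hL] at this
  have hεr : ε ≤ r := min_le_left _ _
  have : E.minSlope lam y' ≤ r - ε := by
    refine minSlope_le ⟨by linarith, by linarith⟩ fun w hw => ?_
    have h2 := hS.le_line_minSlope (y := y) hw
    rw [← hr] at h2
    have h3 : ε * (w - y') ≤ ε * (E.xhi - E.xlo) :=
      mul_le_mul_of_nonneg_left (by linarith [hw.2, hy'.1]) hε0.le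
    nlinarith
  linarith

/-- Without a contact point, compactness gives a uniform gap and the slope could be lowered. -/
theorem exists_eq_line (hE : E.Admissible) (hy : y ∈ E.types)
    (h0 : 0 < E.minSlope lam y) :
    ∃ w ∈ E.types, y + E.minSlope lam y * (w - y) ≤ lam w := by
  by_contra! h
  obtain ⟨η, hη, hgap⟩ := hS.exists_gap hE h
  set r := E.minSlope lam y with hr
  have hL : 0 < E.xhi - E.xlo := by linarith [hE.xlo_lt_xhi]
  set ε := min r (η / (E.xhi - E.xlo)) with hε
  have hε0 : 0 < ε := lt_min h0 (by positivity)
  have hε1 : ε * (E.xhi - E.xlo) ≤ η := by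
    have := min_le_right r (η / (E.xhi - E.xlo))
    rwa [← hε, le_div_iff₀ hL] at this
  have hεr : ε ≤ r := min_le_left _ _
  have hr1 : r ≤ 1 := hS.minSlope_mem.2
  have : r ≤ r - ε := by
    refine minSlope_le ⟨by linarith, by linarith⟩ fun w hw => ?_
    have h2 := hgap w hw
    have h3 : ε * (w - y) ≤ ε * (E.xhi - E.xlo) :=
      mul_le_mul_of_nonneg_left (by linarith [hw.2, hy.1]) hε0.le
    nlinarith
  linarith

theorem minSlope_lowerSemicontinuous {a : ℝ} (ha : a < E.minSlope lam y) :
    ∀ᶠ z in nhds y, a < E.minSlope lam z := by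
  rcases lt_or_ge a 0 with h | h
  · exact Filter.Eventually.of_forall fun z => h.trans_le hS.minSlope_mem.1
  · obtain ⟨w, hw, hlt⟩ := hS.exists_lt_of_lt_minSlope h ha
    have hc : Continuous fun z : ℝ => z + a * (w - z) := by fun_prop
    filter_upwards [hc.continuousAt.eventually_lt continuousAt_const hlt] with z hz
    by_contra! hle
    exact absurd (hS.le_line_of_minSlope_le hle (ha.le.trans hS.minSlope_mem.2) hw) (not_le.2 hz)

/-- Since `lam y < y`, a slightly steeper line through (y, y) lies strictly above `lam`, with a
uniform gap that survives moving y. At a fixed point of `lam` this argument fails, whence the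
possible jump at inf SL. -/
theorem minSlope_upperSemicontinuous (hE : E.Admissible) (hy : y ∈ E.types) (hlt : lam y < y)
    {a : ℝ} (ha : E.minSlope lam y < a) : ∀ᶠ z in nhds y, E.minSlope lam z < a := by
  rcases lt_or_ge 1 a with h | h
  · exact Filter.Eventually.of_forall fun z => hS.minSlope_mem.2.trans_lt h
  · obtain ⟨b, hb1, hb2⟩ := exists_between ha
    obtain ⟨η, hη, hgap⟩ := hS.exists_gap hE
      (fun w hw => hS.lt_line hy hlt hb1 (hb2.trans_le h) hw)
    have hb0 : 0 ≤ b := hS.minSlope_mem.1.trans hb1.le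
    filter_upwards [Ioi_mem_nhds (show y - η < y by linarith)] with z hz
    have hz' : y - η < z := hz
    refine lt_of_le_of_lt (minSlope_le ⟨hb0, (hb2.le.trans h)⟩ fun w hw => ?_) hb2
    have h1 := hgap w hw
    have h2 : b ≤ 1 := hb2.le.trans h
    rcases le_total y z with h3 | h3
    · nlinarith
    · nlinarith

theorem minSlope_continuousOn (hE : E.Admissible) {z : ℝ} (hz : z ∈ E.types)
    (hlt : ∀ y ∈ E.types, z < y → lam y < y) :
    ContinuousOn (E.minSlope lam) (Icc z E.xhi) := by
  intro y hy
  have hyX : y ∈ E.types := ⟨hz.1.trans hy.1, hy.2⟩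
  refine tendsto_order.2 ⟨fun a ha => ?_, fun a ha => ?_⟩
  · exact mem_nhdsWithin_of_mem_nhds (hS.minSlope_lowerSemicontinuous ha)
  · rcases hy.1.eq_or_lt with rfl | h
    -- At the left end point `z` monotonicity replaces upper semicontinuity.
    · filter_upwards [self_mem_nhdsWithin] with x hx
      exact (hS.minSlope_antitone hx.1).trans_lt ha
    · exact mem_nhdsWithin_of_mem_nhds
        (hS.minSlope_upperSemicontinuous hE hyX (hlt y hyX h) ha)

/-! ### The supporting lines of the loss function -/

theorem le_supportValue (hE : E.Admissible) (hq : 0 ≤ q) {w : ℝ} (hw : w ∈ E.types) :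
    lam w - q * (w + E.τ) ≤ E.supportValue lam q := by
  refine le_csSup ⟨E.xhi, ?_⟩ ⟨w, hw, rfl⟩
  rintro _ ⟨z, hz, rfl⟩
  have h1 := hS.le_self z hz
  have h2 := mul_nonneg hq (hE.add_τ_pos hz).le
  simp only
  linarith [hz.2]

omit hS in
theorem supportValue_le (hE : E.Admissible) {c : ℝ}
    (h : ∀ w ∈ E.types, lam w - q * (w + E.τ) ≤ c) : E.supportValue lam q ≤ c := by
  refine csSup_le ⟨_, E.xlo, hE.xlo_mem, rfl⟩ ?_
  rintro _ ⟨z, hz, rfl⟩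
  exact h z hz

/-- As a supremum of affine functions of q with slopes -(w + τ), `supportValue` falls at a rate
between xlo + τ and xhi + τ. These bounds serve as exchange rates between the efforts. -/
theorem supportValue_sub_le (hE : E.Admissible) (hq : 0 ≤ q) (hqq' : q ≤ q') :
    E.supportValue lam q - E.supportValue lam q' ≤ (E.xhi + E.τ) * (q' - q) := by
  have : E.supportValue lam q ≤ E.supportValue lam q' + (E.xhi + E.τ) * (q' - q) := by
    refine supportValue_le hE fun w hw => ?_
    have := hS.le_supportValue hE (hq.trans hqq') hw
    nlinarith [hw.2]
  linarith

theorem le_supportValue_sub (hE : E.Admissible) (hq : 0 ≤ q) (hqq' : q ≤ q') :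
    (E.xlo + E.τ) * (q' - q) ≤ E.supportValue lam q - E.supportValue lam q' := by
  have : E.supportValue lam q' ≤ E.supportValue lam q - (E.xlo + E.τ) * (q' - q) := by
    refine supportValue_le hE fun w hw => ?_
    have := hS.le_supportValue hE hq hw
    nlinarith [hw.1]
  linarith

/-- Convexity: each function in the supremum is affine in the slope. -/
theorem supportValue_le_chord (hE : E.Admissible) (hq : 0 ≤ q) (hqq' : q < q') {r : ℝ}
    (hr : r ∈ Icc q q') :
    E.supportValue lam r ≤ E.supportValue lam q -
      (E.supportValue lam q - E.supportValue lam q') / (q' - q) * (r - q) := by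
  refine supportValue_le hE fun w hw => ?_
  have h1 := hS.le_supportValue hE hq hw
  have h2 := hS.le_supportValue hE (hq.trans hqq'.le) hw
  set A := E.supportValue lam q
  set B := E.supportValue lam q'
  have hd : 0 < q' - q := by linarith
  rw [div_mul_eq_mul_div, le_sub_iff_add_le', ← le_sub_iff_add_le, div_le_iff₀ hd]
  nlinarith [mul_le_mul_of_nonneg_left h1 (sub_nonneg.2 hr.2),
    mul_le_mul_of_nonneg_left h2 (sub_nonneg.2 hr.1)]

theorem supportValue_continuousOn (hE : E.Admissible) :
    ContinuousOn (E.supportValue lam) (Icc 0 1) := by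
  have hτ := hE.add_τ_pos hE.xhi_mem
  have : LipschitzOnWith (E.xhi + E.τ).toNNReal (E.supportValue lam) (Icc 0 1) := by
    refine LipschitzOnWith.of_dist_le_mul fun x hx z hz => ?_
    rw [Real.dist_eq, Real.dist_eq, Real.coe_toNNReal _ hτ.le]
    have hlo := (hE.add_τ_pos hE.xlo_mem).le
    rcases le_total x z with h | h
    · have h1 := hS.supportValue_sub_le hE hx.1 h
      have h2 := hS.le_supportValue_sub hE hx.1 h
      have h3 := mul_nonneg hlo (sub_nonneg.2 h)
      rw [abs_of_nonneg (by linarith), abs_of_nonpos (by linarith)]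
      linarith
    · have h1 := hS.supportValue_sub_le hE hz.1 h
      have h2 := hS.le_supportValue_sub hE hz.1 h
      have h3 := mul_nonneg hlo (sub_nonneg.2 h)
      rw [abs_of_nonpos (by linarith), abs_of_nonneg (by linarith)]
      linarith
  exact this.continuousOn

theorem supportValue_minSlope_le (hE : E.Admissible) :
    E.supportValue lam (E.minSlope lam y) ≤ y - E.minSlope lam y * (y + E.τ) :=
  supportValue_le hE fun w hw => by linarith [hS.le_line_minSlope (y := y) hw]

theorem supportValue_minSlope (hE : E.Admissible) (hy : y ∈ E.types)
    (h0 : 0 < E.minSlope lam y) :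
    E.supportValue lam (E.minSlope lam y) = y - E.minSlope lam y * (y + E.τ) := by
  refine le_antisymm (hS.supportValue_minSlope_le hE) ?_
  obtain ⟨w, hw, h⟩ := hS.exists_eq_line hE hy h0
  have := hS.le_supportValue hE hS.minSlope_mem.1 (q := E.minSlope lam y) hw
  linarith

theorem supportValue_zero (hE : E.Admissible) : E.supportValue lam 0 = lam E.xhi := by
  refine le_antisymm (supportValue_le hE fun w hw => ?_) ?_
  · linarith [hS.mono hw hE.xhi_mem hw.2]
  · linarith [hS.le_supportValue hE le_rfl hE.xhi_mem]

theorem reducedFeasible_of (hE : E.Admissible) {x r : ℝ} (hx : x ∈ Icc (0 : ℝ) 1)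
    (hr : E.minSlope lam y ≤ r) (hr1 : r ≤ 1) (h : E.supportValue lam r ≤ lam y + E.uA x) :
    E.ReducedFeasible lam y x r :=
  ⟨hx, ⟨hS.minSlope_mem.1.trans hr, hr1⟩, fun _ hw => hS.le_line_of_minSlope_le hr hr1 hw,
    fun _ hw => (hS.le_supportValue hE (hS.minSlope_mem.1.trans hr) hw).trans h⟩

theorem eA_mem (hy : y ∈ E.types) : e y ∈ Icc (0 : ℝ) 1 := (hS.feasible y hy).eA_mem

theorem eP_mem (hy : y ∈ E.types) : p y ∈ Icc (0 : ℝ) 1 := (hS.feasible y hy).eP_mem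

theorem minSlope_le_eP (hy : y ∈ E.types) : E.minSlope lam y ≤ p y :=
  minSlope_le (hS.eP_mem hy) (hS.feasible y hy).le_line

theorem supportValue_le_rent (hE : E.Admissible) (hy : y ∈ E.types) :
    E.supportValue lam (p y) ≤ lam y + E.uA (e y) :=
  supportValue_le hE (hS.feasible y hy).le_rent

theorem supportValue_le_line (hE : E.Admissible) (hy : y ∈ E.types) :
    E.supportValue lam (p y) ≤ y - p y * (y + E.τ) :=
  supportValue_le hE fun w hw => by linarith [(hS.feasible y hy).le_line w hw]

/-- The principal's effort is minimal whenever the resulting optimal agent effort leaves enough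
rent. -/
theorem eq_of_isMin (hE : E.Admissible) (hy : y ∈ E.types) {x : ℝ} (hx : x ∈ Icc (0 : ℝ) 1)
    (hmin : ∀ z ∈ Icc (0 : ℝ) 1, z ≠ x →
      max (y - lam y) (E.uA x) + E.cA x - E.cP (E.minSlope lam y) * x <
        max (y - lam y) (E.uA z) + E.cA z - E.cP (E.minSlope lam y) * z)
    (hrent : E.supportValue lam (E.minSlope lam y) ≤ lam y + E.uA x) :
    e y = x ∧ p y = E.minSlope lam y := by
  have h1 := hS.optimal y hy x (E.minSlope lam y)
    (hS.reducedFeasible_of hE hx le_rfl hS.minSlope_mem.2 hrent)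
  have h2 := hS.minSlope_le_eP hy
  have h3 := hE.cost_P.strictMonoOn.monotoneOn hS.minSlope_mem (hS.eP_mem hy) h2
  have he := hS.eA_lt_one y hy
  unfold reducedCost at h1
  -- Since `p y` is at least the smallest slope, the cost at `(e y, p y)` is at least the cost of `e
  -- y` at the smallest slope, where `x` is the strict minimizer.
  have hex : e y = x := by
    by_contra hne
    have := hmin (e y) (hS.eA_mem hy) hne
    nlinarith
  refine ⟨hex, ?_⟩
  by_contra hne
  have h4 := hE.cost_P.strictMonoOn hS.minSlope_mem (hS.eP_mem hy) (lt_of_le_of_ne h2 (Ne.symm hne))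
  rw [hex] at h1 he
  nlinarith

end

end ReducedSolution

/-! ### Optimal agent efforts for a given principal's effort -/

section

variable {s g : ℝ} (hE : E.Admissible) (hs : s ∈ Icc 0 (E.cP 1))
include hE hs

theorem Admissible.lowEffort_isMin (hg : g ≤ E.uA (E.lowEffort s)) {z : ℝ}
    (hz : z ∈ Icc (0 : ℝ) 1) (hne : z ≠ E.lowEffort s) :
    max g (E.uA (E.lowEffort s)) + E.cA (E.lowEffort s) - s * E.lowEffort s <
      max g (E.uA z) + E.cA z - s * z := by
  have h1 := hE.reward_strictConvexOn.tangent_lt_of_ne hE.reward_differentiableOn hz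
    (hE.lowEffort_mem hs) hne
  rw [hE.deriv_lowEffort hs, reward_eq, reward_eq] at h1
  rw [max_eq_right hg]
  linarith [le_max_right g (E.uA z)]

theorem Admissible.effEffort_isMin (hg : E.uA (E.effEffort s) ≤ g) {z : ℝ}
    (hz : z ∈ Icc (0 : ℝ) 1) (hne : z ≠ E.effEffort s) :
    max g (E.uA (E.effEffort s)) + E.cA (E.effEffort s) - s * E.effEffort s <
      max g (E.uA z) + E.cA z - s * z := by
  have h1 := hE.cost_A.strictConvexOn.tangent_lt_of_ne hE.cost_A.differentiableOn hz
    (hE.effEffort_mem hs) hne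
  rw [hE.deriv_effEffort hs] at h1
  rw [max_eq_left hg]
  linarith [le_max_left g (E.uA z)]

/-- The objective has its kink where the rent equals g. To the left only the cost varies and the
objective falls up to the efficient effort; to the right rent plus cost varies and rises beyond the
low effort. -/
theorem Admissible.between_isMin {x : ℝ} (hx : x ∈ Icc (E.lowEffort s) (E.effEffort s))
    (hg : E.uA x = g) {z : ℝ} (hz : z ∈ Icc (0 : ℝ) 1) (hne : z ≠ x) :
    max g (E.uA x) + E.cA x - s * x < max g (E.uA z) + E.cA z - s * z := by
  rw [hg, max_self]
  rcases lt_or_gt_of_ne hne with h | h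
  · have h1 := hE.cost_A.strictConvexOn.sub_mul_strictAntiOn hE.cost_A.differentiableOn
      (hE.effEffort_mem hs) (hE.deriv_effEffort hs) ⟨hz.1, h.le.trans hx.2⟩
      ⟨hz.1.trans h.le, hx.2⟩ h
    simp only at h1
    linarith [le_max_left g (E.uA z)]
  · have h1 := hE.reward_strictConvexOn.sub_mul_strictMonoOn hE.reward_differentiableOn
      (hE.lowEffort_mem hs) (hE.deriv_lowEffort hs) ⟨hx.1, h.le.trans hz.2⟩
      ⟨hx.1.trans h.le, hz.2⟩ h
    simp only [reward_eq] at h1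
    linarith [le_max_right g (E.uA z)]

end

end AuditEnv

/-! ### Thresholds of the regimes with undistorted efforts -/

namespace AuditEnv

/-- The rent of an agent who exerts the effort with marginal reward `c_P`, when the principal's
effort is the smallest slope. -/
def lowRent (E : AuditEnv) (lam : ℝ → ℝ) (y : ℝ) : ℝ :=
  E.uA (E.lowEffort (E.cP (E.minSlope lam y)))

/-- The rent of an agent who exerts the efficient effort, when the principal's effort is the
smallest slope. -/
def effRent (E : AuditEnv) (lam : ℝ → ℝ) (y : ℝ) : ℝ :=
  E.uA (E.effEffort (E.cP (E.minSlope lam y)))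

variable {E : AuditEnv} {lam e p : ℝ → ℝ} {y y' z : ℝ}

namespace ReducedSolution

variable (hS : E.ReducedSolution lam e p)
include hS

theorem gap_mono (hy : y ∈ E.types) (hy' : y' ∈ E.types) (h : y ≤ y') :
    y - lam y ≤ y' - lam y' := by
  linarith [hS.sub_le y hy y' hy' h]

/-- The set of fixed points is closed and contains `xlo`. Its maximum will be inf SL. -/
theorem exists_last_fixed (hE : E.Admissible) :
    ∃ z ∈ E.types, lam z = z ∧ ∀ y ∈ E.types, z < y → lam y < y := by
  have hclosed : IsClosed {y | y ∈ E.types ∧ lam y - y = 0} := by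
    have : {y | y ∈ E.types ∧ lam y - y = 0} = E.types ∩ (fun y => lam y - y) ⁻¹' {0} := rfl
    rw [this]
    exact (hS.continuousOn.sub continuousOn_id).preimage_isClosed_of_isClosed isClosed_Icc
      isClosed_singleton
  have hne : {y | y ∈ E.types ∧ lam y - y = 0}.Nonempty := by
    refine ⟨E.xlo, hE.xlo_mem, ?_⟩
    linarith [hS.le_self _ hE.xlo_mem, hS.xlo_le _ hE.xlo_mem]
  have hbdd : BddAbove {y | y ∈ E.types ∧ lam y - y = 0} := ⟨E.xhi, fun _ h => h.1.2⟩
  have hmem := hclosed.csSup_mem hne hbdd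
  refine ⟨_, hmem.1, by linarith [hmem.2], fun y hy hlt => ?_⟩
  refine lt_of_le_of_ne (hS.le_self y hy) fun h => ?_
  exact absurd (le_csSup hbdd ⟨hy, by linarith⟩) (not_le.2 hlt)

theorem eq_zero_of_eq_xhi (hE : E.Admissible) (hy : y ∈ E.types) (h : lam y = lam E.xhi) :
    e y = 0 ∧ p y = 0 := by
  have h0 : E.minSlope lam y = 0 := hS.minSlope_eq_zero (h ▸ hS.le_self y hy) hE
  have hs : (0 : ℝ) ∈ Icc 0 (E.cP 1) := ⟨le_rfl, hE.cP_one_nonneg⟩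
  have hg : E.uA (E.effEffort 0) ≤ y - lam y := by
    rw [hE.effEffort_zero, hE.uA_zero]; linarith [hS.le_self y hy]
  have := hS.eq_of_isMin hE hy zero_mem_effort (fun x hx hne => ?_) ?_
  · rwa [h0] at this
  · rw [h0, hE.cost_P.map_zero]
    have := hE.effEffort_isMin hs hg hx (by rwa [hE.effEffort_zero])
    rwa [hE.effEffort_zero] at this
  · rw [h0, hS.supportValue_zero hE, h, hE.uA_zero]; linarith

/-- The gap is nonnegative and nondecreasing, so it vanishes below a fixed point z; and a line
through (y, y) that passes above (z, z) has slope at least one. -/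
theorem eq_of_lt_fixed (hE : E.Admissible) (hy : y ∈ E.types) (hz : z ∈ E.types)
    (hlz : lam z = z) (hyz : y < z) : lam y = y ∧ e y = E.lowEffort (E.cP 1) ∧ p y = 1 := by
  have h1 : E.minSlope lam y = 1 := hS.minSlope_eq_one hz hlz hyz
  have hs := hE.cP_mem one_mem_effort
  have hlam : lam y = y := by
    linarith [hS.gap_mono hy hz hyz.le, hS.le_self y hy]
  have hu := hE.uA_nonneg (hE.lowEffort_mem hs)
  refine ⟨hlam, ?_⟩
  have := hS.eq_of_isMin hE hy (hE.lowEffort_mem hs) (fun x hx hne => ?_) ?_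
  · rwa [h1] at this
  · rw [h1]
    exact hE.lowEffort_isMin hs (by linarith) hx hne
  · rw [h1]
    refine supportValue_le hE fun w hw => ?_
    linarith [hS.le_self w hw, hE.τ_pos, hE.xlo_nonneg, hy.1]

/-- Otherwise all types below `z` are audited for sure, and all others have the maximal loss and are
never audited. -/
theorem lt_xhi_of_random (hE : E.Admissible) (hz : z ∈ E.types) (hlz : lam z = z)
    (hr : ∃ x ∈ E.types, p x ∈ Ioo (0 : ℝ) 1) : z < lam E.xhi := by
  by_contra! hle
  obtain ⟨x, hx, hpx⟩ := hr
  rcases lt_or_ge x z with h | h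
  · have := (hS.eq_of_lt_fixed hE hx hz hlz h).2.2
    exact absurd hpx.2 (by rw [this]; exact lt_irrefl _)
  · have h1 := hS.mono hz hx h
    have h2 := hS.mono hx hE.xhi_mem hx.2
    have := (hS.eq_zero_of_eq_xhi hE hx (by linarith)).2
    exact absurd hpx.1 (by rw [this]; exact lt_irrefl _)

theorem lam_xhi_mem (hE : E.Admissible) : lam E.xhi ∈ E.types :=
  ⟨hS.xlo_le _ hE.xhi_mem, hS.le_self _ hE.xhi_mem⟩

theorem slope_le (hx : z ∈ E.types) (hy' : y' ∈ E.types) (h1 : z ≤ y) (h2 : y ≤ y') :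
    (lam y' - lam y) * (y - z) ≤ (lam y - lam z) * (y' - y) := by
  rcases h1.eq_or_lt with rfl | h1
  · simp
  rcases h2.eq_or_lt with rfl | h2
  · simp
  have := hS.concave.slope_anti_adjacent hx hy' h1 h2
  rwa [div_le_div_iff₀ (by linarith) (by linarith)] at this

section

variable (hz : z ∈ E.types) (hlz : lam z = z) (hlt : ∀ y ∈ E.types, z < y → lam y < y)
include hz hlz

/-- The gap is convex and vanishes at `z`, so its ratio to y - z is nondecreasing. Adding z + τ > 0
to the denominator makes the ratio strictly increasing, which is `gap_mul_lt`. -/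
theorem gap_mul_le (hy' : y' ∈ E.types) (hzy : z ≤ y) (hle : y ≤ y') :
    (y - lam y) * (y' - z) ≤ (y' - lam y') * (y - z) := by
  nlinarith [hS.slope_le hz hy' hzy hle]

include hlt

theorem gap_strictMonoOn : StrictMonoOn (fun y => y - lam y) (Icc z E.xhi) := by
  intro y hy y' hy' h
  have hy'X : y' ∈ E.types := ⟨hz.1.trans hy'.1, hy'.2⟩
  have h1 := hS.gap_mul_le hz hlz hy'X hy.1 h.le
  have h2 := hlt y' hy'X (hy.1.trans_lt h)
  simp only
  by_contra! hle
  nlinarith [hy.1]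

theorem gap_mul_lt (hE : E.Admissible) (hy' : y' ∈ E.types) (hzy : z ≤ y) (h : y < y') :
    (y - lam y) * (y' + E.τ) < (y' - lam y') * (y + E.τ) := by
  have h1 := hS.gap_mul_le hz hlz hy' hzy h.le
  have h2 := hlt y' hy' (hzy.trans_lt h)
  have h3 := hE.add_τ_pos hz
  have h4 : 0 < y' - z := by linarith
  have h5 : (y - z) * (y' + E.τ) < (y + E.τ) * (y' - z) := by nlinarith
  have h6 : (y - lam y) * (y' - z) * (y' + E.τ) ≤ (y' - lam y') * ((y - z) * (y' + E.τ)) := by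
    have := mul_le_mul_of_nonneg_right h1 (hE.add_τ_pos hy').le
    linarith
  have h7 := mul_lt_mul_of_pos_left h5 (sub_pos.2 h2)
  by_contra! hle
  have := mul_le_mul_of_nonneg_right hle h4.le
  linarith

end

theorem cP_minSlope_mem (hE : E.Admissible) : E.cP (E.minSlope lam y) ∈ Icc 0 (E.cP 1) :=
  hE.cP_mem hS.minSlope_mem

theorem cP_minSlope_antitone (hE : E.Admissible) : Antitone fun y => E.cP (E.minSlope lam y) :=
  fun _ _ h => hE.cost_P.strictMonoOn.monotoneOn hS.minSlope_mem hS.minSlope_mem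
    (hS.minSlope_antitone h)

theorem lowRent_antitone (hE : E.Admissible) : Antitone (E.lowRent lam) := fun _ _ h =>
  hE.uA_strictMonoOn.monotoneOn (hE.lowEffort_mem (hS.cP_minSlope_mem hE))
    (hE.lowEffort_mem (hS.cP_minSlope_mem hE))
    (hE.lowEffort_strictMonoOn.monotoneOn (hS.cP_minSlope_mem hE) (hS.cP_minSlope_mem hE)
      (hS.cP_minSlope_antitone hE h))

theorem effRent_antitone (hE : E.Admissible) : Antitone (E.effRent lam) := fun _ _ h =>
  hE.uA_strictMonoOn.monotoneOn (hE.effEffort_mem (hS.cP_minSlope_mem hE))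
    (hE.effEffort_mem (hS.cP_minSlope_mem hE))
    (hE.effEffort_strictMonoOn.monotoneOn (hS.cP_minSlope_mem hE) (hS.cP_minSlope_mem hE)
      (hS.cP_minSlope_antitone hE h))

theorem effRent_nonneg (hE : E.Admissible) : 0 ≤ E.effRent lam y :=
  hE.uA_nonneg (hE.effEffort_mem (hS.cP_minSlope_mem hE))

theorem lowRent_lt_effRent (hE : E.Admissible) (hy : y < lam E.xhi) :
    E.lowRent lam y < E.effRent lam y :=
  hE.uA_strictMonoOn (hE.lowEffort_mem (hS.cP_minSlope_mem hE))
    (hE.effEffort_mem (hS.cP_minSlope_mem hE))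
    (hE.lowEffort_lt_effEffort (hS.cP_minSlope_mem hE)
      (hE.cost_P.pos hS.minSlope_mem (hS.minSlope_pos hE hy)))

theorem lowRent_pos (hE : E.Admissible) (hy : y < lam E.xhi) : 0 < E.lowRent lam y :=
  hE.uA_pos (hE.lowEffort_mem (hS.cP_minSlope_mem hE))
    (hE.lowEffort_pos (hS.cP_minSlope_mem hE)
      (hE.cost_P.pos hS.minSlope_mem (hS.minSlope_pos hE hy)))

theorem lowRent_eq_zero (hE : E.Admissible) (hy : lam E.xhi ≤ y) : E.lowRent lam y = 0 := by
  rw [lowRent, hS.minSlope_eq_zero hy hE, hE.cost_P.map_zero, hE.lowEffort_zero, hE.uA_zero]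

theorem effRent_eq_zero (hE : E.Admissible) (hy : lam E.xhi ≤ y) : E.effRent lam y = 0 := by
  rw [effRent, hS.minSlope_eq_zero hy hE, hE.cost_P.map_zero, hE.effEffort_zero, hE.uA_zero]

theorem cP_minSlope_continuousOn (hE : E.Admissible) (hz : z ∈ E.types)
    (hlt : ∀ y ∈ E.types, z < y → lam y < y) :
    ContinuousOn (fun y => E.cP (E.minSlope lam y)) (Icc z E.xhi) :=
  hE.cost_P.differentiableOn.continuousOn.comp (hS.minSlope_continuousOn hE hz hlt)
    fun _ _ => hS.minSlope_mem

theorem low_continuousOn (hE : E.Admissible) (hz : z ∈ E.types)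
    (hlt : ∀ y ∈ E.types, z < y → lam y < y) :
    ContinuousOn (fun y => E.lowEffort (E.cP (E.minSlope lam y))) (Icc z E.xhi) :=
  hE.lowEffort_continuousOn.comp (hS.cP_minSlope_continuousOn hE hz hlt)
    fun _ _ => hS.cP_minSlope_mem hE

theorem eff_continuousOn (hE : E.Admissible) (hz : z ∈ E.types)
    (hlt : ∀ y ∈ E.types, z < y → lam y < y) :
    ContinuousOn (fun y => E.effEffort (E.cP (E.minSlope lam y))) (Icc z E.xhi) :=
  hE.effEffort_continuousOn.comp (hS.cP_minSlope_continuousOn hE hz hlt)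
    fun _ _ => hS.cP_minSlope_mem hE

theorem lowRent_continuousOn (hE : E.Admissible) (hz : z ∈ E.types)
    (hlt : ∀ y ∈ E.types, z < y → lam y < y) : ContinuousOn (E.lowRent lam) (Icc z E.xhi) :=
  hE.uA_continuousOn.comp (hS.low_continuousOn hE hz hlt)
    fun _ _ => hE.lowEffort_mem (hS.cP_minSlope_mem hE)

theorem effRent_continuousOn (hE : E.Admissible) (hz : z ∈ E.types)
    (hlt : ∀ y ∈ E.types, z < y → lam y < y) : ContinuousOn (E.effRent lam) (Icc z E.xhi) :=
  hE.uA_continuousOn.comp (hS.eff_continuousOn hE hz hlt)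
    fun _ _ => hE.effEffort_mem (hS.cP_minSlope_mem hE)

theorem gap_continuousOn (hz : z ∈ E.types) :
    ContinuousOn (fun y => y - lam y) (Icc z E.xhi) :=
  continuousOn_id.sub (hS.continuousOn.mono (Icc_subset_Icc_left hz.1))

/-- The part of the required utility that exceeds the efficient rent, per unit of the largest
refund, grows relative to the smallest slope. -/
theorem excess_lt (hE : E.Admissible) (hz : z ∈ E.types) (hlz : lam z = z)
    (hlt : ∀ y ∈ E.types, z < y → lam y < y) (hy' : y' ∈ E.types) (hzy : z ≤ y) (h : y < y') :
    (y - lam y - E.effRent lam y) / (y + E.τ) - E.minSlope lam y <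
      (y' - lam y' - E.effRent lam y') / (y' + E.τ) - E.minSlope lam y' := by
  have h1 := hS.gap_mul_lt hz hlz hlt hE hy' hzy h
  have h2 := hS.minSlope_antitone h.le
  have h3 := hS.effRent_antitone hE h.le
  have h4 : 0 < y + E.τ := by linarith [hE.add_τ_pos hz]
  have h5 : 0 < y' + E.τ := hE.add_τ_pos hy'
  have h6 := hS.effRent_nonneg hE (y := y')
  have h7 : (y - lam y - E.effRent lam y) / (y + E.τ) <
      (y' - lam y' - E.effRent lam y') / (y' + E.τ) := by
    rw [div_lt_div_iff₀ h4 h5]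
    nlinarith
  linarith

/-- Each threshold is the zero of a strictly increasing continuous function on [z, λ(xhi)]: at `z`
the gap vanishes and the low rent is positive, while at λ(xhi) the smallest slope and both rents
vanish and the gap is positive. -/
theorem exists_thresholds (hE : E.Admissible) (hz : z ∈ E.types) (hlz : lam z = z)
    (hlt : ∀ y ∈ E.types, z < y → lam y < y) (hzx : z < lam E.xhi) :
    ∃ y₁ y₂ y₃, z < y₁ ∧ y₁ < y₂ ∧ y₂ < y₃ ∧ y₃ < lam E.xhi ∧
      (∀ y ∈ Icc z E.xhi, (y < y₁ → y - lam y < E.lowRent lam y) ∧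
        (y₁ ≤ y → E.lowRent lam y ≤ y - lam y)) ∧
      (∀ y ∈ Icc z E.xhi, (y < y₂ → y - lam y < E.effRent lam y) ∧
        (y₂ < y → E.effRent lam y < y - lam y)) ∧
      (∀ y ∈ Icc z E.xhi,
        (y < y₃ → y - lam y - E.effRent lam y < E.minSlope lam y * (y + E.τ)) ∧
        (y₃ < y → E.minSlope lam y * (y + E.τ) < y - lam y - E.effRent lam y)) ∧
      y₁ - lam y₁ = E.lowRent lam y₁ ∧ y₂ - lam y₂ = E.effRent lam y₂ ∧
      y₃ - lam y₃ - E.effRent lam y₃ = E.minSlope lam y₃ * (y₃ + E.τ) := by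
  have hX := hS.lam_xhi_mem hE
  have hg := hS.gap_strictMonoOn hz hlz hlt
  have hsub : Icc z (lam E.xhi) ⊆ Icc z E.xhi := Icc_subset_Icc_right hX.2
  have hgc := hS.gap_continuousOn hz
  have hgx := hlt _ hX hzx
  have hτ : ∀ y ∈ Icc z E.xhi, 0 < y + E.τ := fun y hy => hE.add_τ_pos ⟨hz.1.trans hy.1, hy.2⟩
  have m1 : StrictMonoOn (fun y => y - lam y - E.lowRent lam y) (Icc z E.xhi) :=
    fun y hy y' hy' h => by
      have := hg hy hy' h
      have := hS.lowRent_antitone hE h.le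
      simp only at *
      linarith
  have m2 : StrictMonoOn (fun y => y - lam y - E.effRent lam y) (Icc z E.xhi) :=
    fun y hy y' hy' h => by
      have := hg hy hy' h
      have := hS.effRent_antitone hE h.le
      simp only at *
      linarith
  have m3 : StrictMonoOn (fun y => (y - lam y - E.effRent lam y) / (y + E.τ) - E.minSlope lam y)
      (Icc z E.xhi) := fun y hy y' hy' h =>
    hS.excess_lt hE hz hlz hlt ⟨hz.1.trans hy'.1, hy'.2⟩ hy.1 h
  have c1 := hgc.sub (hS.lowRent_continuousOn hE hz hlt)
  have c2 := hgc.sub (hS.effRent_continuousOn hE hz hlt)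
  have c3 : ContinuousOn (fun y => (y - lam y - E.effRent lam y) / (y + E.τ) - E.minSlope lam y)
      (Icc z E.xhi) :=
    (c2.div (by fun_prop) fun y hy => (hτ y hy).ne').sub (hS.minSlope_continuousOn hE hz hlt)
  obtain ⟨y₁, hy₁, e1⟩ : ∃ y ∈ Icc z (lam E.xhi), y - lam y - E.lowRent lam y = 0 := by
    refine intermediate_value_Icc hzx.le (c1.mono hsub) ⟨?_, ?_⟩
    · simp only [Pi.sub_apply]
      linarith [hS.lowRent_pos hE hzx]
    · simp only [Pi.sub_apply]
      linarith [hS.lowRent_eq_zero hE le_rfl]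
  obtain ⟨y₂, hy₂, e2⟩ : ∃ y ∈ Icc z (lam E.xhi), y - lam y - E.effRent lam y = 0 := by
    refine intermediate_value_Icc hzx.le (c2.mono hsub) ⟨?_, ?_⟩
    · simp only [Pi.sub_apply]
      linarith [hS.effRent_nonneg hE (y := z)]
    · simp only [Pi.sub_apply]
      linarith [hS.effRent_eq_zero hE le_rfl]
  have hzI : z ∈ Icc z E.xhi := ⟨le_rfl, hz.2⟩
  have hxI : lam E.xhi ∈ Icc z E.xhi := ⟨hzx.le, hX.2⟩
  have e3x : 0 < (lam E.xhi - lam (lam E.xhi) - E.effRent lam (lam E.xhi)) / (lam E.xhi + E.τ) -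
      E.minSlope lam (lam E.xhi) := by
    rw [hS.effRent_eq_zero hE le_rfl, hS.minSlope_eq_zero le_rfl hE, sub_zero, sub_zero]
    exact div_pos (by linarith) (hτ _ hxI)
  have hy₂x : y₂ < lam E.xhi := by
    refine lt_of_le_of_ne hy₂.2 fun h => ?_
    rw [h, hS.effRent_eq_zero hE le_rfl] at e2
    linarith
  have e32 : (y₂ - lam y₂ - E.effRent lam y₂) / (y₂ + E.τ) - E.minSlope lam y₂ < 0 := by
    rw [e2, zero_div]
    linarith [hS.minSlope_pos hE hy₂x]
  obtain ⟨y₃, hy₃, e3⟩ : ∃ y ∈ Icc z (lam E.xhi),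
      (y - lam y - E.effRent lam y) / (y + E.τ) - E.minSlope lam y = 0 := by
    refine intermediate_value_Icc hzx.le (c3.mono hsub) ⟨?_, e3x.le⟩
    rcases hy₂.1.eq_or_lt with h | h
    · rw [h]; exact e32.le
    · exact (m3 hzI (hsub hy₂) h).le.trans e32.le
  have hy₃x : y₃ < lam E.xhi := by
    refine lt_of_le_of_ne hy₃.2 fun h => ?_
    rw [h] at e3
    exact e3x.ne' e3
  have hy₁x : y₁ < lam E.xhi := by
    refine lt_of_le_of_ne hy₁.2 fun h => ?_
    rw [h, hS.lowRent_eq_zero hE le_rfl] at e1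
    linarith
  refine ⟨y₁, y₂, y₃, ?_, ?_, ?_, hy₃x, ?_, ?_, ?_, by linarith, by linarith, ?_⟩
  · refine lt_of_le_of_ne hy₁.1 fun h => ?_
    rw [← h, hlz] at e1
    linarith [hS.lowRent_pos hE hzx]
  · refine (m2.lt_iff_lt (hsub hy₁) (hsub hy₂)).1 ?_
    linarith [hS.lowRent_lt_effRent hE hy₁x]
  · refine (m3.lt_iff_lt (hsub hy₂) (hsub hy₃)).1 ?_
    linarith
  · intro y hy
    refine ⟨fun h => ?_, fun h => ?_⟩
    · have := m1 hy (hsub hy₁) h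
      simp only at this
      linarith
    · have := m1.monotoneOn (hsub hy₁) hy h
      linarith
  · intro y hy
    refine ⟨fun h => ?_, fun h => ?_⟩
    · have := m2 hy (hsub hy₂) h
      simp only at this
      linarith
    · have := m2 (hsub hy₂) hy h
      simp only at this
      linarith
  · intro y hy
    have h0 := hτ y hy
    refine ⟨fun h => ?_, fun h => ?_⟩
    · have := m3 hy (hsub hy₃) h
      simp only at this
      rw [← div_lt_iff₀ h0]
      linarith
    · have := m3 (hsub hy₃) hy h
      simp only at this
      rw [← lt_div_iff₀ h0]
      linarith
  · rw [← div_eq_iff (hτ y₃ (hsub hy₃)).ne']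
    linarith

theorem eq_low (hE : E.Admissible) (hy : y ∈ E.types) (h : y - lam y ≤ E.lowRent lam y) :
    e y = E.lowEffort (E.cP (E.minSlope lam y)) ∧ p y = E.minSlope lam y := by
  have hs := hS.cP_minSlope_mem hE (y := y)
  refine hS.eq_of_isMin hE hy (hE.lowEffort_mem hs)
    (fun x hx hne => hE.lowEffort_isMin hs h hx hne) ?_
  have h1 := hS.supportValue_minSlope_le hE (y := y)
  have h2 := mul_nonneg (hS.minSlope_mem (y := y)).1 (hE.add_τ_pos hy).le
  unfold lowRent at h
  linarith

/-- The intermediate value theorem finds the effort at the kink. Its rent already covers the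
required utility, so the rent constraint holds. -/
theorem eq_between (hE : E.Admissible) (hy : y ∈ E.types) (h : E.lowRent lam y ≤ y - lam y)
    (h' : y - lam y ≤ E.effRent lam y) :
    E.uA (e y) = y - lam y ∧ p y = E.minSlope lam y := by
  have hs := hS.cP_minSlope_mem hE (y := y)
  have hlow := hE.lowEffort_mem hs
  have heff := hE.effEffort_mem hs
  have hle : E.lowEffort (E.cP (E.minSlope lam y)) ≤ E.effEffort (E.cP (E.minSlope lam y)) :=
    (hE.uA_strictMonoOn.le_iff_le hlow heff).1 (h.trans h')
  obtain ⟨x, hx, hux⟩ := intermediate_value_Icc hle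
    (hE.uA_continuousOn.mono (Icc_subset_Icc hlow.1 heff.2)) ⟨h, h'⟩
  have hxI : x ∈ Icc (0 : ℝ) 1 := ⟨hlow.1.trans hx.1, hx.2.trans heff.2⟩
  have h1 := hS.supportValue_minSlope_le hE (y := y)
  have h2 := mul_nonneg (hS.minSlope_mem (y := y)).1 (hE.add_τ_pos hy).le
  obtain ⟨h3, h4⟩ := hS.eq_of_isMin hE hy hxI
    (fun w hw hne => hE.between_isMin hs hx hux hw hne) (by linarith)
  exact ⟨by rw [h3, hux], h4⟩

theorem eq_eff (hE : E.Admissible) (hy : y ∈ E.types) (h : E.effRent lam y ≤ y - lam y)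
    (h' : y - lam y - E.effRent lam y ≤ E.minSlope lam y * (y + E.τ)) :
    e y = E.effEffort (E.cP (E.minSlope lam y)) ∧ p y = E.minSlope lam y := by
  have hs := hS.cP_minSlope_mem hE (y := y)
  refine hS.eq_of_isMin hE hy (hE.effEffort_mem hs)
    (fun x hx hne => hE.effEffort_isMin hs h hx hne) ?_
  have h1 := hS.supportValue_minSlope_le hE (y := y)
  unfold effRent at h'
  linarith

end ReducedSolution

end AuditEnv

/-! ### First-order conditions, and types at which the rent constraint binds -/

section

open Filter Topology

theorem HasDerivWithinAt.nonneg_of_forall_right {f : ℝ → ℝ} {d a : ℝ}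
    (hf : HasDerivWithinAt f d (Ici a) a) (h : ∀ᶠ x in nhdsWithin a (Ioi a), f a ≤ f x) :
    0 ≤ d := by
  have h1 := (hasDerivWithinAt_iff_tendsto_slope' (notMem_Ioi.2 le_rfl)).1 hf.Ioi_of_Ici
  refine ge_of_tendsto h1 ?_
  filter_upwards [h, self_mem_nhdsWithin] with x hx hxa
  rw [slope_def_field]
  exact div_nonneg (by linarith) (sub_nonneg.2 (le_of_lt hxa))

theorem HasDerivWithinAt.nonpos_of_forall_left {f : ℝ → ℝ} {d a : ℝ}
    (hf : HasDerivWithinAt f d (Iic a) a) (h : ∀ᶠ x in nhdsWithin a (Iio a), f a ≤ f x) :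
    d ≤ 0 := by
  have h1 := (hasDerivWithinAt_iff_tendsto_slope' (notMem_Iio.2 le_rfl)).1 hf.Iio_of_Iic
  refine le_of_tendsto h1 ?_
  filter_upwards [h, self_mem_nhdsWithin] with x hx hxa
  rw [slope_def_field]
  exact div_nonpos_of_nonneg_of_nonpos (by linarith) (sub_nonpos.2 (le_of_lt hxa))

namespace AuditEnv

variable {E : AuditEnv} {lam e p : ℝ → ℝ} {y y' q κ : ℝ}

/-- The audit cost along the path on which the agent's effort `x` replaces the principal's effort at
the rate `κ`, starting from `(a, r)`. -/
def tradeCost (E : AuditEnv) (κ a r x : ℝ) : ℝ :=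
  E.cA x + (1 - x) * E.cP (r - (E.uA x - E.uA a) / κ)

theorem tradeCost_self (E : AuditEnv) (κ a r : ℝ) :
    E.tradeCost κ a r a = E.cA a + (1 - a) * E.cP r := by
  simp [tradeCost]

theorem Admissible.tradeCost_hasDerivWithinAt (hE : E.Admissible) {a r : ℝ} {s t : Set ℝ}
    (hκ : 0 < κ) (ha : a ∈ Ioo (0 : ℝ) 1)
    (hP : HasDerivWithinAt E.cP (effortDeriv E.cP r) t r)
    (hst : MapsTo (fun x => r - (E.uA x - E.uA a) / κ) s t) :
    HasDerivWithinAt (E.tradeCost κ a r) (-(E.auditGain κ a r / κ)) s a := by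
  have h1 : HasDerivWithinAt (fun x => r - (E.uA x - E.uA a) / κ)
      (-(a * effortDeriv (effortDeriv E.cA) a / κ)) s a :=
    (((hE.uA_hasDerivAt ha).sub_const _).div_const κ |>.const_sub r).hasDerivWithinAt
  have hP' : HasDerivWithinAt E.cP (effortDeriv E.cP r) t (r - (E.uA a - E.uA a) / κ) := by
    simpa using hP
  have h2 := HasDerivWithinAt.comp a hP' h1 hst
  have h3 : HasDerivWithinAt (E.tradeCost κ a r) _ s a :=
    (hE.cost_A.hasDerivAt ha).hasDerivWithinAt.add
      (((hasDerivWithinAt_const a s (1 : ℝ)).sub (hasDerivWithinAt_id a s)).mul h2)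
  refine h3.congr_deriv ?_
  simp only [Pi.sub_apply, id, sub_self, zero_div, sub_zero]
  unfold auditGain
  field_simp
  ring

theorem Admissible.uA_continuousAt (hE : E.Admissible) {a : ℝ} (ha : a ∈ Ioo (0 : ℝ) 1) :
    ContinuousAt E.uA a := (hE.uA_hasDerivAt ha).continuousAt

namespace ReducedSolution

variable (hS : E.ReducedSolution lam e p)
include hS

theorem optimal_of_le_gap (hy : y ∈ E.types) (hg : E.uA (e y) ≤ y - lam y) {x r : ℝ}
    (hx : E.uA x ≤ y - lam y) (h : E.ReducedFeasible lam y x r) :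
    E.cA (e y) + (1 - e y) * E.cP (p y) ≤ E.cA x + (1 - x) * E.cP r := by
  have := hS.optimal y hy x r h
  unfold reducedCost at this
  rw [max_eq_left hg, max_eq_left hx] at this
  linarith

/-- Replacing principal effort by agent effort does not pay. -/
theorem auditGain_nonpos (hE : E.Admissible) (hy : y ∈ E.types) (hκ : 0 < κ)
    (he : e y ∈ Ioo (0 : ℝ) 1) (hp1 : p y < 1) (hg : E.uA (e y) < y - lam y) (hq : q < p y)
    (hp0 : E.minSlope lam y < p y)
    (hΦ : ∀ r ∈ Icc q (p y), 0 ≤ r → E.supportValue lam r ≤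
      E.supportValue lam (p y) + κ * (p y - r)) :
    E.auditGain κ (e y) (p y) ≤ 0 := by
  have hpos : 0 < p y := hS.minSlope_mem.1.trans_lt hp0
  have hP := (hE.cost_P.hasDerivAt ⟨hpos, hp1⟩).hasDerivWithinAt (s := univ)
  have hd := hE.tradeCost_hasDerivWithinAt (s := Ici (e y)) hκ he hP (mapsTo_univ _ _)
  have hc : ContinuousAt (fun x => p y - (E.uA x - E.uA (e y)) / κ) (e y) :=
    continuousAt_const.sub (((hE.uA_continuousAt he).sub continuousAt_const).div_const κ)
  have hself : p y - (E.uA (e y) - E.uA (e y)) / κ = p y := by simp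
  have ev1 : ∀ᶠ x in 𝓝[>] (e y), max q (E.minSlope lam y) <
      p y - (E.uA x - E.uA (e y)) / κ :=
    (hc.eventually (lt_mem_nhds (by simp only [hself]; exact max_lt hq hp0))).filter_mono
      nhdsWithin_le_nhds
  have ev2 : ∀ᶠ x in 𝓝[>] (e y), E.uA x < y - lam y :=
    ((hE.uA_continuousAt he).eventually (gt_mem_nhds hg)).filter_mono nhdsWithin_le_nhds
  have ev3 : ∀ᶠ x in 𝓝[>] (e y), x < 1 :=
    (gt_mem_nhds he.2).filter_mono nhdsWithin_le_nhds
  have h0 := hd.nonneg_of_forall_right (by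
    filter_upwards [ev1, ev2, ev3, self_mem_nhdsWithin] with x h1 h2 h3 h4
    rw [tradeCost_self]
    have hxI : x ∈ Icc (0 : ℝ) 1 := ⟨he.1.le.trans (le_of_lt h4), h3.le⟩
    have hu := hE.uA_strictMonoOn (hS.eA_mem hy) hxI h4
    set r := p y - (E.uA x - E.uA (e y)) / κ with hr
    have hdiv : 0 < (E.uA x - E.uA (e y)) / κ := div_pos (by linarith) hκ
    have hrp : r ≤ p y := by linarith
    have hr0 := (max_lt_iff.1 h1).2
    have h5 := hΦ r ⟨(max_lt_iff.1 h1).1.le, hrp⟩ (hS.minSlope_mem.1.trans hr0.le)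
    -- Along the path the rent grows exactly by the permitted growth of `supportValue`, so the rent
    -- constraint is preserved.
    have h6 : κ * (p y - r) = E.uA x - E.uA (e y) := by rw [hr]; field_simp; ring
    have h7 := hS.supportValue_le_rent hE hy
    exact hS.optimal_of_le_gap hy hg.le h2.le
      (hS.reducedFeasible_of hE hxI hr0.le (hrp.trans hp1.le) (by linarith)))
  have h1 : E.auditGain κ (e y) (p y) / κ ≤ 0 := by linarith
  by_contra! hlt
  exact absurd (div_pos hlt hκ) (not_lt.2 h1)

/-- Replacing agent effort by principal effort does not pay. -/
theorem auditGain_nonneg (hE : E.Admissible) (hy : y ∈ E.types) (hκ : 0 < κ)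
    (he : e y ∈ Ioo (0 : ℝ) 1) (hg : E.uA (e y) ≤ y - lam y) (hq : p y < q) (hq1 : q ≤ 1)
    (hΦ : ∀ r ∈ Icc (p y) q, E.supportValue lam r ≤
      E.supportValue lam (p y) - κ * (r - p y)) :
    0 ≤ E.auditGain κ (e y) (p y) := by
  have hp := hS.eP_mem hy
  -- Here `p y` may be 0, where only a right derivative is available; the path moves the principal's
  -- effort upward.
  have hP : HasDerivWithinAt E.cP (effortDeriv E.cP (p y)) (Icc (p y) 1) (p y) :=
    (hE.cost_P.hasDerivWithinAt hp).mono (Icc_subset_Icc_left hp.1)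
  have hP' : HasDerivWithinAt E.cP (effortDeriv E.cP (p y)) (Ici (p y)) (p y) :=
    hP.mono_of_mem_nhdsWithin (Icc_mem_nhdsGE (hq.trans_le hq1))
  have hmaps : MapsTo (fun x => p y - (E.uA x - E.uA (e y)) / κ) (Icc 0 (e y)) (Ici (p y)) := by
    intro x hx
    have hu := hE.uA_strictMonoOn.monotoneOn ⟨hx.1, hx.2.trans he.2.le⟩ (hS.eA_mem hy) hx.2
    have : (E.uA x - E.uA (e y)) / κ ≤ 0 :=
      div_nonpos_of_nonpos_of_nonneg (by linarith) hκ.le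
    show p y ≤ p y - (E.uA x - E.uA (e y)) / κ
    linarith
  have hd := (hE.tradeCost_hasDerivWithinAt hκ he hP' hmaps).mono_of_mem_nhdsWithin
    (Icc_mem_nhdsLE he.1)
  have hc : ContinuousAt (fun x => p y - (E.uA x - E.uA (e y)) / κ) (e y) :=
    continuousAt_const.sub (((hE.uA_continuousAt he).sub continuousAt_const).div_const κ)
  have hself : p y - (E.uA (e y) - E.uA (e y)) / κ = p y := by simp
  have ev1 : ∀ᶠ x in 𝓝[<] (e y), p y - (E.uA x - E.uA (e y)) / κ < q :=
    (hc.eventually (gt_mem_nhds (by simp only [hself]; exact hq))).filter_mono nhdsWithin_le_nhds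
  have ev3 : ∀ᶠ x in 𝓝[<] (e y), 0 < x :=
    (lt_mem_nhds he.1).filter_mono nhdsWithin_le_nhds
  have h0 := hd.nonpos_of_forall_left (by
    filter_upwards [ev1, ev3, self_mem_nhdsWithin] with x h1 h3 h4
    rw [tradeCost_self]
    have h4' : x < e y := h4
    have hxI : x ∈ Icc (0 : ℝ) 1 := ⟨h3.le, h4'.le.trans he.2.le⟩
    have hu := hE.uA_strictMonoOn hxI (hS.eA_mem hy) h4
    have hrp := hmaps ⟨h3.le, h4'.le⟩
    set r := p y - (E.uA x - E.uA (e y)) / κ with hr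
    have hrp' : p y ≤ r := hrp
    have h5 := hΦ r ⟨hrp, h1.le⟩
    have h6 : κ * (r - p y) = E.uA (e y) - E.uA x := by rw [hr]; field_simp; ring
    have h7 := hS.supportValue_le_rent hE hy
    exact hS.optimal_of_le_gap hy hg (hu.le.trans hg)
      (hS.reducedFeasible_of hE hxI ((hS.minSlope_le_eP hy).trans hrp') (h1.le.trans hq1)
        (by linarith)))
  have h1 : 0 ≤ E.auditGain κ (e y) (p y) / κ := by linarith
  by_contra! hlt
  exact absurd (div_neg_of_neg_of_pos hlt hκ) (not_lt.2 h1)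

end ReducedSolution

/-- Types at which the efficient effort, together with the smallest slope, leaves the agent less
than the required utility, although the loss function still increases. -/
structure HighType (E : AuditEnv) (lam : ℝ → ℝ) (y : ℝ) : Prop where
  mem : y ∈ E.types
  lam_lt : lam y < lam E.xhi
  excess : E.minSlope lam y * (y + E.τ) < y - lam y - E.effRent lam y

namespace ReducedSolution

variable (hS : E.ReducedSolution lam e p) (hE : E.Admissible)
include hS hE

/-- A positive smallest slope belongs to a line that touches `lam`, and the excess inequality is
then the claim. If the slope is 0, the supporting line has height λ(xhi) > λ(y). -/
theorem effRent_lt_supportValue (hy : E.HighType lam y) :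
    lam y + E.effRent lam y < E.supportValue lam (E.minSlope lam y) := by
  rcases lt_or_ge y (lam E.xhi) with h | h
  · rw [hS.supportValue_minSlope hE hy.mem (hS.minSlope_pos hE h)]
    linarith [hy.excess]
  · rw [hS.minSlope_eq_zero h hE, hS.supportValue_zero hE, hS.effRent_eq_zero hE h]
    linarith [hy.lam_lt]

theorem effRent_lt_uA_of_eq (hy : E.HighType lam y) (hp : p y = E.minSlope lam y) :
    E.effRent lam y < E.uA (e y) := by
  have h1 := hS.supportValue_le_rent hE hy.mem
  have h2 := hS.effRent_lt_supportValue hE hy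
  rw [hp] at h1
  linarith

/-- With slack in the rent constraint one effort could be lowered at a profit: the agent's if the
principal's is minimal, because it then exceeds the efficient level, and otherwise the principal's.
-/
theorem supportValue_eq (hy : E.HighType lam y) :
    E.supportValue lam (p y) = lam y + E.uA (e y) := by
  refine le_antisymm (hS.supportValue_le_rent hE hy.mem) ?_
  by_contra! hlt
  have he1 := hS.eA_lt_one y hy.mem
  have hp0 := hS.minSlope_le_eP hy.mem
  rcases hp0.eq_or_lt with hp | hp
  · have hlt2 := hS.effRent_lt_uA_of_eq hE hy hp.symm
    have hs := hS.cP_minSlope_mem hE (y := y)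
    have heff := hE.effEffort_mem hs
    have hlt3 : E.effEffort (E.cP (E.minSlope lam y)) < e y :=
      (hE.uA_strictMonoOn.lt_iff_lt heff (hS.eA_mem hy.mem)).1 hlt2
    have hc : ContinuousAt E.uA (e y) := hE.uA_continuousAt ⟨heff.1.trans_lt hlt3, he1⟩
    have ev1 : ∀ᶠ x in 𝓝[<] (e y), E.supportValue lam (p y) - lam y < E.uA x :=
      (hc.eventually (lt_mem_nhds (by linarith))).filter_mono nhdsWithin_le_nhds
    have ev2 : ∀ᶠ x in 𝓝[<] (e y), E.effEffort (E.cP (E.minSlope lam y)) < x :=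
      (lt_mem_nhds hlt3).filter_mono nhdsWithin_le_nhds
    obtain ⟨x, h1, h2, h3⟩ := (ev1.and (ev2.and self_mem_nhdsWithin)).exists
    have h3' : x < e y := h3
    have hxI : x ∈ Icc (0 : ℝ) 1 := ⟨heff.1.trans h2.le, h3'.le.trans he1.le⟩
    have h4 := hS.optimal y hy.mem x (p y)
      (hS.reducedFeasible_of hE hxI hp0 (hS.eP_mem hy.mem).2 (by linarith))
    have h5 := hE.uA_strictMonoOn hxI (hS.eA_mem hy.mem) h3'
    have h6 : max (y - lam y) (E.uA x) ≤ max (y - lam y) (E.uA (e y)) :=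
      max_le_max le_rfl h5.le
    have h7 := hE.cost_A.strictConvexOn.sub_mul_strictMonoOn hE.cost_A.differentiableOn heff
      (hE.deriv_effEffort hs) ⟨h2.le, hxI.2⟩ ⟨hlt3.le, he1.le⟩ h3'
    simp only at h7
    unfold reducedCost at h4
    rw [← hp] at h4
    linarith
  · have hτ := hE.add_τ_pos hE.xhi_mem
    set d := lam y + E.uA (e y) - E.supportValue lam (p y) with hd
    set r := max (E.minSlope lam y) (p y - d / (E.xhi + E.τ)) with hr
    have hd0 : 0 < d / (E.xhi + E.τ) := div_pos (by linarith) hτ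
    have hrp : r < p y := max_lt hp (by linarith)
    have hr0 : E.minSlope lam y ≤ r := le_max_left _ _
    have hr1 : p y - d / (E.xhi + E.τ) ≤ r := le_max_right _ _
    have h1 := hS.supportValue_sub_le hE (hS.minSlope_mem.1.trans hr0) hrp.le
    have h2 : (E.xhi + E.τ) * (p y - r) ≤ d := by
      have : p y - r ≤ d / (E.xhi + E.τ) := by linarith
      rw [le_div_iff₀ hτ] at this
      linarith
    have h3 := hS.optimal y hy.mem (e y) r (hS.reducedFeasible_of hE (hS.eA_mem hy.mem) hr0
      (hrp.le.trans (hS.eP_mem hy.mem).2) (by linarith))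
    have h4 := hE.cost_P.strictMonoOn
      ⟨hS.minSlope_mem.1.trans hr0, hrp.le.trans (hS.eP_mem hy.mem).2⟩ (hS.eP_mem hy.mem) hrp
    unfold reducedCost at h3
    nlinarith

theorem eP_lt_one (hy : E.HighType lam y) : p y < 1 := by
  refine lt_of_le_of_ne (hS.eP_mem hy.mem).2 fun h => ?_
  have h1 := hS.supportValue_eq hE hy
  have h2 : E.supportValue lam 1 ≤ -E.τ :=
    supportValue_le hE fun w hw => by linarith [hS.le_self w hw]
  rw [h] at h1
  linarith [hE.uA_nonneg (hS.eA_mem hy.mem), hS.xlo_le y hy.mem, hE.xlo_nonneg, hE.τ_pos]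

theorem uA_le_sub (hy : E.HighType lam y) :
    E.uA (e y) ≤ y - lam y - p y * (y + E.τ) := by
  linarith [hS.supportValue_eq hE hy, hS.supportValue_le_line hE hy.mem]

theorem uA_le_gap (hy : E.HighType lam y) : E.uA (e y) ≤ y - lam y := by
  have := mul_nonneg (hS.eP_mem hy.mem).1 (hE.add_τ_pos hy.mem).le
  linarith [hS.uA_le_sub hE hy]

/-- At p = 0 the agent's effort is positive. Replacing a little of it by audits saves `c_A'(e) > 0`
at the margin, whereas `c_P(0) = c_P'(0) = 0`. -/
theorem eP_pos (hy : E.HighType lam y) : 0 < p y := by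
  refine lt_of_le_of_ne (hS.eP_mem hy.mem).1 fun h => ?_
  have hp0 : p y = E.minSlope lam y :=
    le_antisymm (h ▸ hS.minSlope_mem.1) (hS.minSlope_le_eP hy.mem)
  have h1 := hS.effRent_lt_uA_of_eq hE hy hp0
  have he0 : 0 < e y := by
    refine lt_of_le_of_ne (hS.eA_mem hy.mem).1 fun h2 => ?_
    rw [← h2, hE.uA_zero] at h1
    linarith [hS.effRent_nonneg hE (y := y)]
  have hκ := hE.add_τ_pos hE.xlo_mem
  have h2 := hS.auditGain_nonneg hE hy.mem hκ ⟨he0, hS.eA_lt_one y hy.mem⟩ (hS.uA_le_gap hE hy)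
    (by rw [← h]; exact one_pos) le_rfl (fun r hr => by
      linarith [hS.le_supportValue_sub hE (hS.eP_mem hy.mem).1 hr.1])
  unfold auditGain at h2
  rw [← h, hE.cost_P.deriv_zero, hE.cost_P.map_zero] at h2
  have h3 := mul_pos hκ (hE.cost_A.deriv_pos (hS.eA_mem hy.mem) he0)
  linarith

theorem uA_lt_gap (hy : E.HighType lam y) : E.uA (e y) < y - lam y := by
  have := mul_pos (hS.eP_pos hE hy) (hE.add_τ_pos hy.mem)
  linarith [hS.uA_le_sub hE hy]

/-- Suppose the principal's effort is not minimal. At the efficient agent effort the term `c_A' -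
c_P` of `auditGain` vanishes, so raising e and cutting p pays; below it, raising e alone pays. -/
theorem effEffort_lt (hy : E.HighType lam y) : E.effEffort (E.cP (p y)) < e y := by
  have hs := hE.cP_mem (hS.eP_mem hy.mem)
  have heff := hE.effEffort_mem hs
  rcases (hS.minSlope_le_eP hy.mem).eq_or_lt with hp | hp
  · rw [← hp]
    rw [← hp] at heff
    exact (hE.uA_strictMonoOn.lt_iff_lt heff (hS.eA_mem hy.mem)).1
      (hS.effRent_lt_uA_of_eq hE hy hp.symm)
  by_contra! hle
  have hp1 := hS.eP_lt_one hE hy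
  have hg := hS.uA_lt_gap hE hy
  rcases hle.eq_or_lt with h | h
  · have he0 : 0 < e y := by
      rw [h]
      refine lt_of_le_of_ne heff.1 fun h' => ?_
      have h1 := hE.deriv_effEffort hs
      rw [← h', hE.cost_A.deriv_zero] at h1
      exact (hE.cost_P.pos (hS.eP_mem hy.mem) (hS.eP_pos hE hy)).ne h1
    have he1 := hS.eA_lt_one y hy.mem
    have hκ := hE.add_τ_pos hE.xhi_mem
    have h2 := hS.auditGain_nonpos hE hy.mem hκ ⟨he0, he1⟩ hp1 hg (hS.eP_pos hE hy) hp
      (fun r hr h0 => by linarith [hS.supportValue_sub_le hE h0 hr.2])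
    have h3 : effortDeriv E.cA (e y) = E.cP (p y) := by rw [h, hE.deriv_effEffort hs]
    unfold auditGain at h2
    rw [h3] at h2
    have h4 : 0 < (1 - e y) * (e y * effortDeriv (effortDeriv E.cA) (e y)) *
        effortDeriv E.cP (p y) :=
      mul_pos (mul_pos (by linarith) (mul_pos he0 (hE.curvature_pos _ ⟨he0, he1.le⟩)))
        (hE.cost_P.deriv_pos (hS.eP_mem hy.mem) (hS.eP_pos hE hy))
    linarith
  · have hc : ContinuousWithinAt E.uA (Icc 0 1) (e y) := hE.uA_continuousOn _ (hS.eA_mem hy.mem)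
    have hmono : 𝓝[>] (e y) ≤ 𝓝[Icc 0 1] (e y) :=
      nhdsWithin_le_of_mem (mem_of_superset (Ioo_mem_nhdsGT (hS.eA_lt_one y hy.mem))
        fun x hx => ⟨(hS.eA_mem hy.mem).1.trans hx.1.le, hx.2.le⟩)
    have ev1 : ∀ᶠ x in 𝓝[>] (e y), E.uA x < y - lam y :=
      hmono ((tendsto_order.1 hc).2 _ hg)
    have ev2 : ∀ᶠ x in 𝓝[>] (e y), x < E.effEffort (E.cP (p y)) :=
      (gt_mem_nhds h).filter_mono nhdsWithin_le_nhds
    obtain ⟨x, h1, h2, h3⟩ := (ev1.and (ev2.and self_mem_nhdsWithin)).exists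
    have h3' : e y < x := h3
    have hxI : x ∈ Icc (0 : ℝ) 1 := ⟨(hS.eA_mem hy.mem).1.trans h3'.le, h2.le.trans heff.2⟩
    have h4 := hE.uA_strictMonoOn (hS.eA_mem hy.mem) hxI h3'
    have h5 := hS.optimal_of_le_gap hy.mem hg.le h1.le (hS.reducedFeasible_of hE hxI hp.le hp1.le
      (by linarith [hS.supportValue_le_rent hE hy.mem]))
    have h6 := hE.cost_A.strictConvexOn.sub_mul_strictAntiOn hE.cost_A.differentiableOn heff
      (hE.deriv_effEffort hs) ⟨(hS.eA_mem hy.mem).1, h.le⟩ ⟨hxI.1, h2.le⟩ h3'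
    simp only at h6
    linarith

theorem eA_mem_Ioo (hy : E.HighType lam y) : e y ∈ Ioo (0 : ℝ) 1 :=
  ⟨(hE.effEffort_mem (hE.cP_mem (hS.eP_mem hy.mem))).1.trans_lt (hS.effEffort_lt hE hy),
    hS.eA_lt_one y hy.mem⟩

/-- If the principal's effort is higher at `y`, and not minimal there, so is the agent's. -/
theorem eA_lt_of_eP_lt (hy : E.HighType lam y) (hy' : E.HighType lam y')
    (hp : E.minSlope lam y < p y) (hlt : p y' < p y) : e y' < e y := by
  have hp0' := hS.eP_mem hy'.mem
  have hd : 0 < p y - p y' := by linarith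
  -- The slope of the chord of `supportValue` between the two principal efforts. By convexity both
  -- trades at this rate are feasible, downward from `p y` and upward from `p y'`.
  set κ := (E.supportValue lam (p y') - E.supportValue lam (p y)) / (p y - p y') with hκdef
  have hκ : E.xlo + E.τ ≤ κ := by
    rw [hκdef, le_div_iff₀ hd]
    exact hS.le_supportValue_sub hE hp0'.1 hlt.le
  have hκ0 : 0 < κ := (hE.add_τ_pos hE.xlo_mem).trans_le hκ
  have hκeq : κ * (p y - p y') = E.supportValue lam (p y') - E.supportValue lam (p y) := by
    rw [hκdef]; field_simp
  have h1 := hS.auditGain_nonpos hE hy.mem hκ0 (hS.eA_mem_Ioo hE hy) (hS.eP_lt_one hE hy)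
    (hS.uA_lt_gap hE hy) hlt hp (fun r hr _ => by
      have := hS.supportValue_le_chord hE hp0'.1 hlt hr
      rw [← hκdef] at this
      nlinarith)
  have h2 := hS.auditGain_nonneg hE hy'.mem hκ0 (hS.eA_mem_Ioo hE hy') (hS.uA_le_gap hE hy')
    hlt (hS.eP_mem hy.mem).2 (fun r hr => hS.supportValue_le_chord hE hp0'.1 hlt hr)
  have h3 := hE.auditGain_lt_of_lt hκ0 (hS.eA_mem hy'.mem) hp0' (hS.eP_mem hy.mem) hlt
  by_contra! hle
  have h4 := (hE.auditGain_strictAntiOn hκ (hS.eP_mem hy.mem)).antitoneOn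
    (hS.eA_mem_Ioo hE hy) (hS.eA_mem_Ioo hE hy') hle
  linarith

/-- If p were higher at y', so would be e, and hence λ + u_A(e). This sum equals `supportValue` at
p, which is decreasing. -/
theorem eP_antitone_of_highType (hy : E.HighType lam y) (hy' : E.HighType lam y') (h : y ≤ y') :
    p y' ≤ p y := by
  by_contra! hlt
  have h1 := hS.eA_lt_of_eP_lt hE hy' hy
    (((hS.minSlope_antitone h).trans (hS.minSlope_le_eP hy.mem)).trans_lt hlt) hlt
  have h2 := hE.uA_strictMonoOn (hS.eA_mem hy.mem) (hS.eA_mem hy'.mem) h1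
  have h3 := hS.supportValue_eq hE hy
  have h4 := hS.supportValue_eq hE hy'
  have h5 := hS.mono hy.mem hy'.mem h
  have h6 := hS.le_supportValue_sub hE (hS.eP_mem hy.mem).1 hlt.le
  have h7 := mul_pos (hE.add_τ_pos hE.xlo_mem) (sub_pos.2 hlt)
  linarith

theorem lam_lt_of_lt (hy' : y' ∈ E.types) (hy : y ∈ E.types) (hlt : y < y')
    (hlam : lam y' < lam E.xhi) : lam y < lam y' := by
  refine lt_of_le_of_ne (hS.mono hy hy' hlt.le) fun h => ?_
  have := hS.slope_le hy hE.xhi_mem hlt.le hy'.2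
  rw [h, sub_self, zero_mul] at this
  nlinarith

theorem eA_lt_of_lt (hy : E.HighType lam y) (hy' : E.HighType lam y')
    (hp : E.minSlope lam y < p y) (hlt : y < y') : e y' < e y := by
  rcases (hS.eP_antitone_of_highType hE hy hy' hlt.le).eq_or_lt with h | h
  · have h1 := hS.supportValue_eq hE hy
    have h2 := hS.supportValue_eq hE hy'
    have h3 := hS.lam_lt_of_lt hE hy'.mem hy.mem hlt hy'.lam_lt
    rw [h] at h2
    exact (hE.uA_strictMonoOn.lt_iff_lt (hS.eA_mem hy'.mem) (hS.eA_mem hy.mem)).1 (by linarith)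
  · exact hS.eA_lt_of_eP_lt hE hy hy' hp h

theorem uA_eq_of_eq (hy : E.HighType lam y) (hp : p y = E.minSlope lam y) :
    E.uA (e y) = y - lam y - E.minSlope lam y * (y + E.τ) := by
  have h0 := hS.eP_pos hE hy
  rw [hp] at h0
  have h1 := hS.supportValue_eq hE hy
  rw [hp, hS.supportValue_minSlope hE hy.mem h0] at h1
  linarith

theorem uA_lt_of_lt (hy : E.HighType lam y) (hp : E.minSlope lam y < p y)
    (h0 : 0 < E.minSlope lam y) :
    E.uA (e y) < y - lam y - E.minSlope lam y * (y + E.τ) := by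
  have h1 := hS.supportValue_eq hE hy
  have h2 := hS.supportValue_minSlope hE hy.mem h0
  have h3 := hS.le_supportValue_sub hE hS.minSlope_mem.1 hp.le
  have h4 := mul_pos (hE.add_τ_pos hE.xlo_mem) (sub_pos.2 hp)
  linarith

end ReducedSolution

end AuditEnv

/-! ### The six regimes -/

namespace AuditEnv

variable {E : AuditEnv} {lam e p : ℝ → ℝ} {y y' z y₃ y₅ : ℝ}

/-- The thresholds `y₀ < y₁ < ⋯ < y₅` between the six regimes of a reduced solution. -/
structure Regimes (E : AuditEnv) (lam e p : ℝ → ℝ) (y₀ y₁ y₂ y₃ y₄ y₅ : ℝ) : Prop where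
  mem₀ : y₀ ∈ E.types
  lam₀ : lam y₀ = y₀
  lam_lt : ∀ y ∈ E.types, y₀ < y → lam y < y
  lt₀₁ : y₀ < y₁
  lt₁₂ : y₁ < y₂
  lt₂₃ : y₂ < y₃
  lt₃₄ : y₃ < y₄
  lt₄₅ : y₄ < y₅
  mem₅ : y₅ ∈ E.types
  lam₅ : lam y₅ = lam E.xhi
  eP_one : ∀ y ∈ E.types, y < y₀ → p y = 1
  eP_minSlope : ∀ y ∈ Icc y₀ y₄, p y = E.minSlope lam y
  eA_low : ∀ y ∈ E.types, y ≤ y₁ → e y = E.lowEffort (E.cP (p y))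
  gap_lt : ∀ y ∈ E.types, y < y₁ → y - lam y < E.uA (e y)
  eA_mid : ∀ y ∈ Icc y₁ y₂, E.uA (e y) = y - lam y
  gap_lt_eff : ∀ y ∈ Ioo y₁ y₂, y - lam y < E.uA (E.effEffort (E.cP (p y)))
  eA_eff : ∀ y ∈ Icc y₂ y₃, e y = E.effEffort (E.cP (p y))
  lt_gap : ∀ y ∈ E.types, y₂ < y → E.uA (e y) < y - lam y
  gap_sub_lt : ∀ y ∈ Ico y₂ y₃, y - lam y - E.uA (e y) < p y * (y + E.τ)
  eA_high : ∀ y ∈ Icc y₃ y₄, E.uA (e y) = y - lam y - p y * (y + E.τ)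
  high : ∀ y ∈ Ioo y₃ y₅, E.HighType lam y
  minSlope_lt : ∀ y ∈ Ioo y₄ y₅, E.minSlope lam y < p y
  zero : ∀ y ∈ Icc y₅ E.xhi, e y = 0 ∧ p y = 0

namespace ReducedSolution

variable (hS : E.ReducedSolution lam e p) (hE : E.Admissible)
include hS hE

theorem exists_first_max : ∃ y₅ ∈ E.types, lam y₅ = lam E.xhi ∧
    ∀ y ∈ E.types, y < y₅ → lam y < lam E.xhi := by
  have hclosed : IsClosed {y | y ∈ E.types ∧ lam y = lam E.xhi} := by
    have : {y | y ∈ E.types ∧ lam y = lam E.xhi} = E.types ∩ lam ⁻¹' {lam E.xhi} := rfl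
    rw [this]
    exact hS.continuousOn.preimage_isClosed_of_isClosed isClosed_Icc isClosed_singleton
  have hbdd : BddBelow {y | y ∈ E.types ∧ lam y = lam E.xhi} := ⟨E.xlo, fun _ h => h.1.1⟩
  have hmem := hclosed.csInf_mem ⟨E.xhi, hE.xhi_mem, rfl⟩ hbdd
  refine ⟨_, hmem.1, hmem.2, fun y hy hlt => ?_⟩
  refine lt_of_le_of_ne (hS.mono hy hE.xhi_mem hy.2) fun h => ?_
  exact absurd (csInf_le hbdd ⟨hy, h⟩) (not_le.2 hlt)

section

variable (hz : z ∈ E.types) (hlz : lam z = z) (hlt : ∀ y ∈ E.types, z < y → lam y < y)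
include hz hlz hlt

/-- The expression is y + τ times the difference of gap/(y + τ) and the smallest slope; the first
factor increases, and the second is nonnegative and increases. -/
theorem gap_sub_lt_gap_sub (hy' : y' ∈ E.types) (hzy : z ≤ y) (h : y < y')
    (h0 : 0 ≤ y - lam y - E.minSlope lam y * (y + E.τ)) :
    y - lam y - E.minSlope lam y * (y + E.τ) < y' - lam y' - E.minSlope lam y' * (y' + E.τ) := by
  have h1 := hS.gap_mul_lt hz hlz hlt hE hy' hzy h
  have h2 := hS.minSlope_antitone h.le
  have h3 : 0 < y + E.τ := by linarith [hE.add_τ_pos hz]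
  have h4 : 0 < y' + E.τ := by linarith
  have h5 := mul_le_mul_of_nonneg_right h2 (mul_pos h3 h4).le
  have h6 := mul_le_mul_of_nonneg_left h.le h0
  by_contra! hle
  have h7 := mul_le_mul_of_nonneg_right hle h3.le
  nlinarith

/-- If p exceeded the smallest slope at y, then e would be higher at y than at y'. But u_A(e(y))
would be below the High formula at y, which increases up to its value u_A(e(y')). -/
theorem eP_eq_of_le (hzy : z ≤ y) (hy : E.HighType lam y) (hy' : E.HighType lam y') (h : y < y')
    (hp' : p y' = E.minSlope lam y') : p y = E.minSlope lam y := by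
  by_contra hne
  have hp : E.minSlope lam y < p y := lt_of_le_of_ne (hS.minSlope_le_eP hy.mem) (Ne.symm hne)
  have h1 := hS.eP_pos hE hy'
  have h2 := hS.minSlope_antitone h.le
  rw [hp'] at h1
  have h3 := hS.eA_lt_of_eP_lt hE hy hy' hp (by rw [hp']; exact h2.trans_lt hp)
  have h4 := hE.uA_strictMonoOn (hS.eA_mem hy'.mem) (hS.eA_mem hy.mem) h3
  have h5 := hS.uA_lt_of_lt hE hy hp (h1.trans_le h2)
  have h6 := hS.uA_eq_of_eq hE hy' hp'
  have h7 := hS.gap_sub_lt_gap_sub hE hz hlz hlt hy'.mem hzy h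
    (by linarith [hy.excess, hS.effRent_nonneg hE (y := y)])
  linarith

omit hlz in
-- At y₃ the agent's effort is efficient, so trading audits for agent effort strictly pays even at
-- the worst rate xhi + τ. By continuity it still pays slightly to the right, which rules out p
-- above the smallest slope there.
theorem exists_eP_eq (hzy : z < y₃) (hy₃ : y₃ < lam E.xhi) (h35 : y₃ < y₅) (hy₅ : y₅ ≤ E.xhi)
    (h₃ : y₃ - lam y₃ - E.effRent lam y₃ = E.minSlope lam y₃ * (y₃ + E.τ))
    (hhigh : ∀ y ∈ Ioo y₃ y₅, E.HighType lam y) :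
    ∃ y ∈ Ioo y₃ y₅, p y = E.minSlope lam y := by
  by_contra! hne
  have hy₃X : y₃ ∈ E.types := ⟨hz.1.trans hzy.le, (h35.trans_le hy₅).le⟩
  have hP0 : 0 < E.minSlope lam y₃ := hS.minSlope_pos hE hy₃
  have hP1 : E.minSlope lam y₃ < 1 :=
    hS.minSlope_lt_one hy₃X (h35.trans_le hy₅) (hlt _ hy₃X hzy)
  have hs := hS.cP_minSlope_mem hE (y := y₃)
  set P := E.minSlope lam y₃ with hPdef
  set x := E.effEffort (E.cP P) with hx
  have hxI : x ∈ Ioo (0 : ℝ) 1 :=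
    ⟨(hE.lowEffort_pos hs (hE.cost_P.pos ⟨hP0.le, hP1.le⟩ hP0)).trans
      (hE.lowEffort_lt_effEffort hs (hE.cost_P.pos ⟨hP0.le, hP1.le⟩ hP0)),
      hE.effEffort_lt_one hs⟩
  set κ := E.xhi + E.τ with hκ
  have hκ0 : 0 < κ := hE.add_τ_pos hE.xhi_mem
  have hκle : E.xlo + E.τ ≤ κ := by linarith [hE.xlo_lt_xhi]
  have hG : 0 < E.auditGain κ x P := by
    unfold auditGain
    rw [hx, hE.deriv_effEffort hs, sub_self, mul_zero, sub_zero, ← hx]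
    exact mul_pos (mul_pos (by linarith [hxI.2]) (mul_pos hxI.1
      (hE.curvature_pos _ ⟨hxI.1, hxI.2.le⟩))) (hE.cost_P.deriv_pos ⟨hP0.le, hP1.le⟩ hP0)
  -- `x₁` and `P₁` bound the efforts just to the right of `y₃`, from above and below; as `auditGain`
  -- decreases in e and increases in p, its sign at this corner controls all of them.
  obtain ⟨x₁, hG1, hx1, hxx₁⟩ : ∃ x₁, 0 < E.auditGain κ x₁ P ∧ x₁ < 1 ∧ x < x₁ := by
    have ev1 : ∀ᶠ t in 𝓝[>] x, 0 < E.auditGain κ t P :=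
      ((hE.auditGain_hasDerivAt κ P hxI).continuousAt.eventually
        (lt_mem_nhds hG)).filter_mono nhdsWithin_le_nhds
    have ev2 : ∀ᶠ t in 𝓝[>] x, t < 1 := (gt_mem_nhds hxI.2).filter_mono nhdsWithin_le_nhds
    exact (ev1.and (ev2.and self_mem_nhdsWithin)).exists
  have hx₁I : x₁ ∈ Ioo (0 : ℝ) 1 := ⟨hxI.1.trans hxx₁, hx1⟩
  obtain ⟨P₁, hG2, hP₁0, hP₁⟩ : ∃ P₁, 0 < E.auditGain κ x₁ P₁ ∧ 0 < P₁ ∧ P₁ < P := by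
    have hc : ContinuousAt (fun t => E.auditGain κ x₁ t) P :=
      (continuousAt_const.mul (hE.cost_P.hasDerivAt_deriv ⟨hP0, hP1⟩).continuousAt).sub
        (continuousAt_const.mul
          (continuousAt_const.sub (hE.cost_P.hasDerivAt ⟨hP0, hP1⟩).continuousAt))
    have ev1 : ∀ᶠ t in 𝓝[<] P, 0 < E.auditGain κ x₁ t :=
      (hc.eventually (lt_mem_nhds hG1)).filter_mono nhdsWithin_le_nhds
    have ev2 : ∀ᶠ t in 𝓝[<] P, 0 < t := (lt_mem_nhds hP0).filter_mono nhdsWithin_le_nhds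
    exact (ev1.and (ev2.and self_mem_nhdsWithin)).exists
  have hux := hE.uA_strictMonoOn ⟨hxI.1.le, hxI.2.le⟩ ⟨hx₁I.1.le, hx₁I.2.le⟩ hxx₁
  have hcont : ContinuousWithinAt (fun y => y - lam y - E.minSlope lam y * (y + E.τ))
      (Icc z E.xhi) y₃ :=
    ((hS.gap_continuousOn hz).sub ((hS.minSlope_continuousOn hE hz hlt).mul
      (by fun_prop))) y₃ ⟨hzy.le, hy₃X.2⟩
  have hh₃ : y₃ - lam y₃ - E.minSlope lam y₃ * (y₃ + E.τ) < E.uA x₁ := by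
    have : E.effRent lam y₃ = E.uA x := rfl
    linarith
  have hmono : 𝓝[>] y₃ ≤ 𝓝[Icc z E.xhi] y₃ :=
    nhdsWithin_le_of_mem (mem_of_superset (Ioo_mem_nhdsGT (h35.trans_le hy₅))
      fun x hx => ⟨hzy.le.trans hx.1.le, hx.2.le⟩)
  have ev1 : ∀ᶠ y in 𝓝[>] y₃, y - lam y - E.minSlope lam y * (y + E.τ) < E.uA x₁ :=
    hmono ((tendsto_order.1 hcont).2 _ hh₃)
  have ev2 : ∀ᶠ y in 𝓝[>] y₃, P₁ < E.minSlope lam y :=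
    (hS.minSlope_lowerSemicontinuous hP₁).filter_mono nhdsWithin_le_nhds
  obtain ⟨y, h1, h2, h3⟩ := (ev1.and (ev2.and (Ioo_mem_nhdsGT h35))).exists
  have hy := hhigh y h3
  have hp : E.minSlope lam y < p y :=
    lt_of_le_of_ne (hS.minSlope_le_eP hy.mem) (Ne.symm (hne y h3))
  have h4 := hS.uA_lt_of_lt hE hy hp (hP₁0.trans h2)
  have h5 : e y < x₁ := (hE.uA_strictMonoOn.lt_iff_lt (hS.eA_mem hy.mem)
    ⟨hx₁I.1.le, hx₁I.2.le⟩).1 (h4.trans h1)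
  have h6 := hS.auditGain_nonpos hE hy.mem hκ0 (hS.eA_mem_Ioo hE hy) (hS.eP_lt_one hE hy)
    (hS.uA_lt_gap hE hy) (hS.eP_pos hE hy) hp
    (fun r hr h0 => by linarith [hS.supportValue_sub_le hE h0 hr.2])
  have h7 := hE.auditGain_strictAntiOn hκle (hS.eP_mem hy.mem) (hS.eA_mem_Ioo hE hy) hx₁I h5
  have h8 := hE.auditGain_lt_of_lt hκ0 ⟨hx₁I.1.le, hx₁I.2.le⟩
    ⟨hP₁0.le, (hP₁.trans hP1).le⟩ (hS.eP_mem hy.mem) (h2.trans hp)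
  simp only at h7
  linarith

theorem exists_last_eP_eq (hzy : z < y₃) (hy₃ : y₃ < lam E.xhi) (h5 : lam E.xhi < y₅)
    (hy₅ : y₅ ≤ E.xhi)
    (h₃ : y₃ - lam y₃ - E.effRent lam y₃ = E.minSlope lam y₃ * (y₃ + E.τ))
    (hhigh : ∀ y ∈ Ioo y₃ y₅, E.HighType lam y) :
    ∃ y₄ ∈ Ioo y₃ y₅, (∀ y ∈ Ioc y₃ y₄, p y = E.minSlope lam y) ∧
      ∀ y ∈ Ioo y₄ y₅, E.minSlope lam y < p y := by
  set S := {y | y ∈ Ioo y₃ y₅ ∧ p y = E.minSlope lam y} with hSdef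
  obtain ⟨s, hs⟩ : S.Nonempty := by
    obtain ⟨y, hy, hpy⟩ :=
      hS.exists_eP_eq hE hz hlt hzy hy₃ (hy₃.trans h5) hy₅ h₃ hhigh
    exact ⟨y, hy, hpy⟩
  -- Beyond λ(xhi) the smallest slope is 0 but audits are not.
  have hle : ∀ y ∈ S, y ≤ lam E.xhi := by
    intro y hy
    by_contra! hlt'
    have h1 := hS.eP_pos hE (hhigh y hy.1)
    rw [hy.2, hS.minSlope_eq_zero hlt'.le hE] at h1
    exact lt_irrefl _ h1
  have hbdd : BddAbove S := ⟨_, hle⟩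
  have h34 : y₃ < sSup S := hs.1.1.trans_le (le_csSup hbdd hs)
  have h45 : sSup S < y₅ := (csSup_le ⟨s, hs⟩ hle).trans_lt h5
  have hH4 := hhigh _ ⟨h34, h45⟩
  -- The supremum is attained: on `S` the monotone p is the smallest slope, which is upper
  -- semicontinuous.
  have hmem : p (sSup S) = E.minSlope lam (sSup S) := by
    refine le_antisymm ?_ (hS.minSlope_le_eP hH4.mem)
    by_contra! hgt
    have hev := hS.minSlope_upperSemicontinuous hE hH4.mem
      (hlt _ hH4.mem (hzy.trans h34)) hgt
    obtain ⟨l, hl, hI⟩ := (mem_nhdsLE_iff_exists_Ioc_subset.1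
      (hev.filter_mono nhdsWithin_le_nhds : {t | E.minSlope lam t < p (sSup S)} ∈
        𝓝[≤] (sSup S)))
    obtain ⟨t, ht, hlt'⟩ := exists_lt_of_lt_csSup ⟨s, hs⟩ hl
    have h1 := hI ⟨hlt', le_csSup hbdd ht⟩
    have h2 := hS.eP_antitone_of_highType hE (hhigh t ht.1) hH4 (le_csSup hbdd ht)
    rw [ht.2] at h2
    exact absurd h1 (not_lt.2 h2)
  refine ⟨sSup S, ⟨h34, h45⟩, fun y hy => ?_, fun y hy => ?_⟩
  · rcases hy.2.eq_or_lt with rfl | h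
    · exact hmem
    · exact hS.eP_eq_of_le hE hz hlz hlt (hzy.trans hy.1).le (hhigh y ⟨hy.1, h.trans h45⟩) hH4 h hmem
  · have hyI : y ∈ Ioo y₃ y₅ := ⟨h34.trans hy.1, hy.2⟩
    refine lt_of_le_of_ne (hS.minSlope_le_eP (hhigh y hyI).mem) fun h => ?_
    exact absurd (le_csSup hbdd ⟨hyI, h.symm⟩) (not_le.2 hy.1)

end

theorem exists_regimes (hr : ∃ x ∈ E.types, p x ∈ Ioo (0 : ℝ) 1) :
    ∃ y₀ y₁ y₂ y₃ y₄ y₅, E.Regimes lam e p y₀ y₁ y₂ y₃ y₄ y₅ := by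
  obtain ⟨z, hz, hlz, hlt⟩ := hS.exists_last_fixed hE
  have hzx := hS.lt_xhi_of_random hE hz hlz hr
  obtain ⟨y₁, y₂, y₃, h01, h12, h23, h3x, t1, t2, t3, e1, e2, e3⟩ :=
    hS.exists_thresholds hE hz hlz hlt hzx
  obtain ⟨y₅, hy₅, hl5, hfirst⟩ := hS.exists_first_max hE
  have hX := hS.lam_xhi_mem hE
  have hx5 : lam E.xhi < y₅ := by
    by_contra! hle
    have h1 := hS.mono hy₅ hX hle
    have h2 := hlt _ hX hzx
    linarith
  have hI : ∀ {y}, z ≤ y → y ≤ y₅ → y ∈ Icc z E.xhi := fun h h' => ⟨h, h'.trans hy₅.2⟩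
  have hIX : ∀ {y}, y ∈ Icc z E.xhi → y ∈ E.types := fun h => ⟨hz.1.trans h.1, h.2⟩
  have hhigh : ∀ y ∈ Ioo y₃ y₅, E.HighType lam y := fun y hy => by
    have hyI := hI (h01.trans (h12.trans (h23.trans hy.1))).le hy.2.le
    exact ⟨hIX hyI, hfirst y (hIX hyI) hy.2, (t3 y hyI).2 hy.1⟩
  have hz3 : z < y₃ := h01.trans (h12.trans h23)
  obtain ⟨y₄, ⟨h34, h45⟩, hle4, hgt4⟩ :=
    hS.exists_last_eP_eq hE hz hlz hlt hz3 h3x hx5 hy₅.2 e3 hhigh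
  have hlow : ∀ y ∈ Icc z E.xhi, y ≤ y₁ → y - lam y ≤ E.lowRent lam y := fun y hy h => by
    rcases h.eq_or_lt with rfl | h
    · exact e1.le
    · exact ((t1 y hy).1 h).le
  have heff_le : ∀ y ∈ Icc z E.xhi, y ≤ y₂ → y - lam y ≤ E.effRent lam y := fun y hy h => by
    rcases h.eq_or_lt with rfl | h
    · exact e2.le
    · exact ((t2 y hy).1 h).le
  have heff_ge : ∀ y ∈ Icc z E.xhi, y₂ ≤ y → E.effRent lam y ≤ y - lam y := fun y hy h => by
    rcases h.eq_or_lt with rfl | h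
    · exact e2.ge
    · exact ((t2 y hy).2 h).le
  have hrp_le : ∀ y ∈ Icc z E.xhi, y ≤ y₃ →
      y - lam y - E.effRent lam y ≤ E.minSlope lam y * (y + E.τ) := fun y hy h => by
    rcases h.eq_or_lt with rfl | h
    · exact e3.le
    · exact ((t3 y hy).1 h).le
  have q1 : ∀ y ∈ Icc z y₁, e y = E.lowEffort (E.cP (E.minSlope lam y)) ∧ p y = E.minSlope lam y :=
    fun y hy => by
      have hyI := hI hy.1 (by linarith [hy.2])
      exact hS.eq_low hE (hIX hyI) (hlow y hyI hy.2)
  have q2 : ∀ y ∈ Icc y₁ y₂, E.uA (e y) = y - lam y ∧ p y = E.minSlope lam y := fun y hy => by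
    have hyI := hI (h01.le.trans hy.1) (by linarith [hy.2])
    exact hS.eq_between hE (hIX hyI) ((t1 y hyI).2 hy.1) (heff_le y hyI hy.2)
  have q3 : ∀ y ∈ Icc y₂ y₃,
      e y = E.effEffort (E.cP (E.minSlope lam y)) ∧ p y = E.minSlope lam y := fun y hy => by
    have hyI := hI (h01.trans h12 |>.le.trans hy.1) (by linarith [hy.2])
    exact hS.eq_eff hE (hIX hyI) (heff_ge y hyI hy.1) (hrp_le y hyI hy.2)
  have hone : ∀ y ∈ E.types, y < z → lam y = y ∧ e y = E.lowEffort (E.cP 1) ∧ p y = 1 :=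
    fun y hy h => hS.eq_of_lt_fixed hE hy hz hlz h
  have hzero : ∀ y ∈ Icc y₅ E.xhi, e y = 0 ∧ p y = 0 := fun y hy => by
    have hyX : y ∈ E.types := ⟨hy₅.1.trans hy.1, hy.2⟩
    refine hS.eq_zero_of_eq_xhi hE hyX (le_antisymm (hS.mono hyX hE.xhi_mem hy.2) ?_)
    rw [← hl5]
    exact hS.mono hy₅ hyX hy.1
  refine ⟨z, y₁, y₂, y₃, y₄, y₅, hz, hlz, hlt, h01, h12, h23, h34, h45, hy₅, hl5,
    fun y hy h => (hone y hy h).2.2, ?_, ?_, ?_, fun y hy => (q2 y hy).1, ?_, ?_, ?_, ?_, ?_,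
    hhigh, hgt4, hzero⟩
  · intro y hy
    rcases le_or_gt y y₁ with h | h
    · exact (q1 y ⟨hy.1, h⟩).2
    rcases le_or_gt y y₂ with h' | h'
    · exact (q2 y ⟨h.le, h'⟩).2
    rcases le_or_gt y y₃ with h'' | h''
    · exact (q3 y ⟨h'.le, h''⟩).2
    · exact hle4 y ⟨h'', hy.2⟩
  · intro y hy h
    rcases lt_or_ge y z with h' | h'
    · rw [(hone y hy h').2.2, (hone y hy h').2.1]
    · rw [(q1 y ⟨h', h⟩).2, (q1 y ⟨h', h⟩).1]
  · intro y hy h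
    rcases lt_or_ge y z with h' | h'
    · obtain ⟨h1, h2, -⟩ := hone y hy h'
      rw [h1, h2, sub_self]
      have hs := hE.cP_mem one_mem_effort
      exact hE.uA_pos (hE.lowEffort_mem hs)
        (hE.lowEffort_pos hs (hE.cost_P.pos one_mem_effort one_pos))
    · rw [(q1 y ⟨h', h.le⟩).1]
      exact (t1 y ⟨h', hy.2⟩).1 h
  · intro y hy
    rw [(q2 y ⟨hy.1.le, hy.2.le⟩).2]
    exact (t2 y (hI (h01.trans hy.1).le (by linarith [hy.2]))).1 hy.2
  · intro y hy
    rw [(q3 y hy).2, (q3 y hy).1]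
  · intro y hy h
    rcases le_or_gt y y₃ with h' | h'
    · rw [(q3 y ⟨h.le, h'⟩).1]
      exact (t2 y ⟨(h01.trans (h12.trans h)).le, hy.2⟩).2 h
    rcases lt_or_ge y y₅ with h'' | h''
    · exact hS.uA_lt_gap hE (hhigh y ⟨h', h''⟩)
    · rw [(hzero y ⟨h'', hy.2⟩).1, hE.uA_zero]
      linarith [hlt y hy (hz3.trans h')]
  · intro y hy
    rw [(q3 y ⟨hy.1, hy.2.le⟩).2, (q3 y ⟨hy.1, hy.2.le⟩).1]
    exact (t3 y (hI ((h01.trans h12).le.trans hy.1) (by linarith [hy.2]))).1 hy.2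
  · intro y hy
    rcases hy.1.eq_or_lt with rfl | h
    · rw [(q3 y₃ ⟨h23.le, le_rfl⟩).1, (q3 y₃ ⟨h23.le, le_rfl⟩).2]
      unfold effRent at e3
      linarith
    · have hp := hle4 y ⟨h, hy.2⟩
      rw [hp]
      exact hS.uA_eq_of_eq hE (hhigh y ⟨h, hy.2.trans_lt h45⟩) hp

end ReducedSolution

end AuditEnv

/-! ### Monotonicity and continuity of efforts and utility across the regimes -/

namespace AuditEnv

namespace Regimes

variable {E : AuditEnv} {lam e p : ℝ → ℝ} {y y' y₀ y₁ y₂ y₃ y₄ y₅ : ℝ}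
  (R : E.Regimes lam e p y₀ y₁ y₂ y₃ y₄ y₅) (hS : E.ReducedSolution lam e p) (hE : E.Admissible)

section
include R

theorem mem_types (h : y₀ ≤ y) (h' : y ≤ y₅) : y ∈ E.types :=
  ⟨R.mem₀.1.trans h, h'.trans R.mem₅.2⟩

theorem lt₀₃ : y₀ < y₃ := R.lt₀₁.trans (R.lt₁₂.trans R.lt₂₃)

theorem lt₁₄ : y₁ < y₄ := R.lt₁₂.trans (R.lt₂₃.trans R.lt₃₄)

theorem lt₀₄ : y₀ < y₄ := R.lt₀₁.trans R.lt₁₄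

theorem high₄ : E.HighType lam y₄ := R.high _ ⟨R.lt₃₄, R.lt₄₅⟩

theorem gap_le (hy : y ∈ E.types) (h : y ≤ y₁) : y - lam y ≤ E.uA (e y) := by
  rcases h.eq_or_lt with rfl | h
  · exact (R.eA_mid y ⟨le_rfl, R.lt₁₂.le⟩).ge
  · exact (R.gap_lt y hy h).le

theorem uA_le_gap (hy : y ∈ E.types) (h : y₁ ≤ y) : E.uA (e y) ≤ y - lam y := by
  rcases le_or_gt y y₂ with h2 | h2
  · exact (R.eA_mid y ⟨h, h2⟩).le
  · exact (R.lt_gap y hy h2).le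

end

section
include R hS hE

theorem eP_antitoneOn : AntitoneOn p E.types := by
  intro y hy y' hy' h
  rcases lt_or_ge y y₀ with h0 | h0
  · rw [R.eP_one y hy h0]
    exact (hS.eP_mem hy').2
  rcases le_or_gt y₅ y' with h5 | h5
  · rw [(R.zero y' ⟨h5, hy'.2⟩).2]
    exact (hS.eP_mem hy).1
  rcases le_or_gt y' y₄ with h4 | h4
  · rw [R.eP_minSlope y ⟨h0, h.trans h4⟩, R.eP_minSlope y' ⟨h0.trans h, h4⟩]
    exact hS.minSlope_antitone h
  rcases le_or_gt y y₃ with h3 | h3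
  · refine (hS.eP_antitone_of_highType hE R.high₄ (R.high y' ⟨R.lt₃₄.trans h4, h5⟩) h4.le).trans ?_
    rw [R.eP_minSlope y ⟨h0, h3.trans R.lt₃₄.le⟩, R.eP_minSlope y₄ ⟨R.lt₀₄.le, le_rfl⟩]
    exact hS.minSlope_antitone (h3.trans R.lt₃₄.le)
  · exact hS.eP_antitone_of_highType hE (R.high y ⟨h3, h.trans_lt h5⟩)
      (R.high y' ⟨h3.trans_le h, h5⟩) h

theorem eP_pos (hy : y ∈ E.types) (h : y < y₅) : 0 < p y := by
  rcases le_or_gt y y₄ with h4 | h4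
  · exact (hS.eP_pos hE R.high₄).trans_le (R.eP_antitoneOn hS hE hy R.high₄.mem h4)
  · exact hS.eP_pos hE (R.high y ⟨R.lt₃₄.trans h4, h⟩)

theorem eP_lt_one (h : y₀ < y) (h' : y < y₅) : p y < 1 := by
  have hy := R.mem_types h.le h'.le
  rcases le_or_gt y y₄ with h4 | h4
  · rw [R.eP_minSlope y ⟨h.le, h4⟩]
    exact hS.minSlope_lt_one hy (h'.trans_le R.mem₅.2) (R.lam_lt y hy h)
  · exact hS.eP_lt_one hE (R.high y ⟨R.lt₃₄.trans h4, h'⟩)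

theorem eP_lt_of_lt (h0 : y₀ ≤ y) (h : y < y') (h4 : y' ≤ y₄) (h1 : p y < 1) : p y' < p y := by
  have hpos := R.eP_pos hS hE (R.mem_types h0 (h.le.trans (h4.trans R.lt₄₅.le)))
    (h.trans_le (h4.trans R.lt₄₅.le))
  rw [R.eP_minSlope y ⟨h0, h.le.trans h4⟩] at h1 hpos ⊢
  rw [R.eP_minSlope y' ⟨h0.trans h.le, h4⟩]
  exact hS.minSlope_lt_of_lt hE hpos h1 h (R.mem_types (h0.trans h.le) (h4.trans R.lt₄₅.le))

theorem supportValue_eq (hy : y ∈ Icc y₄ E.xhi) :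
    E.supportValue lam (p y) = lam y + E.uA (e y) := by
  have hyX : y ∈ E.types := ⟨R.mem₀.1.trans (R.lt₀₄.le.trans hy.1), hy.2⟩
  rcases lt_or_ge y y₅ with h | h
  · exact hS.supportValue_eq hE (R.high y ⟨R.lt₃₄.trans_le hy.1, h⟩)
  · rw [(R.zero y ⟨h, hy.2⟩).1, (R.zero y ⟨h, hy.2⟩).2, hS.supportValue_zero hE, hE.uA_zero,
      add_zero]
    refine le_antisymm ?_ (hS.mono hyX hE.xhi_mem hy.2)
    rw [← R.lam₅]
    exact hS.mono R.mem₅ hyX h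

theorem eA_le_of_le (hy : y ∈ Ioc y₄ E.xhi) (hy' : y' ∈ Ioc y₄ E.xhi) (h : y ≤ y') :
    e y' ≤ e y := by
  have hX : ∀ x ∈ Ioc y₄ E.xhi, x ∈ E.types := fun x hx =>
    ⟨R.mem₀.1.trans (R.lt₀₄.le.trans hx.1.le), hx.2⟩
  rcases le_or_gt y₅ y' with h5 | h5
  · rw [(R.zero y' ⟨h5, hy'.2⟩).1]
    exact (hS.eA_mem (hX y hy)).1
  rcases h.eq_or_lt with rfl | h
  · exact le_rfl
  · exact (hS.eA_lt_of_lt hE (R.high y ⟨R.lt₃₄.trans hy.1, h.trans h5⟩)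
      (R.high y' ⟨R.lt₃₄.trans hy'.1, h5⟩) (R.minSlope_lt y ⟨hy.1, h.trans h5⟩) h).le

/-- From Φ(p) = λ + u_A(e): as e falls, Φ(p) grows no faster than λ, hence with rate at most one,
whereas Φ has slope at most -(xlo + τ). So p is Lipschitz. -/
theorem eP_continuousOn_Ioc : ContinuousOn p (Ioc y₄ E.xhi) := by
  have hX : ∀ x ∈ Ioc y₄ E.xhi, x ∈ E.types := fun x hx =>
    ⟨R.mem₀.1.trans (R.lt₀₄.le.trans hx.1.le), hx.2⟩
  have hτ := hE.add_τ_pos hE.xlo_mem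
  have key : ∀ x ∈ Ioc y₄ E.xhi, ∀ x' ∈ Ioc y₄ E.xhi, x ≤ x' →
      0 ≤ p x - p x' ∧ p x - p x' ≤ (E.xlo + E.τ)⁻¹ * (x' - x) := by
    intro x hx x' hx' h
    have h1 := R.eP_antitoneOn hS hE (hX x hx) (hX x' hx') h
    refine ⟨by linarith, ?_⟩
    have h2 := hS.le_supportValue_sub hE (hS.eP_mem (hX x' hx')).1 h1
    have h3 := R.supportValue_eq hS hE ⟨hx.1.le, hx.2⟩
    have h4 := R.supportValue_eq hS hE ⟨hx'.1.le, hx'.2⟩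
    have h5 := hE.uA_strictMonoOn.monotoneOn (hS.eA_mem (hX x' hx')) (hS.eA_mem (hX x hx))
      (R.eA_le_of_le hS hE hx hx' h)
    have h6 := hS.sub_le x (hX x hx) x' (hX x' hx') h
    rw [inv_mul_eq_div, le_div_iff₀ hτ]
    linarith
  have : LipschitzOnWith (E.xlo + E.τ)⁻¹.toNNReal p (Ioc y₄ E.xhi) := by
    refine LipschitzOnWith.of_dist_le_mul fun x hx z hz => ?_
    rw [Real.dist_eq, Real.dist_eq, Real.coe_toNNReal _ (inv_nonneg.2 hτ.le)]
    rcases le_total x z with h | h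
    · obtain ⟨h1, h2⟩ := key x hx z hz h
      rw [abs_of_nonneg h1, abs_of_nonpos (by linarith)]
      linarith
    · obtain ⟨h1, h2⟩ := key z hz x hx h
      rw [abs_of_nonpos (by linarith), abs_of_nonneg (by linarith)]
      linarith
  exact this.continuousOn

theorem eP_continuousOn_high : ContinuousOn p (Icc y₄ E.xhi) := by
  intro y hy
  rcases hy.1.eq_or_lt with rfl | h
  · have hp := R.eP_minSlope y₄ ⟨R.lt₀₄.le, le_rfl⟩
    refine tendsto_order.2 ⟨fun a ha => ?_, fun a ha => ?_⟩
    · rw [hp] at ha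
      filter_upwards [self_mem_nhdsWithin,
        (hS.minSlope_lowerSemicontinuous ha).filter_mono nhdsWithin_le_nhds] with x hx hax
      exact hax.trans_le (hS.minSlope_le_eP ⟨R.high₄.mem.1.trans hx.1, hx.2⟩)
    · filter_upwards [self_mem_nhdsWithin] with x hx
      exact (R.eP_antitoneOn hS hE R.high₄.mem ⟨R.high₄.mem.1.trans hx.1, hx.2⟩ hx.1).trans_lt ha
  · refine (R.eP_continuousOn_Ioc hS hE y ⟨h, hy.2⟩).mono_of_mem_nhdsWithin ?_
    filter_upwards [inter_mem_nhdsWithin _ (Ioi_mem_nhds h)] with x hx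
    exact ⟨hx.2, hx.1.2⟩

theorem eP_continuousOn : ContinuousOn p (Icc y₀ E.xhi) := by
  have h1 : ContinuousOn p (Icc y₀ y₄) :=
    ((hS.minSlope_continuousOn hE R.mem₀ R.lam_lt).mono
      (Icc_subset_Icc_right R.high₄.mem.2)).congr R.eP_minSlope
  have := h1.union_of_isClosed (R.eP_continuousOn_high hS hE) isClosed_Icc isClosed_Icc
  rwa [Icc_union_Icc_eq_Icc R.lt₀₄.le R.high₄.mem.2] at this

/-- On each of five closed pieces either e is a continuous function of p, or u_A(e) is continuous
and u_A is strictly increasing. Closed pieces glue. -/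
theorem eA_continuousOn : ContinuousOn e (Icc y₀ E.xhi) := by
  have hx4 := R.high₄.mem.2
  have hX : ∀ x ∈ Icc y₀ E.xhi, x ∈ E.types := fun x hx => ⟨R.mem₀.1.trans hx.1, hx.2⟩
  have hp := R.eP_continuousOn hS hE
  have hcP : ContinuousOn (fun y => E.cP (p y)) (Icc y₀ E.xhi) :=
    hE.cost_P.differentiableOn.continuousOn.comp hp fun y hy => hS.eP_mem (hX y hy)
  have hg := hS.gap_continuousOn R.mem₀
  have hu : ∀ {s : Set ℝ}, s ⊆ Icc y₀ E.xhi → ContinuousOn (fun y => E.uA (e y)) s →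
      ContinuousOn e s := fun hs h y hy => hE.uA_strictMonoOn.continuousWithinAt_of_comp
    (fun x hx => hS.eA_mem (hX x (hs hx))) hy (h y hy)
  have s1 : Icc y₀ y₁ ⊆ Icc y₀ E.xhi := Icc_subset_Icc_right (R.lt₁₄.le.trans hx4)
  have s2 : Icc y₁ y₂ ⊆ Icc y₀ E.xhi :=
    Icc_subset_Icc R.lt₀₁.le ((R.lt₂₃.trans R.lt₃₄).le.trans hx4)
  have s3 : Icc y₂ y₃ ⊆ Icc y₀ E.xhi :=
    Icc_subset_Icc (R.lt₀₁.trans R.lt₁₂).le (R.lt₃₄.le.trans hx4)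
  have s4 : Icc y₃ y₄ ⊆ Icc y₀ E.xhi := Icc_subset_Icc R.lt₀₃.le hx4
  have s5 : Icc y₄ E.xhi ⊆ Icc y₀ E.xhi := Icc_subset_Icc_left R.lt₀₄.le
  have c1 : ContinuousOn e (Icc y₀ y₁) :=
    (hE.lowEffort_continuousOn.comp (hcP.mono s1)
      fun y hy => hE.cP_mem (hS.eP_mem (hX y (s1 hy)))).congr
      fun y hy => R.eA_low y (hX y (s1 hy)) hy.2
  have c2 : ContinuousOn e (Icc y₁ y₂) := hu s2 ((hg.mono s2).congr R.eA_mid)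
  have c3 : ContinuousOn e (Icc y₂ y₃) :=
    (hE.effEffort_continuousOn.comp (hcP.mono s3)
      fun y hy => hE.cP_mem (hS.eP_mem (hX y (s3 hy)))).congr R.eA_eff
  have c4 : ContinuousOn e (Icc y₃ y₄) := hu s4
    ((((hg.sub (hp.mul (by fun_prop : ContinuousOn (fun y => y + E.τ) _))).mono s4)).congr
      R.eA_high)
  have c5 : ContinuousOn e (Icc y₄ E.xhi) := by
    refine hu s5 (((hS.supportValue_continuousOn hE).comp (hp.mono s5)
      (fun y hy => hS.eP_mem (hX y (s5 hy))) |>.sub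
        (hS.continuousOn.mono fun y hy => hX y (s5 hy))).congr fun y hy => ?_)
    have := R.supportValue_eq hS hE hy
    simp only [Pi.sub_apply, Function.comp]
    linarith
  have := (((c1.union_of_isClosed c2 isClosed_Icc isClosed_Icc).union_of_isClosed c3
    (isClosed_Icc.union isClosed_Icc) isClosed_Icc).union_of_isClosed c4
    ((isClosed_Icc.union isClosed_Icc).union isClosed_Icc) isClosed_Icc).union_of_isClosed c5
    (((isClosed_Icc.union isClosed_Icc).union isClosed_Icc).union isClosed_Icc) isClosed_Icc
  rwa [Icc_union_Icc_eq_Icc R.lt₀₁.le R.lt₁₂.le,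
    Icc_union_Icc_eq_Icc (R.lt₀₁.trans R.lt₁₂).le R.lt₂₃.le,
    Icc_union_Icc_eq_Icc R.lt₀₃.le R.lt₃₄.le, Icc_union_Icc_eq_Icc R.lt₀₄.le hx4] at this

omit R hS hE in
theorem continuousWithinAt_types {f : ℝ → ℝ} (hf : ContinuousOn f (Icc y₀ E.xhi))
    (hc : ∀ x ∈ E.types, x < y₀ → ∀ x' ∈ E.types, x' < y₀ → f x = f x')
    (hy : y ∈ E.types) (hne : y ≠ y₀) : ContinuousWithinAt f E.types y := by
  rcases lt_or_gt_of_ne hne with h | h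
  · refine (continuousWithinAt_const (b := f y)).congr_of_eventuallyEq ?_ rfl
    filter_upwards [inter_mem_nhdsWithin _ (Iio_mem_nhds h)] with x hx
    exact hc x hx.1 hx.2 y hy h
  · refine (hf y ⟨h.le, hy.2⟩).mono_of_mem_nhdsWithin ?_
    filter_upwards [inter_mem_nhdsWithin _ (Ioi_mem_nhds h)] with x hx
    exact ⟨le_of_lt hx.2, hx.1.2⟩

theorem eA_low_strictAntiOn : StrictAntiOn e {y | y ∈ Icc y₀ y₁ ∧ p y < 1} := by
  intro y hy y' hy' h
  have hX : ∀ x ∈ Icc y₀ y₁, x ∈ E.types := fun x hx =>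
    R.mem_types hx.1 (hx.2.trans (R.lt₁₄.trans R.lt₄₅).le)
  have hyX := hX y hy.1
  have hyX' := hX y' hy'.1
  rw [R.eA_low y hyX hy.1.2, R.eA_low y' hyX' hy'.1.2]
  exact hE.lowEffort_strictMonoOn (hE.cP_mem (hS.eP_mem hyX')) (hE.cP_mem (hS.eP_mem hyX))
    (hE.cost_P.strictMonoOn (hS.eP_mem hyX') (hS.eP_mem hyX)
      (R.eP_lt_of_lt hS hE hy.1.1 h (hy'.1.2.trans R.lt₁₄.le) hy.2))

theorem eA_mid_strictMonoOn : StrictMonoOn e (Icc y₁ y₂) := by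
  intro y hy y' hy' h
  have hX : ∀ x ∈ Icc y₁ y₂, x ∈ Icc y₀ y₅ := fun x hx =>
    ⟨R.lt₀₁.le.trans hx.1, hx.2.trans (R.lt₂₃.trans (R.lt₃₄.trans R.lt₄₅)).le⟩
  have h1 := hS.gap_strictMonoOn R.mem₀ R.lam₀ R.lam_lt
    ⟨(hX y hy).1, (hX y hy).2.trans R.mem₅.2⟩ ⟨(hX y' hy').1, (hX y' hy').2.trans R.mem₅.2⟩ h
  refine (hE.uA_strictMonoOn.lt_iff_lt (hS.eA_mem (R.mem_types (hX y hy).1 (hX y hy).2))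
    (hS.eA_mem (R.mem_types (hX y' hy').1 (hX y' hy').2))).1 ?_
  rw [R.eA_mid y hy, R.eA_mid y' hy']
  exact h1

theorem eA_eff_strictAntiOn : StrictAntiOn e (Icc y₂ y₃) := by
  intro y hy y' hy' h
  have h02 := R.lt₀₁.trans R.lt₁₂
  have h35 := R.lt₃₄.trans R.lt₄₅
  have hX : ∀ x ∈ Icc y₂ y₃, x ∈ E.types := fun x hx =>
    R.mem_types (h02.le.trans hx.1) (hx.2.trans h35.le)
  rw [R.eA_eff y hy, R.eA_eff y' hy']
  exact hE.effEffort_strictMonoOn (hE.cP_mem (hS.eP_mem (hX y' hy')))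
    (hE.cP_mem (hS.eP_mem (hX y hy))) (hE.cost_P.strictMonoOn (hS.eP_mem (hX y' hy'))
      (hS.eP_mem (hX y hy)) (R.eP_lt_of_lt hS hE (h02.le.trans hy.1) h (hy'.2.trans R.lt₃₄.le)
        (R.eP_lt_one hS hE (h02.trans_le hy.1) (hy.2.trans_lt h35))))

theorem eA_high_strictMonoOn : StrictMonoOn e (Icc y₃ y₄) := by
  intro y hy y' hy' h
  have hX : ∀ x ∈ Icc y₃ y₄, x ∈ E.types := fun x hx =>
    R.mem_types (R.lt₀₃.le.trans hx.1) (hx.2.trans R.lt₄₅.le)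
  refine (hE.uA_strictMonoOn.lt_iff_lt (hS.eA_mem (hX y hy)) (hS.eA_mem (hX y' hy'))).1 ?_
  have h1 := R.eA_high y hy
  have h2 := R.eA_high y' hy'
  have h3 := hE.uA_nonneg (hS.eA_mem (hX y hy))
  rw [R.eP_minSlope y ⟨R.lt₀₃.le.trans hy.1, hy.2⟩] at h1
  rw [R.eP_minSlope y' ⟨R.lt₀₃.le.trans hy'.1, hy'.2⟩] at h2
  rw [h1, h2]
  exact hS.gap_sub_lt_gap_sub hE R.mem₀ R.lam₀ R.lam_lt (hX y' hy') (R.lt₀₃.le.trans hy.1) h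
    (by linarith)

theorem eA_superHigh_strictAntiOn : StrictAntiOn e (Ioo y₄ y₅) := fun y hy y' hy' h =>
  hS.eA_lt_of_lt hE (R.high y ⟨R.lt₃₄.trans hy.1, hy.2⟩) (R.high y' ⟨R.lt₃₄.trans hy'.1, hy'.2⟩)
    (R.minSlope_lt y hy) h

theorem eA_lt_eff (hy : y ∈ E.types) (h : y < y₂) : e y < E.effEffort (E.cP (p y)) := by
  have hs := hE.cP_mem (hS.eP_mem hy)
  rcases le_or_gt y y₁ with h1 | h1
  · rw [R.eA_low y hy h1]
    exact hE.lowEffort_lt_effEffort hs (hE.cost_P.pos (hS.eP_mem hy)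
      (R.eP_pos hS hE hy (h1.trans_lt (R.lt₁₄.trans R.lt₄₅))))
  · refine (hE.uA_strictMonoOn.lt_iff_lt (hS.eA_mem hy) (hE.effEffort_mem hs)).1 ?_
    rw [R.eA_mid y ⟨h1.le, h.le⟩]
    exact R.gap_lt_eff y ⟨h1, h⟩

theorem utility_antitoneOn :
    AntitoneOn (fun y => max (y - lam y) (E.uA (e y))) (Icc E.xlo y₁) := by
  intro y hy y' hy' h
  have h1 : y₁ ≤ E.xhi := (R.lt₁₄.trans R.lt₄₅).le.trans R.mem₅.2
  have hyX : y ∈ E.types := ⟨hy.1, hy.2.trans h1⟩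
  have hyX' : y' ∈ E.types := ⟨hy'.1, hy'.2.trans h1⟩
  simp only
  rw [max_eq_right (R.gap_le hyX hy.2), max_eq_right (R.gap_le hyX' hy'.2)]
  refine hE.uA_strictMonoOn.monotoneOn (hS.eA_mem hyX') (hS.eA_mem hyX) ?_
  rw [R.eA_low y hyX hy.2, R.eA_low y' hyX' hy'.2]
  exact hE.lowEffort_strictMonoOn.monotoneOn (hE.cP_mem (hS.eP_mem hyX'))
    (hE.cP_mem (hS.eP_mem hyX)) (hE.cost_P.strictMonoOn.monotoneOn (hS.eP_mem hyX')
      (hS.eP_mem hyX) (R.eP_antitoneOn hS hE hyX hyX' h))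

theorem utility_strictAntiOn :
    StrictAntiOn (fun y => max (y - lam y) (E.uA (e y))) {y | y ∈ Icc y₀ y₁ ∧ p y < 1} := by
  intro y hy y' hy' h
  have hX : ∀ x ∈ Icc y₀ y₁, x ∈ E.types := fun x hx =>
    R.mem_types hx.1 (hx.2.trans (R.lt₁₄.trans R.lt₄₅).le)
  simp only
  rw [max_eq_right (R.gap_le (hX y hy.1) hy.1.2),
    max_eq_right (R.gap_le (hX y' hy'.1) hy'.1.2)]
  exact hE.uA_strictMonoOn (hS.eA_mem (hX y' hy'.1)) (hS.eA_mem (hX y hy.1))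
    (R.eA_low_strictAntiOn hS hE hy hy' h)

omit hE in
theorem utility_strictMonoOn :
    StrictMonoOn (fun y => max (y - lam y) (E.uA (e y))) (Icc y₁ E.xhi) := by
  intro y hy y' hy' h
  have hX : ∀ x ∈ Icc y₁ E.xhi, x ∈ E.types := fun x hx =>
    ⟨R.mem₀.1.trans (R.lt₀₁.le.trans hx.1), hx.2⟩
  simp only
  rw [max_eq_left (R.uA_le_gap (hX y hy) hy.1),
    max_eq_left (R.uA_le_gap (hX y' hy') hy'.1)]
  exact hS.gap_strictMonoOn R.mem₀ R.lam₀ R.lam_lt ⟨R.lt₀₁.le.trans hy.1, hy.2⟩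
    ⟨R.lt₀₁.le.trans hy'.1, hy'.2⟩ h

end

end Regimes

end AuditEnv

end

/-! ### Size and growth of the refund without evidence -/

namespace AuditEnv.Regimes

variable {E : AuditEnv} {lam e p : ℝ → ℝ} {y y' y₀ y₁ y₂ y₃ y₄ y₅ : ℝ}

theorem gap_sub_le (R : E.Regimes lam e p y₀ y₁ y₂ y₃ y₄ y₅) (hS : E.ReducedSolution lam e p)
    (hE : E.Admissible) (hy : y ∈ E.types) (h : y ≤ y₄) :
    max (y - lam y - E.uA (e y)) 0 ≤ p y * (y + E.τ) := by
  have h0 := mul_nonneg (hS.eP_mem hy).1 (hE.add_τ_pos hy).le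
  refine max_le ?_ h0
  rcases le_or_gt y y₁ with h1 | h1
  · linarith [R.gap_le hy h1]
  rcases le_or_gt y y₂ with h2 | h2
  · linarith [R.eA_mid y ⟨h1.le, h2⟩]
  rcases lt_or_ge y y₃ with h3 | h3
  · exact (R.gap_sub_lt y ⟨h2.le, h3⟩).le
  · linarith [R.eA_high y ⟨h3, h⟩]

/-- When p exceeds the smallest slope, the line through (y, y) stays strictly above λ. The binding
constraint is thus the rent constraint alone, and its line lies strictly lower: a refund without
evidence is paid. -/
theorem lt_gap_sub (R : E.Regimes lam e p y₀ y₁ y₂ y₃ y₄ y₅) (hS : E.ReducedSolution lam e p)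
    (hE : E.Admissible) (hy : y ∈ E.types) (h : y₄ < y) :
    p y * (y + E.τ) < y - lam y - E.uA (e y) := by
  have hy0 := R.lt₀₄.trans h
  rcases lt_or_ge y y₅ with h5 | h5
  · obtain ⟨η, hη, hgap⟩ := hS.exists_gap hE (fun w hw => hS.lt_line hy (R.lam_lt y hy hy0)
      (R.minSlope_lt y ⟨h, h5⟩) (R.eP_lt_one hS hE hy0 h5) hw)
    have h1 : E.supportValue lam (p y) ≤ y - p y * (y + E.τ) - η :=
      ReducedSolution.supportValue_le hE fun w hw => by linarith [hgap w hw]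
    linarith [R.supportValue_eq hS hE ⟨h.le, hy.2⟩]
  · rw [(R.zero y ⟨h5, hy.2⟩).1, (R.zero y ⟨h5, hy.2⟩).2, hE.uA_zero]
    linarith [R.lam_lt y hy hy0]

/-- Above the last type with minimal principal's effort, the refund without evidence increases. -/
theorem refund_mono (R : E.Regimes lam e p y₀ y₁ y₂ y₃ y₄ y₅) (hS : E.ReducedSolution lam e p)
    (hE : E.Admissible) (hy : y ∈ E.types) (hy' : y' ∈ E.types) (h : y₄ < y) (hle : y ≤ y')
    (hp : p y < 1) {r r' : ℝ}
    (hr : (1 - p y) * r = y - lam y - E.uA (e y) - p y * (y + E.τ))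
    (hr' : (1 - p y') * r' = y' - lam y' - E.uA (e y') - p y' * (y' + E.τ)) : r ≤ r' := by
  have h1 := R.supportValue_eq hS hE ⟨h.le, hy.2⟩
  have h2 := R.supportValue_eq hS hE ⟨h.le.trans hle, hy'.2⟩
  have h3 := R.eP_antitoneOn hS hE hy hy' hle
  have h4 := hE.uA_strictMonoOn.monotoneOn (hS.eA_mem hy') (hS.eA_mem hy)
    (R.eA_le_of_le hS hE ⟨h, hy.2⟩ ⟨h.trans_le hle, hy'.2⟩ hle)
  have h5 := R.lt_gap_sub hS hE hy h
  have hu := hE.uA_nonneg (hS.eA_mem hy)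
  have hu' := hE.uA_nonneg (hS.eA_mem hy')
  have hτ := hE.add_τ_pos hy
  have hlo := hS.xlo_le y' hy'
  have hx0 := hE.xlo_nonneg
  have hτ0 := hE.τ_pos
  have hyx : E.xlo < y := R.mem₀.1.trans_lt (R.lt₀₄.trans h)
  -- By concavity λ grows beyond `y` at most at its average rate between `xlo` and `y`, which `h5`
  -- bounds by `1 - p y`.
  have h6 : lam y' - lam y ≤ (1 - p y) * (y' - y) := by
    have hs := hS.slope_le hE.xlo_mem hy' hy.1 hle
    have hxx : lam E.xlo = E.xlo :=
      le_antisymm (hS.le_self _ hE.xlo_mem) (hS.xlo_le _ hE.xlo_mem)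
    rw [hxx] at hs
    have h7 : lam y - E.xlo ≤ (1 - p y) * (y - E.xlo) := by
      nlinarith [mul_nonneg (hS.eP_mem hy).1 (by linarith : 0 ≤ E.xlo + E.τ)]
    have h8 := mul_le_mul_of_nonneg_right h7 (sub_nonneg.2 hle)
    have h9 : 0 < y - E.xlo := by linarith
    by_contra! hlt
    have := mul_lt_mul_of_pos_right hlt h9
    linarith
  have hq : 0 < 1 - p y := by linarith
  have hq' : 0 < 1 - p y' := by linarith
  -- Rewritten this way, the refund is compared through λ + u_A(e): λ grows by at most `(1 - p y)
  -- (y' - y)` and the rent falls.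
  have k1 : (1 - p y) * (y - r + E.τ) = lam y + E.uA (e y) + E.τ := by linear_combination -hr
  have k2 : (1 - p y') * (y' - r' + E.τ) = lam y' + E.uA (e y') + E.τ := by
    linear_combination -hr'
  have k3 : 0 ≤ y' - r' + E.τ := by
    by_contra! hneg
    have := mul_neg_of_pos_of_neg hq' hneg
    linarith
  have k4 : (1 - p y) * (y' - r' + E.τ) ≤ lam y' + E.uA (e y') + E.τ := by
    rw [← k2]
    exact mul_le_mul_of_nonneg_right (by linarith) k3
  by_contra! hlt
  have := mul_lt_mul_of_pos_left hlt hq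
  nlinarith

end AuditEnv.Regimes

/-! ### Refunds of the representative -/

namespace TaxMechanism

open AuditEnv

variable {E : AuditEnv} {m : TaxMechanism} {y y' y₀ y₁ y₂ y₃ y₄ y₅ : ℝ}

/-- The representative of `m` whose refunds that are never paid are as small as possible without any
evidence and as large as possible after evidence by the principal. -/
def representative (E : AuditEnv) (m : TaxMechanism) : TaxMechanism where
  eA := m.eA
  eP := m.eP
  rA := m.rA
  rP := open Classical in fun y => if m.eP y = 0 then y + E.τ else m.rP y
  rN := open Classical in fun y => if m.eP y = 1 then 0 else m.rN y

theorem representative_identified (E : AuditEnv) (m : TaxMechanism) :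
    Identified E m (representative E m) := fun _ _ =>
  ⟨rfl, rfl, rfl, fun h => if_neg h, fun h => if_neg h⟩

theorem representative_RNA (E : AuditEnv) (m : TaxMechanism) (y : ℝ) :
    (representative E m).RNA y = m.RNA y := by
  unfold RNA representative
  by_cases h0 : m.eP y = 0
  · simp [h0]
  · by_cases h1 : m.eP y = 1 <;> simp [h0, h1]

theorem representative_deviationLoss (E : AuditEnv) (m : TaxMechanism) (x y : ℝ) :
    (representative E m).deviationLoss x y = m.deviationLoss x y := by
  unfold deviationLoss representative
  by_cases h1 : m.eP y = 1 <;> simp [h1]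

theorem IsMechanism.representative (hE : E.Admissible) (hm : m.IsMechanism E) :
    (representative E m).IsMechanism E where
  feasible := fun y hy => by
    obtain ⟨h1, h2, h3, h4, h5⟩ := hm.feasible y hy
    have hτ := (hE.add_τ_pos hy).le
    refine ⟨h1, h2, h3, ?_, ?_⟩
    · unfold TaxMechanism.representative
      simp only
      split_ifs
      · exact ⟨hτ, le_rfl⟩
      · exact h4
    · unfold TaxMechanism.representative
      simp only
      split_ifs
      · exact ⟨le_rfl, hτ⟩
      · exact h5
  obedient := fun x hx e he => by
    rw [representative_RNA]
    exact hm.obedient x hx e he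
  truthful := fun x hx => by
    have h1 : (TaxMechanism.representative E m).loss E x = m.loss E x := by
      unfold loss
      simp only [representative_deviationLoss]
    have h2 : (TaxMechanism.representative E m).utility E x = m.utility E x := by
      unfold utility evidenceRent
      rw [representative_RNA]
      rfl
    rw [h1, h2]
    exact hm.truthful x hx

theorem isEfficientEffort_effEffort (hE : E.Admissible) (hp : m.eP y ∈ Icc (0 : ℝ) 1) :
    m.IsEfficientEffort E y (E.effEffort (E.cP (m.eP y))) := by
  have hs := hE.cP_mem hp
  refine ⟨hE.effEffort_mem hs, fun e' he' hne => ?_⟩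
  have h := hE.cost_A.strictConvexOn.tangent_lt_of_ne hE.cost_A.differentiableOn he'
    (hE.effEffort_mem hs) hne
  rw [hE.deriv_effEffort hs] at h
  linarith

section

variable (hE : E.Admissible) (hm : m.Tight E)
  (R : E.Regimes (m.loss E) m.eA m.eP y₀ y₁ y₂ y₃ y₄ y₅)
include hE hm R

theorem Tight.representative_rN_eq_zero (hy : y ∈ E.types) (h : y ≤ y₄) :
    (representative E m).rN y = 0 := by
  have hS := hm.reducedSolution hE
  unfold representative
  simp only
  split_ifs with h1
  · rfl
  have hp1 : m.eP y < 1 := lt_of_le_of_ne (hS.eP_mem hy).2 h1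
  have h2 := hm.rN_eq hE hy ⟨R.eP_pos hS hE hy (h.trans_lt R.lt₄₅), hp1⟩
  rw [hm.RNA_eq hE hy, max_eq_right (sub_nonpos.2 (R.gap_sub_le hS hE hy h))] at h2
  rcases mul_eq_zero.1 h2 with h3 | h3
  · linarith
  · exact h3

theorem Tight.representative_rN_eq (hy : y ∈ E.types) (h : y₄ < y) :
    m.eP y < 1 ∧ (1 - m.eP y) * (representative E m).rN y =
      y - m.loss E y - E.uA (m.eA y) - m.eP y * (y + E.τ) := by
  have hS := hm.reducedSolution hE
  have hgap := R.lt_gap_sub hS hE hy h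
  have h0 := mul_nonneg (hS.eP_mem hy).1 (hE.add_τ_pos hy).le
  have hR : m.RNA y = y - m.loss E y - E.uA (m.eA y) := by
    rw [hm.RNA_eq hE hy, max_eq_left (by linarith)]
  have hp1 : m.eP y < 1 := by
    rcases lt_or_ge y y₅ with h5 | h5
    · exact R.eP_lt_one hS hE (R.lt₀₄.trans h) h5
    · rw [(R.zero y ⟨h5, hy.2⟩).2]; exact one_pos
  refine ⟨hp1, ?_⟩
  have hrep : (representative E m).rN y = m.rN y := if_neg hp1.ne
  rw [hrep]
  rcases lt_or_ge y y₅ with h5 | h5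
  · rw [hm.rN_eq hE hy ⟨R.eP_pos hS hE hy h5, hp1⟩, hR, max_eq_left (by linarith)]
  · rw [← hR]
    unfold RNA
    rw [(R.zero y ⟨h5, hy.2⟩).2]
    ring

theorem Tight.representative_rN_monotoneOn : MonotoneOn (representative E m).rN E.types := by
  intro y hy y' hy' hle
  have hS := hm.reducedSolution hE
  rcases le_or_gt y y₄ with h | h
  · rw [hm.representative_rN_eq_zero hE R hy h]
    exact ((hm.1.representative hE).feasible y' hy').2.2.2.2.1
  · obtain ⟨h1, h2⟩ := hm.representative_rN_eq hE R hy h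
    exact R.refund_mono hS hE hy hy' h hle h1 h2
      (hm.representative_rN_eq hE R hy' (h.trans_le hle)).2

theorem Tight.representative_rN_pos_iff (hy : y ∈ E.types) :
    0 < (representative E m).rN y ↔ y₄ < y := by
  constructor
  · intro h
    by_contra! hle
    rw [hm.representative_rN_eq_zero hE R hy hle] at h
    exact lt_irrefl _ h
  · intro h
    obtain ⟨h1, h2⟩ := hm.representative_rN_eq hE R hy h
    have h3 := R.lt_gap_sub (hm.reducedSolution hE) hE hy h
    refine pos_of_mul_pos_right (a := 1 - m.eP y) ?_ (by linarith)
    rw [h2]; linarith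

theorem Tight.representative_rP_eq_zero (hy : y ∈ E.types) (h : y ≤ y₂) :
    (representative E m).rP y = 0 := by
  have hS := hm.reducedSolution hE
  have hp := R.eP_pos hS hE hy (h.trans_lt (R.lt₂₃.trans (R.lt₃₄.trans R.lt₄₅)))
  have hrep : (representative E m).rP y = m.rP y := if_neg hp.ne'
  rw [hrep]
  have hu : y - m.loss E y ≤ E.uA (m.eA y) := by
    rcases le_or_gt y y₁ with h1 | h1
    · exact R.gap_le hy h1
    · exact (R.eA_mid y ⟨h1.le, h⟩).ge
  have hR : m.RNA y = 0 := by
    rw [hm.RNA_eq hE hy, max_eq_right (by linarith)]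
  obtain ⟨-, hpI, -, hP, hN⟩ := hm.1.feasible y hy
  unfold RNA at hR
  have h1 := mul_nonneg (sub_nonneg.2 hpI.2) hN.1
  have h2 := mul_nonneg hpI.1 hP.1
  rcases mul_eq_zero.1 (by linarith : m.eP y * m.rP y = 0) with h3 | h3
  · exact absurd h3 hp.ne'
  · exact h3

theorem Tight.representative_rP_eq_gap (hy : y ∈ Ioc y₂ y₄) :
    m.eP y * (representative E m).rP y = y - m.loss E y - E.uA (m.eA y) := by
  have hS := hm.reducedSolution hE
  have hyX := R.mem_types ((R.lt₀₁.trans R.lt₁₂).trans hy.1).le (hy.2.trans R.lt₄₅.le)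
  have hp := R.eP_pos hS hE hyX (hy.2.trans_lt R.lt₄₅)
  have hp1 := R.eP_lt_one hS hE ((R.lt₀₁.trans R.lt₁₂).trans hy.1) (hy.2.trans_lt R.lt₄₅)
  have hrep : (representative E m).rP y = m.rP y := if_neg hp.ne'
  have hN := hm.representative_rN_eq_zero hE R hyX hy.2
  have hrep' : (representative E m).rN y = m.rN y := if_neg hp1.ne
  rw [hrep'] at hN
  have hR := hm.RNA_eq hE hyX
  rw [max_eq_left (by linarith [R.lt_gap y hyX hy.1])] at hR
  unfold RNA at hR
  rw [hrep, ← hR, hN, mul_zero, add_zero]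

theorem Tight.representative_rP_eq_max (hy : y ∈ E.types) (h : y₃ ≤ y) :
    (representative E m).rP y = y + E.τ := by
  have hS := hm.reducedSolution hE
  rcases lt_or_ge y y₅ with h5 | h5
  · have hp := R.eP_pos hS hE hy h5
    refine mul_left_cancel₀ hp.ne' ?_
    rcases le_or_gt y y₄ with h4 | h4
    · rw [hm.representative_rP_eq_gap hE R ⟨R.lt₂₃.trans_le h, h4⟩]
      linarith [R.eA_high y ⟨h, h4⟩]
    · obtain ⟨h1, h2⟩ := hm.representative_rN_eq hE R hy h4
      have hrep' : (representative E m).rN y = m.rN y := if_neg h1.ne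
      have hrep : (representative E m).rP y = m.rP y := if_neg hp.ne'
      have hR := hm.RNA_eq hE hy
      have h3 := R.lt_gap_sub hS hE hy h4
      have h0 := mul_nonneg hp.le (hE.add_τ_pos hy).le
      rw [max_eq_left (by linarith)] at hR
      unfold RNA at hR
      rw [hrep'] at h2
      rw [hrep]
      linarith
  · exact if_pos (R.zero y ⟨h5, hy.2⟩).2

theorem Tight.representative_rP_pos_iff (hy : y ∈ E.types) :
    0 < (representative E m).rP y ↔ y₂ < y := by
  constructor
  · intro h
    by_contra! hle
    rw [hm.representative_rP_eq_zero hE R hy hle] at h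
    exact lt_irrefl _ h
  · intro h
    rcases le_or_gt y₃ y with h3 | h3
    · rw [hm.representative_rP_eq_max hE R hy h3]
      exact hE.add_τ_pos hy
    · have h1 := hm.representative_rP_eq_gap hE R ⟨h, (h3.trans R.lt₃₄).le⟩
      refine pos_of_mul_pos_right (a := m.eP y) ?_
        ((hm.reducedSolution hE).eP_mem hy).1
      rw [h1]
      linarith [R.lt_gap y hy h]

theorem Tight.representative_rP_eq_iff (hy : y ∈ E.types) :
    (representative E m).rP y = y + E.τ ↔ y₃ ≤ y := by
  refine ⟨fun h => ?_, fun h => hm.representative_rP_eq_max hE R hy h⟩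
  by_contra! hlt
  rcases le_or_gt y y₂ with h2 | h2
  · rw [hm.representative_rP_eq_zero hE R hy h2] at h
    exact (hE.add_τ_pos hy).ne h
  · have h1 := hm.representative_rP_eq_gap hE R ⟨h2, (hlt.trans R.lt₃₄).le⟩
    rw [h] at h1
    linarith [R.gap_sub_lt y ⟨h2.le, hlt⟩]

/-- In Middle, p r_P = g - u_A(e), where g rises while e and p fall. Elsewhere the refund is zero or
at its cap. -/
theorem Tight.representative_rP_monotoneOn : MonotoneOn (representative E m).rP E.types := by
  intro y hy y' hy' hle
  have hS := hm.reducedSolution hE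
  have hf := (hm.1.representative hE).feasible
  rcases le_or_gt y y₂ with h2 | h2
  · rw [hm.representative_rP_eq_zero hE R hy h2]
    exact (hf y' hy').2.2.2.1.1
  rcases le_or_gt y₃ y' with h3 | h3
  · rw [hm.representative_rP_eq_max hE R hy' h3]
    linarith [(hf y hy).2.2.2.1.2]
  have h34 := R.lt₃₄.le
  have h1 := hm.representative_rP_eq_gap hE R ⟨h2, (hle.trans h3.le).trans h34⟩
  have h1' := hm.representative_rP_eq_gap hE R ⟨h2.trans_le hle, h3.le.trans h34⟩
  have hg := hS.gap_mono hy hy' hle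
  have hu := hE.uA_strictMonoOn.monotoneOn (hS.eA_mem hy') (hS.eA_mem hy)
    ((R.eA_eff_strictAntiOn hS hE).antitoneOn ⟨h2.le, hle.trans h3.le⟩
      ⟨h2.le.trans hle, h3.le⟩ hle)
  have hp := R.eP_antitoneOn hS hE hy hy' hle
  have hpos := R.eP_pos hS hE hy ((hle.trans_lt h3).trans (R.lt₃₄.trans R.lt₄₅))
  have h5 := mul_le_mul_of_nonneg_right hp (hf y' hy').2.2.2.1.1
  refine le_of_mul_le_mul_left (a := m.eP y) ?_ hpos
  linarith

end

end TaxMechanism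

end

/-! ### The five intervals -/

theorem theorem1 (E : AuditEnv) (hE : E.Admissible) (m : TaxMechanism)
    (hm : m.Tight E) (hrandom : m.RandomAudits E) :
    -- the evidence rent is `u_A(e_A)`, so utility and profit are the usual functions of `e_A`
    (∀ x ∈ E.types, m.evidenceRent E x = E.uA (m.eA x)) ∧
    -- `SL, L, M, H, SH` are SuperLow, Low, Middle, High, SuperHigh
    ∃ SL L M H SH : Set ℝ,
      -- intervals with non-empty interior
      (SL.OrdConnected ∧ L.OrdConnected ∧ M.OrdConnected ∧ H.OrdConnected ∧ SH.OrdConnected) ∧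
      ((interior SL).Nonempty ∧ (interior L).Nonempty ∧ (interior M).Nonempty ∧
        (interior H).Nonempty ∧ (interior SH).Nonempty) ∧
      -- consecutive
      (sSup SL = sInf L ∧ sSup L = sInf M ∧ sSup M = sInf H ∧ sSup H = sInf SH) ∧
      -- they partition the set of types with interior principal effort
      (SL ∪ L ∪ M ∪ H ∪ SH = {x | x ∈ E.types ∧ m.eP x ∈ Ioo (0 : ℝ) 1}) ∧
      (Disjoint SL L ∧ Disjoint SL M ∧ Disjoint SL H ∧ Disjoint SL SH ∧ Disjoint L M ∧
        Disjoint L H ∧ Disjoint L SH ∧ Disjoint M H ∧ Disjoint M SH ∧ Disjoint H SH) ∧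
      -- (1) the principal's effort
      ((∀ y ∈ Ico E.xlo (sInf SL), m.eP y = 1) ∧
        AntitoneOn m.eP E.types ∧
        StrictAntiOn m.eP (SL ∪ L ∪ M ∪ H) ∧
        (∀ y ∈ Icc (sSup SH) E.xhi, m.eP y = 0) ∧
        (∀ y ∈ E.types, y ≠ sInf SL → ContinuousWithinAt m.eP E.types y) ∧
        ContinuousWithinAt m.eP (Icc (sInf SL) E.xhi) (sInf SL)) ∧
      -- (2) the agent's effort
      ((∀ y ∈ Ico E.xlo (sInf SL), ∀ z ∈ Ico E.xlo (sInf SL), m.eA y = m.eA z) ∧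
        (StrictAntiOn m.eA SL ∧ StrictMonoOn m.eA L ∧ StrictAntiOn m.eA M ∧
          StrictMonoOn m.eA H ∧ StrictAntiOn m.eA SH) ∧
        (∀ y ∈ Icc (sSup SH) E.xhi, m.eA y = 0) ∧
        (∃ eff : ℝ → ℝ, (∀ y ∈ E.types, m.IsEfficientEffort E y (eff y)) ∧
          (∀ y ∈ Ico E.xlo (sInf M), m.eA y < eff y) ∧
          (∀ y ∈ M, m.eA y = eff y) ∧
          (∀ y ∈ Ioo (sSup M) (sSup SH), eff y < m.eA y) ∧
          (∀ y ∈ Icc (sSup SH) E.xhi, m.eA y = eff y)) ∧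
        (∀ y ∈ E.types, y ≠ sInf SL → ContinuousWithinAt m.eA E.types y) ∧
        ContinuousWithinAt m.eA (Icc (sInf SL) E.xhi) (sInf SL)) ∧
      -- (3) the refunds, for a representative of the mechanism up to refunds that are never paid
      (∃ m' : TaxMechanism, TaxMechanism.Identified E m m' ∧ m'.IsMechanism E ∧
        MonotoneOn m'.rN E.types ∧
        (∀ y ∈ E.types, 0 < m'.rN y ↔ sInf SH < y) ∧
        MonotoneOn m'.rP E.types ∧
        (∀ y ∈ E.types, 0 < m'.rP y ↔ sInf M < y) ∧
        (∀ y ∈ E.types, m'.rP y = y + E.τ ↔ sSup M ≤ y)) ∧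
      -- (4) the agent's utility
      (AntitoneOn (m.utility E) (Icc E.xlo (sSup SL)) ∧
        (∀ y ∈ Icc E.xlo (sInf SL) \ SL, ∀ z ∈ Icc E.xlo (sInf SL) \ SL,
          m.utility E y = m.utility E z) ∧
        StrictAntiOn (m.utility E) SL ∧
        StrictMonoOn (m.utility E) (Icc (sSup SL) E.xhi) ∧
        (∃ δ > 0, ∀ y ∈ E.types, δ ≤ m.utility E y)) ∧
      -- (5) the agent's incentive to advance the full surplus
      ((∀ y ∈ Ico E.xlo (sSup SL), y - m.loss E y < m.utility E y) ∧
        (∀ y ∈ Icc (sSup SL) E.xhi, m.utility E y = y - m.loss E y)) ∧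
      -- (6) the principal's profit
      MonotoneOn (m.profit E) E.types := by
  have hS := hm.reducedSolution hE
  obtain ⟨y₀, y₁, y₂, y₃, y₄, y₅, R⟩ := hS.exists_regimes hE hrandom
  have h01 := R.lt₀₁
  have h12 := R.lt₁₂
  have h23 := R.lt₂₃
  have h34 := R.lt₃₄
  have h45 := R.lt₄₅
  have hlo := R.mem₀.1
  have hhi := R.mem₅.2
  have hX : ∀ {y}, y₀ ≤ y → y ≤ y₅ → y ∈ E.types := fun h h' => R.mem_types h h'
  -- The condition on `m.eP` in SuperLow matters at `y₀` only, where audits may or may not be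
  -- certain.
  refine ⟨fun y hy => hm.evidenceRent_eq hE hy, {y | y ∈ Icc y₀ y₁ ∧ m.eP y < 1}, Ioo y₁ y₂,
    Icc y₂ y₃, Ioc y₃ y₄, Ioo y₄ y₅, ?_⟩
  have hIoc : Ioc y₀ y₁ ⊆ {y | y ∈ Icc y₀ y₁ ∧ m.eP y < 1} := fun y hy =>
    ⟨⟨hy.1.le, hy.2⟩, R.eP_lt_one hS hE hy.1 (hy.2.trans_lt (R.lt₁₄.trans h45))⟩
  have hInf : sInf {y | y ∈ Icc y₀ y₁ ∧ m.eP y < 1} = y₀ := by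
    refine IsGLB.csInf_eq ⟨fun y hy => hy.1.1, fun b hb => ?_⟩ ⟨y₁, hIoc ⟨h01, le_rfl⟩⟩
    exact (isGLB_Ioc h01).2 fun y hy => hb (hIoc hy)
  have hSup : sSup {y | y ∈ Icc y₀ y₁ ∧ m.eP y < 1} = y₁ := by
    refine IsLUB.csSup_eq ⟨fun y hy => hy.1.2, fun b hb => ?_⟩ ⟨y₁, hIoc ⟨h01, le_rfl⟩⟩
    exact hb (hIoc ⟨h01, le_rfl⟩)
  have hanti := R.eP_antitoneOn hS hE
  have heA : ∀ y ∈ E.types, y < y₀ → m.eA y = E.lowEffort (E.cP 1) := fun y hy h => by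
    rw [R.eA_low y hy (h.trans h01).le, R.eP_one y hy h]
  have hutil : ∀ s ⊆ E.types, EqOn (fun y => max (y - m.loss E y) (E.uA (m.eA y)))
      (m.utility E) s := fun s hs y hy => (hm.utility_eq hE (hs hy)).symm
  have hb1 : y₁ ≤ E.xhi := (R.lt₁₄.trans h45).le.trans hhi
  have hs1 : Icc E.xlo y₁ ⊆ E.types := Icc_subset_Icc_right hb1
  have hs2 : Icc y₁ E.xhi ⊆ E.types := Icc_subset_Icc_left (hlo.trans h01.le)
  have hU1 := (R.utility_antitoneOn hS hE).congr (hutil _ hs1)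
  have hU2 := (R.utility_strictMonoOn hS).congr (hutil _ hs2)
  rw [hInf, hSup, csInf_Ioo h12, csSup_Ioo h12, csInf_Icc h23.le, csSup_Icc h23.le, csInf_Ioc h34,
    csSup_Ioc h34, csInf_Ioo h45, csSup_Ioo h45]
  refine ⟨⟨⟨fun x hx y hy z hz => ?_⟩, ordConnected_Ioo, ordConnected_Icc, ordConnected_Ioc,
    ordConnected_Ioo⟩, ⟨?_, ?_, ?_, ?_, ?_⟩, ⟨rfl, rfl, rfl, rfl⟩, ?_, ?_, ?_, ?_, ?_, ?_, ?_, ?_⟩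
  · have hzI : z ∈ Icc y₀ y₁ := ⟨hx.1.1.trans hz.1, hz.2.trans hy.1.2⟩
    have h5 := (R.lt₁₄.trans h45).le
    exact ⟨hzI, (hanti (hX hx.1.1 (hx.1.2.trans h5)) (hX hzI.1 (hzI.2.trans h5)) hz.1).trans_lt
      hx.2⟩
  · refine Set.Nonempty.mono (interior_mono hIoc) ?_
    rw [interior_Ioc]
    exact nonempty_Ioo.2 h01
  · rw [interior_Ioo]
    exact nonempty_Ioo.2 h12
  · rw [interior_Icc]
    exact nonempty_Ioo.2 h23
  · rw [interior_Ioc]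
    exact nonempty_Ioo.2 h34
  · rw [interior_Ioo]
    exact nonempty_Ioo.2 h45
  · ext y
    constructor
    · have key : ∀ {y}, y₀ < y → y < y₅ → y ∈ E.types ∧ m.eP y ∈ Ioo (0 : ℝ) 1 := fun h h' =>
        ⟨hX h.le h'.le, R.eP_pos hS hE (hX h.le h'.le) h', R.eP_lt_one hS hE h h'⟩
      rintro ((((h | h) | h) | h) | h)
      · have h5 := h.1.2.trans_lt (R.lt₁₄.trans h45)
        have hyX := hX h.1.1 h5.le
        exact ⟨hyX, R.eP_pos hS hE hyX h5, h.2⟩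
      · exact key (by linarith [h.1]) (by linarith [h.2])
      · exact key (by linarith [h.1]) (by linarith [h.2])
      · exact key (by linarith [h.1]) (by linarith [h.2])
      · exact key (by linarith [h.1]) (by linarith [h.2])
    · rintro ⟨hy, hp⟩
      have h0 : y₀ ≤ y := by
        by_contra! h
        exact hp.2.ne (R.eP_one y hy h)
      have h5 : y < y₅ := by
        by_contra! h
        exact hp.1.ne' (R.zero y ⟨h, hy.2⟩).2
      rcases le_or_gt y y₁ with h1 | h1
      · exact Or.inl (Or.inl (Or.inl (Or.inl ⟨⟨h0, h1⟩, hp.2⟩)))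
      rcases lt_or_ge y y₂ with h2 | h2
      · exact Or.inl (Or.inl (Or.inl (Or.inr ⟨h1, h2⟩)))
      rcases le_or_gt y y₃ with h3 | h3
      · exact Or.inl (Or.inl (Or.inr ⟨h2, h3⟩))
      rcases le_or_gt y y₄ with h4 | h4
      · exact Or.inl (Or.inr ⟨h3, h4⟩)
      · exact Or.inr ⟨h4, h5⟩
  · refine ⟨?_, ?_, ?_, ?_, ?_, ?_, ?_, ?_, ?_, ?_⟩ <;>
      refine Set.disjoint_left.2 fun y hy hy' => ?_ <;>
      simp only [mem_ofPred_eq, mem_Icc, mem_Ioo, mem_Ioc] at hy hy' <;> linarith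
  · refine ⟨fun y hy => R.eP_one y ⟨hy.1, hy.2.le.trans R.mem₀.2⟩ hy.2, hanti, ?_,
      fun y hy => (R.zero y hy).2, fun y hy hne => ?_, R.eP_continuousOn hS hE y₀ ⟨le_rfl, R.mem₀.2⟩⟩
    · have key : ∀ y ∈ {y | y ∈ Icc y₀ y₁ ∧ m.eP y < 1} ∪ Ioo y₁ y₂ ∪ Icc y₂ y₃ ∪ Ioc y₃ y₄,
          y ∈ Icc y₀ y₄ ∧ m.eP y < 1 := by
        have key' : ∀ {y}, y₀ < y → y ≤ y₄ → y ∈ Icc y₀ y₄ ∧ m.eP y < 1 := fun h h' =>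
          ⟨⟨h.le, h'⟩, R.eP_lt_one hS hE h (h'.trans_lt h45)⟩
        rintro y (((h | h) | h) | h)
        · exact ⟨⟨h.1.1, by linarith [h.1.2]⟩, h.2⟩
        · exact key' (by linarith [h.1]) (by linarith [h.2])
        · exact key' (by linarith [h.1]) (by linarith [h.2])
        · exact key' (by linarith [h.1]) (by linarith [h.2])
      intro y hy y' hy' h
      exact R.eP_lt_of_lt hS hE (key y hy).1.1 h (key y' hy').1.2 (key y hy).2
    · exact AuditEnv.Regimes.continuousWithinAt_types (R.eP_continuousOn hS hE)
        (fun x hx h x' hx' h' => by rw [R.eP_one x hx h, R.eP_one x' hx' h']) hy hne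
  · refine ⟨fun y hy z hz => ?_, ⟨R.eA_low_strictAntiOn hS hE,
      (R.eA_mid_strictMonoOn hS hE).mono Ioo_subset_Icc_self, R.eA_eff_strictAntiOn hS hE,
      (R.eA_high_strictMonoOn hS hE).mono Ioc_subset_Icc_self, R.eA_superHigh_strictAntiOn hS hE⟩,
      fun y hy => (R.zero y hy).1, ⟨fun y => E.effEffort (E.cP (m.eP y)), ?_, ?_, ?_, ?_, ?_⟩,
      fun y hy hne => ?_, R.eA_continuousOn hS hE y₀ ⟨le_rfl, R.mem₀.2⟩⟩
    · rw [heA y ⟨hy.1, hy.2.le.trans R.mem₀.2⟩ hy.2, heA z ⟨hz.1, hz.2.le.trans R.mem₀.2⟩ hz.2]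
    · exact fun y hy => TaxMechanism.isEfficientEffort_effEffort hE (hS.eP_mem hy)
    · exact fun y hy => R.eA_lt_eff hS hE ⟨hy.1, by linarith [hy.2]⟩ hy.2
    · exact fun y hy => R.eA_eff y hy
    · exact fun y hy => hS.effEffort_lt hE (R.high y hy)
    · intro y hy
      simp only
      rw [(R.zero y hy).1, (R.zero y hy).2, hE.cost_P.map_zero, hE.effEffort_zero]
    · exact AuditEnv.Regimes.continuousWithinAt_types (R.eA_continuousOn hS hE)
        (fun x hx h x' hx' h' => by rw [heA x hx h, heA x' hx' h']) hy hne
  · exact ⟨TaxMechanism.representative E m, TaxMechanism.representative_identified E m, hm.1.representative hE,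
      hm.representative_rN_monotoneOn hE R, fun y hy => hm.representative_rN_pos_iff hE R hy,
      hm.representative_rP_monotoneOn hE R, fun y hy => hm.representative_rP_pos_iff hE R hy,
      fun y hy => hm.representative_rP_eq_iff hE R hy⟩
  · refine ⟨hU1, ?_, (R.utility_strictAntiOn hS hE).congr (hutil _ fun y hy =>
      hX hy.1.1 (hy.1.2.trans (R.lt₁₄.trans h45).le)), hU2, ?_⟩
    · have key : ∀ y ∈ Icc E.xlo y₀ \ {y | y ∈ Icc y₀ y₁ ∧ m.eP y < 1},
          m.utility E y = E.uA (E.lowEffort (E.cP 1)) := by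
        intro y hy
        have hyX : y ∈ E.types := ⟨hy.1.1, hy.1.2.trans R.mem₀.2⟩
        have hp : m.eP y = 1 := by
          rcases hy.1.2.eq_or_lt with rfl | h
          · by_contra hne
            exact hy.2 ⟨⟨le_rfl, h01.le⟩, lt_of_le_of_ne (hS.eP_mem hyX).2 hne⟩
          · exact R.eP_one y hyX h
        rw [hm.utility_eq hE hyX, max_eq_right (R.gap_le hyX (hy.1.2.trans h01.le)),
          R.eA_low y hyX (hy.1.2.trans h01.le), hp]
      intro y hy z hz
      rw [key y hy, key z hz]
    · have h1X : y₁ ∈ E.types := ⟨hlo.trans h01.le, hb1⟩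
      -- The bottom of the v is at `y₁ = sup SL`, where utility is at least the gap, which is
      -- positive beyond `y₀`.
      refine ⟨m.utility E y₁, ?_, fun y hy => ?_⟩
      · rw [hm.utility_eq hE h1X]
        exact lt_max_of_lt_left (sub_pos.2 (R.lam_lt y₁ h1X h01))
      · rcases le_total y y₁ with h | h
        · exact hU1 ⟨hy.1, h⟩ ⟨h1X.1, le_rfl⟩ h
        · exact hU2.monotoneOn ⟨le_rfl, hb1⟩ ⟨h, hy.2⟩ h
  · refine ⟨fun y hy => ?_, fun y hy => ?_⟩
    · have hyX : y ∈ E.types := ⟨hy.1, hy.2.le.trans hb1⟩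
      rw [hm.utility_eq hE hyX]
      exact lt_max_of_lt_right (R.gap_lt y hyX hy.2)
    · rw [hm.utility_eq hE (hs2 hy), max_eq_left (R.uA_le_gap (hs2 hy) hy.1)]
  · exact hm.profit_monotoneOn hE
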